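/- Let $k$ be a field of characteristic zero. All vector spaces are bigraded, $V=\bigoplus_{p,q\in\mathbb Z}V^{p,q}$ ($p$ the cohomological, $q$ the internal degree), with Koszul signs governed by the parity $p+q \bmod 2$; the dual is $(\overline V)^{p,q}=(V^{-p,-q})^*$, and $V[n]^{p,q}=V^{p+n,q}$. An $L_\infty$ algebra $\mathfrak a$ has graded antisymmetric brackets $\mu_n:\wedge^n\mathfrak a\to\mathfrak a$, $n\ge 1$, of bidegree $(2-n,0)$ satisfying the higher Jacobi identities. It is minimal if $\mu_1=0$, and a strict Lie algebra if $\mu_n=0$ for all $n\neq 2$. A free Lie algebra $F[V]$ is a strict Lie algebra with the universal property of the free bigraded Lie superalgebra on a bigraded subspace $V$. The Chevalley–Eilenberg cochains $C^\bullet(\mathfrak a)=\widehat{\mathrm{Sym}}^\bullet(\overline{\mathfrak a}[-1])$ (in each bidegree, the families $(\omega_n)_{n\ge0}$ of graded symmetric $n$-linear forms on $\mathfrak a[1]$ of that bidegree) carry the differential dual to $\sum_n\mu_n$; $H^\bullet(\mathfrak a)$ is their cohomology, $k\subset H^\bullet(\mathfrak a)$ consists of the classes of constants, and $H^{(1)}(\mathfrak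 a)\subset H^\bullet(\mathfrak a)$ of the classes that have a representative in $\overline{\mathfrak a}[-1]$, i.e. one that is linear in the generators. **Proposition.** Let $\mathfrak a$ be a minimal $L_\infty$ algebra concentrated in positive internal degrees, with every $\mathfrak a^{p,q}$ finite-dimensional. 1. If $\mathfrak a$ is a strict Lie algebra, then $\mathfrak a$ is freely generated (that is, free on some bigraded subspace) if and only if $H^\bullet(\mathfrak a)=k\oplus H^{(1)}(\mathfrak a)$. In particular, this equality holds whenever $\mathfrak a$ is a freely generated strict Lie algebra. 2. In general, $H^\bullet(\mathfrak a)=k\oplus H^{(1)}(\mathfrak a)$ if and only if $\mathfrak a$ is $L_\infty$-isomorphic to the freely generated strict Lie algebra $F[V]$ on a bigraded space $V$ with $\overline V[-1]\cong H^{(1)}(\mathfrak a)$. -/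

import Mathlib

universe u v

open Finset

/-- The parity `p + q mod 2` of an element of bidegree `(p, q)`; here `p` is the cohomological
degree and `q` the internal degree. -/
def parity (i : ℤ × ℤ) : ZMod 2 := ((i.1 + i.2 : ℤ) : ZMod 2)

/-- The sign `(-1)^e`. -/
def paritySign (e : ZMod 2) : ℤ := if e = 0 then 1 else -1

/-- The Koszul sign of stably sorting `x_0, …, x_{n-1}` (with parities `e`) by increasing label
`c`: every pair `i < j` whose labels are in the wrong order contributes `(-1)^(e_i * e_j)`.
With `e = 1` this is `(-1)` to the number of such pairs, that is, the ordinary sign. -/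
def koszulSign {ι : Type*} [LinearOrder ι] {n : ℕ} (c : Fin n → ι) (e : Fin n → ZMod 2) : ℤ :=
  ∏ p : Fin n × Fin n with p.1 < p.2 ∧ c p.2 < c p.1, paritySign (e p.1 * e p.2)

/-- The labels that move the entries in `S` in front of the other entries (an unshuffle). -/
def splitLabel {n : ℕ} (S : Finset (Fin n)) (j : Fin n) : Fin 2 := if j ∈ S then 0 else 1

/-- The subfamily of `x` indexed by `S`, in increasing order. -/
def pick {A : Type*} {n : ℕ} (S : Finset (Fin n)) (x : Fin n → A) : Fin #S → A :=
  fun t => x (S.orderEmbOfFin rfl t)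

/-- The Koszul sign `(-1)^(∑ j, (n - 1 - j) * e j)` of the décalage
`(s x_0) ⋯ (s x_{n-1}) ↦ s (x_0 ⋯ x_{n-1})`. -/
def decalageSign {n : ℕ} (e : Fin n → ZMod 2) : ℤ :=
  ∏ j : Fin n, paritySign (e j) ^ (n - 1 - (j : ℕ))

/-- An `L_∞` structure on the vector space `A`: a bigrading `A = ⨁ A^{p,q}` and brackets
`μ_n : ⋀^n A → A` of bidegree `(2 - n, 0)`, `n ≥ 1`, that are graded antisymmetric and satisfy the
higher Jacobi identities
`∑_{i+j=n} ∑_σ (-1)^{ij} χ(σ; x) μ_{j+1}(μ_i(x_{σ(1)}, …, x_{σ(i)}), x_{σ(i+1)}, …, x_{σ(n)}) = 0`,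
`σ` running over the `(i, j)`-unshuffles, i.e. over the subsets `S` of `Fin n` with `i` elements,
and `χ` being the sign of `σ` times its Koszul sign. (The term with `i = 0` vanishes.) -/
structure LInftyAlg (k : Type u) [Field k] (A : Type v) [AddCommGroup A] [Module k A] where
  gr : ℤ × ℤ → Submodule k A
  isInternal : DirectSum.IsInternal gr
  br : (n : ℕ) → MultilinearMap k (fun _ : Fin n => A) A
  br_zero : br 0 = 0
  br_mem : ∀ (n : ℕ) (d : Fin n → ℤ × ℤ) (x : Fin n → A), (∀ j, x j ∈ gr (d j)) →
    br n x ∈ gr (∑ j, d j + (2 - (n : ℤ), 0))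
  br_antisymm : ∀ (n : ℕ) (d : Fin n → ℤ × ℤ) (x : Fin n → A), (∀ j, x j ∈ gr (d j)) →
    ∀ σ : Equiv.Perm (Fin n), br n (x ∘ σ) =
      ((Equiv.Perm.sign σ : ℤ) * koszulSign σ.symm (fun j => parity (d j))) • br n x
  jacobi : ∀ (n : ℕ) (d : Fin n → ℤ × ℤ) (x : Fin n → A), (∀ j, x j ∈ gr (d j)) →
    ∑ S : Finset (Fin n),
      ((-1) ^ (#S * #Sᶜ) * koszulSign (splitLabel S) (fun _ => 1) *
          koszulSign (splitLabel S) (fun j => parity (d j))) •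
        br (#Sᶜ + 1) (Fin.cons (br #S (pick S x)) (pick Sᶜ x)) = 0

namespace LInftyAlg

section

variable {k : Type u} [Field k] {A : Type v} [AddCommGroup A] [Module k A]

/-- The 1-bracket (the differential) vanishes. -/
def IsMinimal (a : LInftyAlg k A) : Prop := a.br 1 = 0

/-- Only the 2-bracket is nonzero: `a` is a bigraded Lie (super)algebra with zero differential. -/
def IsStrictLie (a : LInftyAlg k A) : Prop := ∀ n, n ≠ 2 → a.br n = 0

/-- `a` is concentrated in positive internal degrees. -/
def IsPositive (a : LInftyAlg k A) : Prop := ∀ i : ℤ × ℤ, i.2 ≤ 0 → a.gr i = ⊥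

/-- `a` is the free Lie (super)algebra `F[V]` on its bigraded subspace `V = ⨁ V^{p,q}`: it is a
strict Lie algebra, and every bidegree-preserving linear map from `V` to a bigraded Lie
superalgebra extends uniquely to a bidegree-preserving Lie homomorphism. -/
def IsFreeLieOn (a : LInftyAlg k A) (V : ℤ × ℤ → Submodule k A) : Prop :=
  a.IsStrictLie ∧ (∀ i, V i ≤ a.gr i) ∧
    ∀ (B : Type v) [AddCommGroup B] [Module k B] (b : LInftyAlg k B), b.IsStrictLie →
      ∀ φ : (i : ℤ × ℤ) → V i →ₗ[k] B, (∀ i y, φ i y ∈ b.gr i) →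
        ∃! F : A →ₗ[k] B, (∀ i, ∀ x ∈ a.gr i, F x ∈ b.gr i) ∧
          (∀ x y, F (a.br 2 ![x, y]) = b.br 2 ![F x, F y]) ∧
          ∀ i (y : V i), F y = φ i y

theorem bijective_coe (a : LInftyAlg k A) : Function.Bijective (DirectSum.coeLinearMap a.gr) :=
  a.isInternal

/-- The projection of `A` onto its part of parity `e`. -/
noncomputable def parityProj (a : LInftyAlg k A) (e : ZMod 2) : A →ₗ[k] A :=
  (DirectSum.toModule k (ℤ × ℤ) A fun i => if parity i = e then (a.gr i).subtype else 0) ∘ₗ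
    (LinearEquiv.ofBijective (DirectSum.coeLinearMap a.gr) a.bijective_coe).symm.toLinearMap

/-- The bracket `μ_n` transported to the suspension `A[1]`: on homogeneous elements,
`(x_0, …, x_{n-1}) ↦ (-1)^{∑ (n - 1 - j) |x_j|} μ_n(x_0, …, x_{n-1})`. It is graded symmetric
for the shifted parities `|x| + 1`. -/
noncomputable def shiftBr (a : LInftyAlg k A) (n : ℕ) : MultilinearMap k (fun _ : Fin n => A) A :=
  ∑ e : Fin n → ZMod 2,
    decalageSign e • (a.br n).compLinearMap (fun j => a.parityProj (e j))

/-- Families `(ω_n)` of `n`-linear forms, before imposing symmetry and homogeneity. -/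
def Forms (k : Type u) [Field k] (A : Type v) [AddCommGroup A] [Module k A] : Type (max u v) :=
  (n : ℕ) → MultilinearMap k (fun _ : Fin n => A) k

noncomputable instance : AddCommGroup (Forms k A) :=
  inferInstanceAs (AddCommGroup ((n : ℕ) → MultilinearMap k (fun _ : Fin n => A) k))

noncomputable instance : Module k (Forms k A) :=
  inferInstanceAs (Module k ((n : ℕ) → MultilinearMap k (fun _ : Fin n => A) k))

@[simp] theorem Forms.add_apply (ω η : Forms k A) (n : ℕ) : (ω + η) n = ω n + η n := rfl

@[simp] theorem Forms.zero_apply (n : ℕ) : (0 : Forms k A) n = 0 := rfl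

@[simp] theorem Forms.smul_apply (c : k) (ω : Forms k A) (n : ℕ) : (c • ω) n = c • ω n := rfl

/-- The Chevalley–Eilenberg cochains `C^{p,q}` of bidegree `(p, q)`: families of forms on
`A[1]`, graded symmetric for the shifted parity, where `ω_n` vanishes on homogeneous elements
unless their total bidegree in `A[1]` is `(-p, -q)`. The arity `n` part is the part of bidegree
`(p, q)` of the `n`-th symmetric power of the shifted dual of `A`. -/
def cochains (a : LInftyAlg k A) (p q : ℤ) : Submodule k (Forms k A) where
  carrier := {ω | ∀ (n : ℕ) (d : Fin n → ℤ × ℤ) (x : Fin n → A), (∀ j, x j ∈ a.gr (d j)) →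
    (∀ σ : Equiv.Perm (Fin n),
      ω n (x ∘ σ) = koszulSign σ.symm (fun j => parity (d j) + 1) • ω n x) ∧
    (∑ j, (d j + (-1, 0)) ≠ (-p, -q) → ω n x = 0)}
  add_mem' := by
    intro ω η hω hη n d x hx
    refine ⟨fun σ => ?_, fun h => ?_⟩
    · simp [(hω n d x hx).1 σ, (hη n d x hx).1 σ]
    · simp [(hω n d x hx).2 h, (hη n d x hx).2 h]
  zero_mem' := by
    intro n d x hx
    simp
  smul_mem' := by
    intro c ω hω n d x hx
    refine ⟨fun σ => ?_, fun h => ?_⟩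
    · simp [(hω n d x hx).1 σ, mul_left_comm]
    · simp [(hω n d x hx).2 h]

/-- The multilinear form `x ↦ ω_{#Sᶜ + 1}(m_{#S}(x_S), x_{Sᶜ})`, `m` being the shifted brackets. -/
noncomputable def insertBr (a : LInftyAlg k A) (ω : Forms k A) {n : ℕ} (S : Finset (Fin n)) :
    MultilinearMap k (fun _ : Fin n => A) k :=
  (MultilinearMap.uncurrySum
    ((ω (#Sᶜ + 1)).curryLeft.compMultilinearMap (a.shiftBr #S))).domDomCongr
      (finSumEquivOfFinset (s := S) rfl rfl)

theorem insertBr_apply (a : LInftyAlg k A) (ω : Forms k A) {n : ℕ} (S : Finset (Fin n))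
    (x : Fin n → A) :
    a.insertBr ω S x = ω (#Sᶜ + 1) (Fin.cons (a.shiftBr #S (pick S x)) (pick Sᶜ x)) := by
  simp only [insertBr, MultilinearMap.domDomCongr_apply, MultilinearMap.uncurrySum_apply,
    LinearMap.compMultilinearMap_apply, MultilinearMap.curryLeft_apply]
  rfl

/-- The arity `n` component of the Chevalley–Eilenberg differential of `ω`: on homogeneous elements,
`(d ω)_n(x) = ∑_S ε(S; x) ω_{#Sᶜ + 1}(m_{#S}(x_S), x_{Sᶜ})`, with the Koszul sign `ε` taken
with respect to the shifted parities (see `ceDiff_apply`). -/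
noncomputable def ceForm (a : LInftyAlg k A) (ω : Forms k A) (n : ℕ) :
    MultilinearMap k (fun _ : Fin n => A) k :=
  ∑ e : Fin n → ZMod 2, ∑ S : Finset (Fin n),
    koszulSign (splitLabel S) (fun j => e j + 1) •
      (a.insertBr ω S).compLinearMap (fun j => a.parityProj (e j))

/-- The Chevalley–Eilenberg differential, dual to the sum of the brackets. -/
noncomputable def ceDiff (a : LInftyAlg k A) : Forms k A →ₗ[k] Forms k A where
  toFun ω n := a.ceForm ω n
  map_add' := by
    intro ω η
    funext n
    ext x
    change a.ceForm (ω + η) n x = a.ceForm ω n x + a.ceForm η n x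
    simp [ceForm, insertBr_apply, Finset.sum_add_distrib]
  map_smul' := by
    intro c ω
    funext n
    ext x
    change a.ceForm (c • ω) n x = c • a.ceForm ω n x
    simp [ceForm, insertBr_apply, Finset.mul_sum, mul_left_comm]

theorem parityProj_of_mem (a : LInftyAlg k A) (e : ZMod 2) {i : ℤ × ℤ} {x : A}
    (hx : x ∈ a.gr i) : a.parityProj e x = if e = parity i then x else 0 := by
  have h : (LinearEquiv.ofBijective (DirectSum.coeLinearMap a.gr) a.bijective_coe).symm x =
      DirectSum.lof k (ℤ × ℤ) (fun i => a.gr i) i ⟨x, hx⟩ := by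
    rw [LinearEquiv.symm_apply_eq]
    exact (DirectSum.coeLinearMap_lof a.gr i ⟨x, hx⟩).symm
  simp only [parityProj, LinearMap.comp_apply, LinearEquiv.coe_coe, h, DirectSum.toModule_lof]
  by_cases he : e = parity i
  · simp [he]
  · simp [he, Ne.symm he]

theorem shiftBr_apply (a : LInftyAlg k A) (n : ℕ) (d : Fin n → ℤ × ℤ) (x : Fin n → A)
    (hx : ∀ j, x j ∈ a.gr (d j)) :
    a.shiftBr n x = decalageSign (fun j => parity (d j)) • a.br n x := by
  simp only [shiftBr, _root_.sum_apply, _root_.smul_apply,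
    MultilinearMap.compLinearMap_apply]
  rw [Finset.sum_eq_single fun j => parity (d j)]
  · simp [parityProj_of_mem a _ (hx _)]
  · intro e _ he
    obtain ⟨j, hj⟩ := Function.ne_iff.mp he
    rw [MultilinearMap.map_coord_zero _ j, smul_zero]
    rw [parityProj_of_mem a _ (hx j), if_neg hj]
  · simp

theorem ceDiff_apply (a : LInftyAlg k A) (ω : Forms k A) (n : ℕ) (d : Fin n → ℤ × ℤ)
    (x : Fin n → A) (hx : ∀ j, x j ∈ a.gr (d j)) :
    a.ceDiff ω n x = ∑ S : Finset (Fin n),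
      koszulSign (splitLabel S) (fun j => parity (d j) + 1) •
        ω (#Sᶜ + 1) (Fin.cons (a.shiftBr #S (pick S x)) (pick Sᶜ x)) := by
  change a.ceForm ω n x = _
  simp only [ceForm, _root_.sum_apply, _root_.smul_apply,
    MultilinearMap.compLinearMap_apply]
  rw [Finset.sum_eq_single fun j => parity (d j)]
  · simp [parityProj_of_mem a _ (hx _), insertBr_apply]
  · intro e _ he
    obtain ⟨j, hj⟩ := Function.ne_iff.mp he
    refine Finset.sum_eq_zero fun S _ => ?_
    rw [MultilinearMap.map_coord_zero _ j, smul_zero]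
    rw [parityProj_of_mem a _ (hx j), if_neg hj]
  · simp

/-- The cocycles of bidegree `(p, q)`. -/
noncomputable def cocycles (a : LInftyAlg k A) (p q : ℤ) : Submodule k (Forms k A) :=
  a.cochains p q ⊓ LinearMap.ker a.ceDiff

/-- The coboundaries of bidegree `(p, q)`. -/
noncomputable def coboundaries (a : LInftyAlg k A) (p q : ℤ) : Submodule k (Forms k A) :=
  (a.cochains (p - 1) q).map a.ceDiff

/-- The cohomology `H^{p,q}(a)` of the Chevalley–Eilenberg complex. -/
abbrev Cohomology (a : LInftyAlg k A) (p q : ℤ) : Type (max u v) :=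
  a.cocycles p q ⧸ (a.coboundaries p q).comap (a.cocycles p q).subtype

/-- The families of forms that are concentrated in arity `m`. -/
def arityPart (k : Type u) [Field k] (A : Type v) [AddCommGroup A] [Module k A] (m : ℕ) :
    Submodule k (Forms k A) where
  carrier := {ω | ∀ n, n ≠ m → ω n = 0}
  add_mem' := by
    intro ω η hω hη n hn
    simp [hω n hn, hη n hn]
  zero_mem' := by
    intro n hn
    simp
  smul_mem' := by
    intro c ω hω n hn
    simp [hω n hn]

/-- The classes in `H^{p,q}(a)` that have a representative concentrated in arity `m`: for `m = 0`
these are the classes of constants, for `m = 1` they form the linear cohomology `H^{(1)}(a)`. -/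
noncomputable def arityCohomology (a : LInftyAlg k A) (m : ℕ) (p q : ℤ) :
    Submodule k (a.Cohomology p q) :=
  ((arityPart k A m).comap (a.cocycles p q).subtype).map
    (Submodule.mkQ ((a.coboundaries p q).comap (a.cocycles p q).subtype))

/-- `H^•(a) = k ⊕ H^{(1)}(a)`. -/
def CohomologyIsLinear (a : LInftyAlg k A) : Prop :=
  ∀ p q : ℤ, IsCompl (a.arityCohomology 0 p q) (a.arityCohomology 1 p q)

end

end LInftyAlg

/-- An `L_∞` morphism `a → b`: maps `f_n : ⋀^n A → B` of bidegree `(1 - n, 0)`, written as graded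
symmetric maps of bidegree `(0, 0)` on the suspensions, that commute with the (shifted) brackets:
`∑_S ε f_{#Sᶜ + 1}(m_{#S}(x_S), x_{Sᶜ})` equals the sum of `ε m_r(f(x_{c⁻¹ 0}), …, f(x_{c⁻¹ (r-1)}))`
over all partitions of `Fin n` into `r` nonempty blocks, for all `r`. The factor `1 / r!` is there
as `c` runs over the ordered partitions. -/
structure LInftyHom {k : Type u} [Field k] {A B : Type v} [AddCommGroup A] [Module k A]
    [AddCommGroup B] [Module k B] (a : LInftyAlg k A) (b : LInftyAlg k B) where
  f : (n : ℕ) → MultilinearMap k (fun _ : Fin n => A) B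
  f_zero : f 0 = 0
  f_mem : ∀ (n : ℕ) (d : Fin n → ℤ × ℤ) (x : Fin n → A), (∀ j, x j ∈ a.gr (d j)) →
    f n x ∈ b.gr (∑ j, d j + (1 - (n : ℤ), 0))
  f_symm : ∀ (n : ℕ) (d : Fin n → ℤ × ℤ) (x : Fin n → A), (∀ j, x j ∈ a.gr (d j)) →
    ∀ σ : Equiv.Perm (Fin n),
      f n (x ∘ σ) = koszulSign σ.symm (fun j => parity (d j) + 1) • f n x
  f_br : ∀ (n : ℕ) (d : Fin n → ℤ × ℤ) (x : Fin n → A), (∀ j, x j ∈ a.gr (d j)) →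
    ∑ S : Finset (Fin n), koszulSign (splitLabel S) (fun j => parity (d j) + 1) •
        f (#Sᶜ + 1) (Fin.cons (a.shiftBr #S (pick S x)) (pick Sᶜ x)) =
      ∑ r ∈ range (n + 1), ((r.factorial : k)⁻¹) •
        ∑ c : Fin n → Fin r with Function.Surjective c,
          koszulSign c (fun j => parity (d j) + 1) •
            b.shiftBr r (fun t => f _ (pick (univ.filter fun j => c j = t) x))

/-- An `L_∞` morphism is an isomorphism if and only if its linear part is bijective. -/
def LInftyHom.IsIso {k : Type u} [Field k] {A B : Type v} [AddCommGroup A] [Module k A]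
    [AddCommGroup B] [Module k B] {a : LInftyAlg k A} {b : LInftyAlg k B}
    (f : LInftyHom a b) : Prop :=
  Function.Bijective fun x : A => f.f 1 (fun _ => x)

/-! ### Signs -/

/-! Write `quad` for the Lie algebra carried by the binary bracket of the minimal algebra `a`; it
satisfies Jacobi because μ₁ = 0 removes every other term of the arity three identity. The central
notion is `IsExactAt`: closed cochains of a given internal degree without components in arities 0
and 1 are exact.

Free Lie algebras are exact (`isExactAt_of_free`). Let N be the span of the nonempty words in a
basis of V, that is, the augmentation ideal of the tensor algebra T(V). It is a right module over
the free algebra A, and it is free over T(V) on the one-letter words. Forms on the semidirect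
product A ⋉ N that are linear in N are cochains with values in the dual of N. Freeness of N makes
the closed ones without arity one part exact (`exists_primitive_of_contr`, a descent on word
length). The universal property gives a derivation D : A → N that multiplies each generator by its
internal degree, hence a Lie map F = (id, D) : A → A ⋉ N, and the iterated bracket N → A composed
with D is multiplication by the internal degree, as in the Dynkin–Specht–Wever theorem
(`wordBrMap_section`). A closed form ω of internal degree -w extends to a closed η linear in N with
F^*η = wω, so a primitive of η pulls back to a primitive of wω. Only the extension property, and
generation in internal degrees below w, are used at this weight.

Exactness produces morphisms. An L∞ morphism into a strict Lie algebra is a solution τ of the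
Maurer–Cartan equation dτ = ½[τ, τ]. In each internal degree the right side depends only on τ in
lower degrees and is closed, so `exists_lInftyHom` solves the equation degree by degree, with the
linear part prescribed on a complement V of the brackets. The linear part of the solution is a Lie
homomorphism on `quad` (`LInftyHom.linear_lie`).

Suppose the cohomology is linear. Then `a` is exact, so every graded map from V to a strict Lie
algebra extends to `quad`. That V generates `quad` follows by induction on the internal degree
(`quad_generated`): a linear form killing V and the binary brackets can be completed by terms of
higher arity to a cocycle of `a`, hence is itself closed and kills all brackets, so it is zero. Thus
`quad` is free on V, and the morphism from `a` to `quad` that is the inclusion on V has the identity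
as its linear part.

Conversely, an isomorphism from `a` to a free l identifies `quad` with l, so `quad` is free and
exact. Exactness passes to `a` by correcting leading components one arity at a time
(`exists_primitive_of_quad`). It remains to see that linear components of cocycles are closed: the
closed linear forms of `a` lie among those of `quad`, which embed in the dual of V, and H^(1) ≅ V^*
with finite dimension forces equality. Part 1 is the case `quad = a`. -/

theorem paritySign_add (a b : ZMod 2) : paritySign (a + b) = paritySign a * paritySign b := by
  revert a b; decide

theorem paritySign_zero : paritySign 0 = 1 := rfl

theorem paritySign_mul_self (a : ZMod 2) : paritySign a * paritySign a = 1 := by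
  revert a; decide

theorem paritySign_sum {α : Type*} (s : Finset α) (f : α → ZMod 2) :
    paritySign (∑ i ∈ s, f i) = ∏ i ∈ s, paritySign (f i) := by
  classical
  induction s using Finset.induction_on with
  | empty => rfl
  | insert a s ha ih => rw [sum_insert ha, prod_insert ha, paritySign_add, ih]

theorem parity_add (i j : ℤ × ℤ) : parity (i + j) = parity i + parity j := by
  simp only [parity, Prod.fst_add, Prod.snd_add]; push_cast; ring

theorem parity_sum {α : Type*} (s : Finset α) (d : α → ℤ × ℤ) :
    parity (∑ i ∈ s, d i) = ∑ i ∈ s, parity (d i) := by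
  classical
  induction s using Finset.induction_on with
  | empty => simp [parity]
  | insert a s ha ih => rw [sum_insert ha, sum_insert ha, parity_add, ih]

/-- The product of `f a b` over all pairs `a < b`. -/
def pairProd {n : ℕ} (f : Fin n → Fin n → ℤ) : ℤ :=
  ∏ p : Fin n × Fin n with p.1 < p.2, f p.1 p.2

theorem pairProd_congr {n : ℕ} {f g : Fin n → Fin n → ℤ} (h : ∀ a b, a < b → f a b = g a b) :
    pairProd f = pairProd g :=
  prod_congr rfl fun p hp => h _ _ (mem_filter.1 hp).2

theorem pairProd_mul {n : ℕ} (f g : Fin n → Fin n → ℤ) :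
    pairProd f * pairProd g = pairProd fun a b => f a b * g a b :=
  prod_mul_distrib.symm

theorem pairProd_one {n : ℕ} : pairProd (fun _ _ : Fin n => 1) = 1 := by simp [pairProd]

/-- All signs are brought into the form of a product over pairs a < b of a factor depending on that
pair alone. An identity between signs then reduces, through `pairProd_mul` and `pairProd_congr`, to
a finite check of parities for a single pair. -/
theorem koszulSign_eq_pairProd {ι : Type*} [LinearOrder ι] {n : ℕ} (c : Fin n → ι)
    (e : Fin n → ZMod 2) :
    koszulSign c e = pairProd fun a b => if c b < c a then paritySign (e a * e b) else 1 := by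
  unfold koszulSign pairProd
  rw [← filter_filter, prod_filter]

/-- A permutation acts on unordered pairs; the conditional puts the image pair back into increasing
order. -/
theorem pairProd_perm {n : ℕ} (σ : Equiv.Perm (Fin n)) (f : Fin n → Fin n → ℤ) :
    pairProd f = pairProd fun a b =>
      if σ a < σ b then f (σ a) (σ b) else f (σ b) (σ a) := by
  have hne : ∀ {a b : Fin n}, a < b → σ a ≠ σ b := fun h h' => h.ne (σ.injective h')
  have hne' : ∀ {a b : Fin n}, a < b → σ.symm a ≠ σ.symm b := fun h h' => h.ne (σ.symm.injective h')
  refine prod_bij' (fun p _ => if σ.symm p.1 < σ.symm p.2 then (σ.symm p.1, σ.symm p.2) else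
      (σ.symm p.2, σ.symm p.1)) (fun p _ => if σ p.1 < σ p.2 then (σ p.1, σ p.2) else
      (σ p.2, σ p.1)) ?_ ?_ ?_ ?_ ?_ <;> rintro ⟨i, j⟩ h <;>
    simp only [mem_filter, mem_univ, true_and] at h ⊢
  · split_ifs with h1
    · exact h1
    · exact lt_of_le_of_ne (not_lt.1 h1) (hne' h).symm
  · split_ifs with h1
    · exact h1
    · exact lt_of_le_of_ne (not_lt.1 h1) (hne h).symm
  · split_ifs with h1 <;> simp_all [not_lt_of_gt]
  · split_ifs with h1 <;> simp_all [not_lt_of_gt]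
  · split_ifs with h1 <;> simp_all [not_lt_of_gt]

theorem pairProd_orderEmbOfFin {n : ℕ} (S : Finset (Fin n)) (f : Fin n → Fin n → ℤ) :
    pairProd (fun a b => f (S.orderEmbOfFin rfl a) (S.orderEmbOfFin rfl b)) =
      pairProd fun a b => if a ∈ S ∧ b ∈ S then f a b else 1 := by
  unfold pairProd
  rw [← prod_filter]
  refine prod_bij (fun (p : Fin #S × Fin #S) _ => (S.orderEmbOfFin rfl p.1, S.orderEmbOfFin rfl p.2)) ?_ ?_ ?_ ?_
  · rintro ⟨i, j⟩ h
    simp only [mem_filter, mem_univ, true_and] at h ⊢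
    exact ⟨by simpa using h, orderEmbOfFin_mem _ _ _, orderEmbOfFin_mem _ _ _⟩
  · rintro ⟨i, j⟩ _ ⟨i', j'⟩ _ h
    simpa using h
  · rintro ⟨i, j⟩ h
    simp only [mem_filter, mem_univ, true_and] at h
    obtain ⟨h1, h2, h3⟩ := h
    have hr := S.range_orderEmbOfFin rfl
    obtain ⟨a, rfl⟩ : i ∈ Set.range (S.orderEmbOfFin rfl) := by rw [hr]; exact h2
    obtain ⟨b, rfl⟩ : j ∈ Set.range (S.orderEmbOfFin rfl) := by rw [hr]; exact h3
    exact ⟨(a, b), by simpa using h1, rfl⟩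
  · intros; rfl

/-- This converts signs such as (-1)^(|x_S||x_T|), from moving one block past another, into pair
products. Disjointness ensures that every (s, t) is an honest pair, in one of the two orders. -/
theorem prod_prod_eq_pairProd {n : ℕ} (S T : Finset (Fin n)) (h : Disjoint S T)
    (g : Fin n → Fin n → ℤ) :
    ∏ s ∈ S, ∏ t ∈ T, g s t = pairProd fun a b =>
      (if a ∈ S ∧ b ∈ T then g a b else 1) * (if a ∈ T ∧ b ∈ S then g b a else 1) := by
  rw [← pairProd_mul, ← prod_product']
  rw [← prod_filter_mul_prod_filter_not (S ×ˢ T) fun p => p.1 < p.2]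
  congr 1
  · unfold pairProd
    rw [← prod_filter]
    refine prod_congr ?_ fun _ _ => rfl
    ext ⟨a, b⟩; simp; tauto
  · unfold pairProd
    rw [← prod_filter]
    refine prod_bij' (fun p _ => (p.2, p.1)) (fun p _ => (p.2, p.1)) ?_ ?_ ?_ ?_ ?_ <;>
      rintro ⟨a, b⟩ hab <;> simp only [mem_filter, mem_product, mem_univ, true_and] at hab ⊢
    · refine ⟨lt_of_le_of_ne (not_lt.1 hab.2) ?_, hab.1.2, hab.1.1⟩
      rintro rfl
      exact disjoint_left.1 h hab.1.1 hab.1.2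
    · exact ⟨⟨hab.2.2, hab.2.1⟩, not_lt.2 hab.1.le⟩

theorem pairProd_succ {n : ℕ} (f : Fin (n + 1) → Fin (n + 1) → ℤ) :
    pairProd f = (∏ j : Fin n, f 0 j.succ) * pairProd fun a b : Fin n => f a.succ b.succ := by
  unfold pairProd
  simp only [prod_filter, ← univ_product_univ, prod_product]
  rw [Fin.prod_univ_succ]
  congr 1
  · rw [Fin.prod_univ_succ]; simp
  · refine prod_congr rfl fun a _ => ?_
    rw [Fin.prod_univ_succ]; simp

theorem decalageSign_eq_pairProd {n : ℕ} (e : Fin n → ZMod 2) :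
    decalageSign e = pairProd fun a _ => paritySign (e a) := by
  unfold decalageSign pairProd
  simp only [prod_filter, ← univ_product_univ, prod_product]
  refine prod_congr rfl fun a _ => ?_
  rw [← prod_filter, prod_const]
  congr 1
  have : (univ.filter fun b : Fin n => a < b) = Ioi a := by ext; simp
  rw [this, Fin.card_Ioi]

theorem decalageSign_sq {n : ℕ} (e : Fin n → ZMod 2) : decalageSign e * decalageSign e = 1 := by
  rw [decalageSign_eq_pairProd, pairProd_mul]
  exact (pairProd_congr fun a b _ => paritySign_mul_self _).trans pairProd_one

theorem koszulSign_perm_symm {n : ℕ} (σ : Equiv.Perm (Fin n)) (e : Fin n → ZMod 2) :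
    koszulSign σ.symm e =
      pairProd fun a b => if σ b < σ a then paritySign (e (σ a) * e (σ b)) else 1 := by
  rw [koszulSign_eq_pairProd, pairProd_perm σ]
  refine pairProd_congr fun a b hab => ?_
  have : σ a ≠ σ b := fun h => hab.ne (σ.injective h)
  simp only [Equiv.symm_apply_apply]
  rcases lt_or_gt_of_ne this with h | h
  · simp [h, not_lt_of_gt h, not_lt_of_gt hab]
  · simp [h, not_lt_of_gt h, hab, mul_comm]

theorem sign_eq_pairProd {n : ℕ} (σ : Equiv.Perm (Fin n)) :
    (Equiv.Perm.sign σ : ℤ) = pairProd fun a b => if σ b < σ a then -1 else 1 := by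
  rw [σ.sign_eq_prod_prod_Ioi]
  unfold pairProd
  simp only [prod_filter, ← univ_product_univ, prod_product, Units.coe_prod]
  refine prod_congr rfl fun a _ => ?_
  rw [← prod_filter]
  refine prod_congr (by ext; simp) fun b hb => ?_
  have hab : a < b := by simpa using hb
  have : σ a ≠ σ b := fun h => hab.ne (σ.injective h)
  rcases lt_or_gt_of_ne this with h | h
  · simp [h, not_lt_of_gt h]
  · simp [h, not_lt_of_gt h]

/-! ### Subfamilies -/

section Pick

variable {X W : Type*}

/-- Here `pick S x` has `#S` entries and `x ∘ g` has `m`, which agree only propositionally. Testing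
against a family `ω` defined in every arity avoids casts. -/
theorem pick_eq_of_strictMono {n m : ℕ} {S : Finset (Fin n)} {g : Fin m → Fin n}
    (hg : StrictMono g) (hS : ∀ i, i ∈ S ↔ ∃ t, g t = i) (x : Fin n → X)
    (ω : (m : ℕ) → (Fin m → X) → W) : ω #S (pick S x) = ω m (x ∘ g) := by
  have hS' : S = univ.map ⟨g, hg.injective⟩ := by ext; simp [hS]
  have hm : m = #S := by rw [hS']; simp
  subst hm
  rw [orderEmbOfFin_unique (s := S) rfl (fun t => (hS _).2 ⟨t, rfl⟩) hg]
  rfl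

theorem pick_comp_strictMono {n m : ℕ} {S : Finset (Fin m)} {T : Finset (Fin n)}
    {g : Fin m → Fin n} (hg : StrictMono g) (hT : ∀ i, i ∈ T ↔ ∃ t ∈ S, g t = i) (x : Fin n → X)
    (ω : (m : ℕ) → (Fin m → X) → W) : ω #T (pick T x) = ω #S (pick S (x ∘ g)) := by
  refine (pick_eq_of_strictMono (g := fun t => g (S.orderEmbOfFin rfl t))
    (fun a b h => hg (by simpa using h)) ?_ x ω).trans rfl
  · intro i
    rw [hT]
    have hr := S.range_orderEmbOfFin rfl
    constructor
    · rintro ⟨t, ht, rfl⟩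
      obtain ⟨s, rfl⟩ : t ∈ Set.range (S.orderEmbOfFin rfl) := by rw [hr]; exact ht
      exact ⟨s, rfl⟩
    · rintro ⟨t, rfl⟩
      exact ⟨_, orderEmbOfFin_mem _ _ _, rfl⟩

theorem pick_univ {n : ℕ} (x : Fin n → X) (ω : (m : ℕ) → (Fin m → X) → W) :
    ω #(univ : Finset (Fin n)) (pick univ x) = ω n x :=
  pick_eq_of_strictMono strictMono_id (by simp) x ω

theorem pick_empty {n : ℕ} (x : Fin n → X) (ω : (m : ℕ) → (Fin m → X) → W) :
    ω #(∅ : Finset (Fin n)) (pick ∅ x) = ω 0 ![] := by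
  refine (pick_eq_of_strictMono (g := Fin.elim0) (fun a => a.elim0) (by simp) x ω).trans ?_
  congr 1
  exact Subsingleton.elim _ _

/-- A family of functions of finite sequences that is graded symmetric with respect to `par`. -/
def SymmFam (par : X → ZMod 2) [AddCommGroup W] (ω : (n : ℕ) → (Fin n → X) → W) : Prop :=
  ∀ (n : ℕ) (x : Fin n → X) (σ : Equiv.Perm (Fin n)),
    ω n (x ∘ σ) = koszulSign σ.symm (fun j => par (x j)) • ω n x

/-- An injection is a permutation followed by the increasing enumeration of its image, and the sign
collects the inversions of `g`. -/
theorem SymmFam.comp_injective {par : X → ZMod 2} [AddCommGroup W]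
    {ω : (n : ℕ) → (Fin n → X) → W} (h : SymmFam par ω) {m n : ℕ} (x : Fin n → X)
    {g : Fin m → Fin n} (hg : Function.Injective g) {S : Finset (Fin n)}
    (hS : ∀ i, i ∈ S ↔ ∃ t, g t = i) :
    ω m (x ∘ g) = (pairProd fun a b =>
      if g b < g a then paritySign (par (x (g a)) * par (x (g b))) else 1) • ω #S (pick S x) := by
  have hS' : S = univ.map ⟨g, hg⟩ := by ext; simp [hS]
  have hm : m = #S := by rw [hS']; simp
  subst hm
  have hr := S.range_orderEmbOfFin rfl
  have : ∀ t, ∃ s, S.orderEmbOfFin rfl s = g t := fun t => by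
    have : g t ∈ Set.range (S.orderEmbOfFin rfl) := by rw [hr]; exact (hS _).2 ⟨t, rfl⟩
    exact this
  choose π hπ using this
  have hinj : Function.Injective π := fun a b hab => hg (by rw [← hπ a, ← hπ b, hab])
  have hx : x ∘ g = pick S x ∘ Equiv.ofBijective π (Finite.injective_iff_bijective.1 hinj) := by
    ext t; simp [pick, hπ]
  rw [hx, h, koszulSign_perm_symm]
  congr 1
  refine pairProd_congr fun a b _ => ?_
  simp only [Equiv.ofBijective_apply, pick, hπ]
  have : (π b < π a) ↔ g b < g a := by rw [← hπ a, ← hπ b]; simp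
  simp only [this]

theorem sum_pick {M : Type*} [AddCommMonoid M] {n : ℕ} (S : Finset (Fin n)) (f : X → M)
    (x : Fin n → X) : ∑ t, f (pick S x t) = ∑ j ∈ S, f (x j) := by
  conv_rhs => rw [← map_orderEmbOfFin_univ S rfl, sum_map]
  rfl

theorem sum_finset_fin_succ {M : Type*} [AddCommMonoid M] {n : ℕ}
    (f : Finset (Fin (n + 1)) → M) :
    ∑ S, f S = ∑ T : Finset (Fin n), f (insert 0 (T.map (Fin.succEmb n))) +
      ∑ T : Finset (Fin n), f (T.map (Fin.succEmb n)) := by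
  rw [← sum_filter_add_sum_filter_not univ fun S : Finset (Fin (n + 1)) => (0 : Fin (n + 1)) ∈ S]
  congr 1
  · refine sum_bij' (fun S _ => univ.filter fun j : Fin n => j.succ ∈ S)
      (fun T _ => insert 0 (T.map (Fin.succEmb n))) ?_ ?_ ?_ ?_ ?_
    · simp
    · simp
    · intro S hS
      ext j
      refine Fin.cases ?_ (fun j => ?_) j
      · simpa using hS
      · simp [Fin.succ_ne_zero]
    · intro T _
      ext j
      simp [Fin.succ_ne_zero]
    · intro S hS
      congr 1
      ext j
      refine Fin.cases ?_ (fun j => ?_) j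
      · simpa using hS
      · simp [Fin.succ_ne_zero]
  · refine sum_bij' (fun S _ => univ.filter fun j : Fin n => j.succ ∈ S)
      (fun T _ => T.map (Fin.succEmb n)) ?_ ?_ ?_ ?_ ?_
    · simp
    · simp [Fin.succ_ne_zero]
    · intro S hS
      ext j
      refine Fin.cases ?_ (fun j => ?_) j
      · simpa [Fin.succ_ne_zero] using hS
      · simp
    · intro T _
      ext j
      simp
    · intro S hS
      congr 1
      ext j
      refine Fin.cases ?_ (fun j => ?_) j
      · simpa [Fin.succ_ne_zero] using hS
      · simp

end Pick

/-! ### Sums over unshuffles -/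

section Shuffle

variable {X W : Type*} [AddCommGroup W] (par : X → ZMod 2)

/-- The sum of `±Φ(x_S; x_{Sᶜ})` over all subsets `S`, with the Koszul signs of the unshuffles. -/
def shuf (Φ : (p q : ℕ) → (Fin p → X) → (Fin q → X) → W) {n : ℕ} (x : Fin n → X) : W :=
  ∑ S : Finset (Fin n), koszulSign (splitLabel S) (fun j => par (x j)) •
    Φ #S #Sᶜ (pick S x) (pick Sᶜ x)

theorem splitLabel_lt {n : ℕ} {S : Finset (Fin n)} {a b : Fin n} :
    splitLabel S b < splitLabel S a ↔ b ∈ S ∧ a ∉ S := by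
  unfold splitLabel
  by_cases ha : a ∈ S <;> by_cases hb : b ∈ S <;> simp [ha, hb]

theorem mem_iff_exists_orderEmbOfFin {n : ℕ} {S : Finset (Fin n)} {i : Fin n} :
    i ∈ S ↔ ∃ t, S.orderEmbOfFin rfl t = i := by
  conv_lhs => rw [← mem_coe, ← S.range_orderEmbOfFin rfl]
  rfl

variable {par}

/-- Reindex by S ↦ σ(S). Sorting each block costs the inversions of σ inside it, and the change of
unshuffle sign accounts for the inversions between the blocks. -/
theorem shuf_symm {Φ : (p q : ℕ) → (Fin p → X) → (Fin q → X) → W}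
    (h1 : ∀ q z, SymmFam par fun p y => Φ p q y z)
    (h2 : ∀ p y, SymmFam par fun q z => Φ p q y z) :
    SymmFam par fun _ x => shuf par Φ x := by
  intro n x σ
  simp only [shuf, smul_sum]
  refine sum_equiv (Equiv.finsetCongr σ) (by simp) fun S _ => ?_
  have hmem : ∀ i, i ∈ S.map σ.toEmbedding ↔ σ.symm i ∈ S := fun i => by
    simp [mem_map_equiv]
  have hS : ∀ i, i ∈ S.map σ.toEmbedding ↔ ∃ t, σ (S.orderEmbOfFin rfl t) = i := fun i => by
    rw [hmem, mem_iff_exists_orderEmbOfFin]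
    simp only [Equiv.eq_symm_apply]
  have hS' : ∀ i, i ∈ (S.map σ.toEmbedding)ᶜ ↔ ∃ t, σ (Sᶜ.orderEmbOfFin rfl t) = i := fun i => by
    rw [mem_compl, hmem, ← mem_compl, mem_iff_exists_orderEmbOfFin]
    simp only [Equiv.eq_symm_apply]
  simp only [Equiv.finsetCongr_apply]
  have e1 := (h1 _ (pick Sᶜ (x ∘ σ))).comp_injective x
    (g := fun t => σ (S.orderEmbOfFin rfl t)) (fun a b h => by simpa using h) hS
  have e2 := (h2 _ (pick (S.map σ.toEmbedding) x)).comp_injective x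
    (g := fun t => σ (Sᶜ.orderEmbOfFin rfl t)) (fun a b h => by simpa using h) hS'
  change _ • Φ _ _ (x ∘ fun t => σ (S.orderEmbOfFin rfl t)) (pick Sᶜ (x ∘ σ)) = _
  rw [e1]
  change _ • _ • Φ _ _ _ (x ∘ fun t => σ (Sᶜ.orderEmbOfFin rfl t)) = _
  rw [e2]
  simp only [smul_smul]
  congr 1
  rw [pairProd_orderEmbOfFin S fun a b =>
      if σ b < σ a then paritySign (par (x (σ a)) * par (x (σ b))) else 1,
    pairProd_orderEmbOfFin Sᶜ fun a b =>
      if σ b < σ a then paritySign (par (x (σ a)) * par (x (σ b))) else 1,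
    koszulSign_perm_symm, koszulSign_eq_pairProd, koszulSign_eq_pairProd, pairProd_perm σ
    (fun a b => if splitLabel (S.map σ.toEmbedding) b < splitLabel (S.map σ.toEmbedding) a then _
      else 1), pairProd_mul, pairProd_mul, pairProd_mul]
  refine pairProd_congr fun a b hab => ?_
  have hne : σ a ≠ σ b := fun h => hab.ne (σ.injective h)
  simp only [splitLabel_lt, hmem, Equiv.symm_apply_apply, mem_compl, Function.comp_apply]
  generalize par (x (σ a)) = ea
  generalize par (x (σ b)) = eb
  have h1 := paritySign_mul_self (ea * eb)
  rcases lt_or_gt_of_ne hne with h | h <;> by_cases ha : a ∈ S <;> by_cases hb : b ∈ S <;>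
    simp [h, ha, hb, not_lt_of_gt h, mul_comm eb ea, h1]

theorem shuf_nil (Φ : (p q : ℕ) → (Fin p → X) → (Fin q → X) → W) (x : Fin 0 → X) :
    shuf par Φ x = Φ 0 0 ![] ![] := by
  unfold shuf
  rw [Fintype.sum_eq_single ∅ (fun S hS => absurd (Subsingleton.elim _ _) hS)]
  have : koszulSign (splitLabel (∅ : Finset (Fin 0))) (fun j => par (x j)) = 1 := by
    simp [koszulSign]
  rw [this, one_smul]
  rw [pick_empty x fun p y => Φ p _ y _]
  refine (pick_comp_strictMono (S := ∅) (g := (id : Fin 0 → Fin 0)) strictMono_id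
    (fun i => i.elim0) x fun q z => Φ 0 q ![] z).trans ?_
  exact pick_empty x fun q z => Φ 0 q ![] z

theorem pick_insert_zero {n : ℕ} (T : Finset (Fin n)) (u : X) (x : Fin n → X)
    {W : Type*} (ω : (m : ℕ) → (Fin m → X) → W) :
    ω _ (pick (insert 0 (T.map (Fin.succEmb n))) (Fin.cons u x : Fin (n + 1) → X)) =
      ω (#T + 1) (Fin.cons u (pick T x)) := by
  refine (pick_eq_of_strictMono (g := Fin.cons 0 fun t => (T.orderEmbOfFin rfl t).succ)
    ?_ ?_ _ ω).trans ?_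
  · intro a b h
    revert h
    refine Fin.cases ?_ (fun a => ?_) a <;> refine Fin.cases ?_ (fun b => ?_) b <;> simp
  · intro i
    refine Fin.cases ?_ (fun i => ?_) i
    · simp only [mem_insert, true_or, true_iff]
      exact ⟨0, rfl⟩
    · simp [Fin.exists_fin_succ, Fin.succ_ne_zero, mem_iff_exists_orderEmbOfFin (S := T),
        (Fin.succ_ne_zero _).symm]
  · congr 1
    ext t
    refine Fin.cases rfl (fun t => rfl) t

theorem pick_map_succ {n : ℕ} (T : Finset (Fin n)) (u : X) (x : Fin n → X)
    {W : Type*} (ω : (m : ℕ) → (Fin m → X) → W) :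
    ω _ (pick (T.map (Fin.succEmb n)) (Fin.cons u x : Fin (n + 1) → X)) = ω #T (pick T x) :=
  pick_comp_strictMono (S := T) (g := Fin.succ) (Fin.strictMono_succ) (by simp) _ ω

theorem compl_insert_zero {n : ℕ} (T : Finset (Fin n)) :
    (insert 0 (T.map (Fin.succEmb n)))ᶜ = Tᶜ.map (Fin.succEmb n) := by
  ext j
  refine Fin.cases ?_ (fun j => ?_) j <;> simp [Fin.succ_ne_zero]

theorem compl_map_succ {n : ℕ} (T : Finset (Fin n)) :
    (T.map (Fin.succEmb n))ᶜ = insert 0 (Tᶜ.map (Fin.succEmb n)) := by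
  ext j
  refine Fin.cases ?_ (fun j => ?_) j <;> simp [Fin.succ_ne_zero]

/-- The two sums correspond to whether the first entry belongs to the first block. If it does not,
the first block must be moved across it, which gives the extra sign. -/
theorem shuf_cons (Φ : (p q : ℕ) → (Fin p → X) → (Fin q → X) → W) {n : ℕ} (u : X)
    (x : Fin n → X) :
    shuf par Φ (Fin.cons u x : Fin (n + 1) → X) =
      shuf par (fun p q y z => Φ (p + 1) q (Fin.cons u y) z) x +
      shuf par (fun p q y z =>
        paritySign (par u * ∑ t, par (y t)) • Φ p (q + 1) y (Fin.cons u z)) x := by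
  unfold shuf
  rw [sum_finset_fin_succ]
  congr 1 <;> refine sum_congr rfl fun T _ => ?_
  · rw [compl_insert_zero, pick_insert_zero T u x (fun p y => Φ p _ y _),
      pick_map_succ Tᶜ u x (fun q z => Φ _ q _ z)]
    congr 1
    simp only [koszulSign_eq_pairProd, pairProd_succ, splitLabel_lt]
    simp [Fin.succ_ne_zero]
  · rw [compl_map_succ, pick_map_succ T u x (fun p y => Φ p _ y _),
      pick_insert_zero Tᶜ u x (fun q z => Φ _ q _ z), smul_smul]
    congr 1
    simp only [koszulSign_eq_pairProd, pairProd_succ, splitLabel_lt]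
    rw [sum_pick T par x, mul_sum, paritySign_sum, mul_comm]
    congr 1
    · simp
    · simp

/-- The positions with label `t`. -/
abbrev fib {n m : ℕ} (c : Fin n → Fin m) (t : Fin m) : Finset (Fin n) := univ.filter (c · = t)

variable (par) in
/-- The sum of `±Φ(x_S; x_T; x_U)` over all ordered partitions into three blocks. -/
def shuf3 (Φ : (p q r : ℕ) → (Fin p → X) → (Fin q → X) → (Fin r → X) → W) {n : ℕ}
    (x : Fin n → X) : W :=
  ∑ c : Fin n → Fin 3, koszulSign c (fun j => par (x j)) •
    Φ _ _ _ (pick (fib c 0) x) (pick (fib c 1) x) (pick (fib c 2) x)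

/-- Relabelling blocks is a bijection on ordered partitions; the sign is that of interchanging the
two adjacent blocks. -/
theorem shuf3_swap₁₂ (Φ : (p q r : ℕ) → (Fin p → X) → (Fin q → X) → (Fin r → X) → W) {n : ℕ}
    (x : Fin n → X) :
    shuf3 par Φ x = shuf3 par (fun p q r y z w =>
      paritySign ((∑ t, par (y t)) * ∑ t, par (z t)) • Φ q p r z y w) x := by
  unfold shuf3
  symm
  refine sum_equiv ((Equiv.refl (Fin n)).arrowCongr (Equiv.swap (0 : Fin 3) 1)) (by simp)
    fun c _ => ?_
  have hc : ∀ j, (Equiv.refl (Fin n)).arrowCongr (Equiv.swap (0 : Fin 3) 1) c j =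
      Equiv.swap (0 : Fin 3) 1 (c j) := fun j => rfl
  generalize hc' : (Equiv.refl (Fin n)).arrowCongr (Equiv.swap (0 : Fin 3) 1) c = c' at hc
  have h0 : fib c' 0 = fib c 1 := by
    ext j; simp only [mem_filter, mem_univ, true_and, hc]; generalize c j = i; revert i; decide
  have h1 : fib c' 1 = fib c 0 := by
    ext j; simp only [mem_filter, mem_univ, true_and, hc]; generalize c j = i; revert i; decide
  have h2 : fib c' 2 = fib c 2 := by
    ext j; simp only [mem_filter, mem_univ, true_and, hc]; generalize c j = i; revert i; decide
  rw [h0, h1, h2, smul_smul, sum_pick, sum_pick]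
  congr 1
  rw [sum_mul_sum, paritySign_sum]
  simp only [paritySign_sum]
  rw [prod_prod_eq_pairProd, koszulSign_eq_pairProd, koszulSign_eq_pairProd, pairProd_mul]
  swap
  · simp +contextual [disjoint_left]
  refine pairProd_congr fun a b _ => ?_
  simp only [mem_filter, mem_univ, true_and, hc]
  generalize c a = i
  generalize c b = j
  generalize par (x a) = ea
  generalize par (x b) = eb
  revert ea eb i j
  decide

theorem shuf3_swap₂₃ (Φ : (p q r : ℕ) → (Fin p → X) → (Fin q → X) → (Fin r → X) → W) {n : ℕ}
    (x : Fin n → X) :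
    shuf3 par Φ x = shuf3 par (fun p q r y z w =>
      paritySign ((∑ t, par (z t)) * ∑ t, par (w t)) • Φ p r q y w z) x := by
  unfold shuf3
  symm
  refine sum_equiv ((Equiv.refl (Fin n)).arrowCongr (Equiv.swap (1 : Fin 3) 2)) (by simp)
    fun c _ => ?_
  have hc : ∀ j, (Equiv.refl (Fin n)).arrowCongr (Equiv.swap (1 : Fin 3) 2) c j =
      Equiv.swap (1 : Fin 3) 2 (c j) := fun j => rfl
  generalize hc' : (Equiv.refl (Fin n)).arrowCongr (Equiv.swap (1 : Fin 3) 2) c = c' at hc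
  have h0 : fib c' 0 = fib c 0 := by
    ext j; simp only [mem_filter, mem_univ, true_and, hc]; generalize c j = i; revert i; decide
  have h1 : fib c' 1 = fib c 2 := by
    ext j; simp only [mem_filter, mem_univ, true_and, hc]; generalize c j = i; revert i; decide
  have h2 : fib c' 2 = fib c 1 := by
    ext j; simp only [mem_filter, mem_univ, true_and, hc]; generalize c j = i; revert i; decide
  rw [h0, h1, h2, smul_smul, sum_pick, sum_pick]
  congr 1
  rw [sum_mul_sum, paritySign_sum]
  simp only [paritySign_sum]
  rw [prod_prod_eq_pairProd, koszulSign_eq_pairProd, koszulSign_eq_pairProd, pairProd_mul]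
  swap
  · simp +contextual [disjoint_left]
  refine pairProd_congr fun a b _ => ?_
  simp only [mem_filter, mem_univ, true_and, hc]
  generalize c a = i
  generalize c b = j
  generalize par (x a) = ea
  generalize par (x b) = eb
  revert ea eb i j
  decide

theorem sum_finset_pick {M : Type*} [AddCommMonoid M] {n : ℕ} (P : Finset (Fin n))
    (f : Finset (Fin n) → M) :
    ∑ S : Finset (Fin #P), f (S.map (P.orderEmbOfFin rfl).toEmbedding) = ∑ S ∈ P.powerset, f S := by
  refine sum_bij (fun S _ => S.map (P.orderEmbOfFin rfl).toEmbedding) ?_ ?_ ?_ ?_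
  · intro S _
    rw [mem_powerset]
    intro i hi
    obtain ⟨t, _, rfl⟩ := mem_map.1 hi
    exact orderEmbOfFin_mem _ _ _
  · intro S _ T _ h
    exact map_injective _ h
  · intro S hS
    rw [mem_powerset] at hS
    refine ⟨univ.filter fun t => P.orderEmbOfFin rfl t ∈ S, mem_univ _, ?_⟩
    ext i
    simp only [mem_map, mem_filter, mem_univ, true_and]
    constructor
    · rintro ⟨t, ht, rfl⟩; exact ht
    · intro hi
      obtain ⟨t, rfl⟩ := mem_iff_exists_orderEmbOfFin.1 (hS hi)
      exact ⟨t, hi, rfl⟩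
  · intros; rfl

theorem shuf_pick {n : ℕ} (P : Finset (Fin n)) (Φ : (p q : ℕ) → (Fin p → X) → (Fin q → X) → W)
    (x : Fin n → X) :
    shuf par Φ (pick P x) = ∑ S ∈ P.powerset,
      (pairProd fun a b => if a ∈ P \ S ∧ b ∈ S then paritySign (par (x a) * par (x b)) else 1) •
        Φ _ _ (pick S x) (pick (P \ S) x) := by
  rw [← sum_finset_pick]
  unfold shuf
  refine sum_congr rfl fun S _ => ?_
  have hmem : ∀ t, P.orderEmbOfFin rfl t ∈ S.map (P.orderEmbOfFin rfl).toEmbedding ↔ t ∈ S :=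
    fun t => mem_map' (P.orderEmbOfFin rfl).toEmbedding
  have hC : ∀ i, i ∈ P \ S.map (P.orderEmbOfFin rfl).toEmbedding ↔
      ∃ t ∈ Sᶜ, P.orderEmbOfFin rfl t = i := by
    intro i
    simp only [mem_sdiff, mem_compl]
    constructor
    · rintro ⟨h1, h2⟩
      obtain ⟨t, rfl⟩ := mem_iff_exists_orderEmbOfFin.1 h1
      exact ⟨t, fun h => h2 ((hmem t).2 h), rfl⟩
    · rintro ⟨t, h, rfl⟩
      exact ⟨orderEmbOfFin_mem _ _ _, fun h' => h ((hmem t).1 h')⟩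
  rw [pick_comp_strictMono (S := S) (g := P.orderEmbOfFin rfl) (OrderEmbedding.strictMono _)
      (by simp) x (fun p y => Φ p _ y _),
    pick_comp_strictMono (S := Sᶜ) (g := P.orderEmbOfFin rfl) (OrderEmbedding.strictMono _) hC x
      (fun q z => Φ _ q _ z)]
  change _ • Φ _ _ (pick S (pick P x)) (pick Sᶜ (pick P x)) = _
  congr 1
  rw [koszulSign_eq_pairProd]
  refine (pairProd_congr fun a b _ => ?_).trans ((pairProd_orderEmbOfFin P fun a b =>
    if a ∈ P \ S.map (P.orderEmbOfFin rfl).toEmbedding ∧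
      b ∈ S.map (P.orderEmbOfFin rfl).toEmbedding then paritySign (par (x a) * par (x b)) else 1).trans
    (pairProd_congr fun a b _ => ?_))
  · simp only [splitLabel_lt, mem_sdiff, hmem, orderEmbOfFin_mem, true_and, and_comm (a := b ∈ S)]
    rfl
  · rw [← ite_and]
    refine if_congr ?_ rfl rfl
    constructor
    · exact fun h => h.2
    · intro h
      refine ⟨⟨(mem_sdiff.1 h.1).1, ?_⟩, h⟩
      obtain ⟨t, _, ht⟩ := mem_map.1 h.2
      exact ht ▸ orderEmbOfFin_mem _ _ _

/-- Splitting off the last block and then dividing the rest is the same as choosing an ordered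
partition into three blocks. With `shuf_shuf_right` this is associativity of unshuffling. -/
theorem shuf_shuf_left (Φ : (p q r : ℕ) → (Fin p → X) → (Fin q → X) → (Fin r → X) → W) {n : ℕ}
    (x : Fin n → X) :
    shuf par (fun _ r y w => shuf par (fun p q y z => Φ p q r y z w) y) x = shuf3 par Φ x := by
  unfold shuf3
  change ∑ P : Finset (Fin n), koszulSign (splitLabel P) (fun j => par (x j)) •
    shuf par (fun p q y z => Φ p q #Pᶜ y z (pick Pᶜ x)) (pick P x) = _
  simp only [shuf_pick, smul_sum, smul_smul]
  rw [sum_sigma']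
  refine sum_bij' (fun i _ j => if j ∈ i.2 then (0 : Fin 3) else if j ∈ i.1 then 1 else 2)
    (fun c _ => ⟨univ.filter fun j => c j ≠ 2, fib c 0⟩) (by simp) ?_ ?_ ?_ ?_
  · intro c _
    simp only [mem_sigma, mem_univ, true_and, mem_powerset]
    intro j hj
    simp only [mem_filter, mem_univ, true_and] at hj ⊢
    rw [hj]; decide
  · rintro ⟨P, S⟩ h
    simp only [mem_sigma, mem_univ, true_and, mem_powerset] at h
    have : ∀ j, j ∈ S → j ∈ P := fun j hj => h hj
    congr 1
    · ext j
      by_cases h1 : j ∈ S <;> by_cases h2 : j ∈ P <;> simp [h1, h2]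
      exact h2 (this j h1)
    · ext j
      by_cases h1 : j ∈ S <;> by_cases h2 : j ∈ P <;> simp [h1, h2]
  · intro c _
    ext1 j
    simp only [mem_filter, mem_univ, true_and]
    generalize c j = i; revert i; decide
  · rintro ⟨P, S⟩ h
    simp only [mem_sigma, mem_univ, true_and, mem_powerset] at h
    have hSP : ∀ j, j ∈ S → j ∈ P := fun j hj => h hj
    generalize hc : (fun j => if j ∈ S then (0 : Fin 3) else if j ∈ P then 1 else 2) = c
    have hcj : ∀ j, c j = if j ∈ S then (0 : Fin 3) else if j ∈ P then 1 else 2 := fun j => by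
      rw [← hc]
    have h0 : fib c 0 = S := by
      ext j
      by_cases h1 : j ∈ S <;> by_cases h2 : j ∈ P <;> simp [hcj, h1, h2]
    have h1 : fib c 1 = P \ S := by
      ext j
      by_cases h1 : j ∈ S <;> by_cases h2 : j ∈ P <;> simp [hcj, h1, h2]
    have h2 : fib c 2 = Pᶜ := by
      ext j
      by_cases h1 : j ∈ S <;> by_cases h2 : j ∈ P <;> simp [hcj, h1, h2]
      exact h2 (hSP j h1)
    rw [h0, h1, h2]
    congr 1
    rw [koszulSign_eq_pairProd, koszulSign_eq_pairProd, pairProd_mul]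
    refine pairProd_congr fun a b _ => ?_
    simp only [splitLabel_lt, mem_sdiff, hcj]
    have ha := hSP a
    have hb := hSP b
    by_cases h1 : a ∈ S <;> by_cases h2 : a ∈ P <;> by_cases h3 : b ∈ S <;> by_cases h4 : b ∈ P <;>
      simp_all

theorem shuf_shuf_right (Φ : (p q r : ℕ) → (Fin p → X) → (Fin q → X) → (Fin r → X) → W) {n : ℕ}
    (x : Fin n → X) :
    shuf par (fun p _ y w => shuf par (fun q r z w => Φ p q r y z w) w) x = shuf3 par Φ x := by
  unfold shuf3
  change ∑ S : Finset (Fin n), koszulSign (splitLabel S) (fun j => par (x j)) •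
    shuf par (fun q r z w => Φ #S q r (pick S x) z w) (pick Sᶜ x) = _
  simp only [shuf_pick, smul_sum, smul_smul]
  rw [sum_sigma']
  refine sum_bij' (fun i _ j => if j ∈ i.1 then (0 : Fin 3) else if j ∈ i.2 then 1 else 2)
    (fun c _ => ⟨fib c 0, fib c 1⟩) (by simp) ?_ ?_ ?_ ?_
  · intro c _
    simp only [mem_sigma, mem_univ, true_and, mem_powerset]
    intro j hj
    simp only [mem_filter, mem_univ, true_and, mem_compl] at hj ⊢
    rw [hj]; decide
  · rintro ⟨S, T⟩ h
    simp only [mem_sigma, mem_univ, true_and, mem_powerset] at h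
    have : ∀ j, j ∈ T → j ∉ S := fun j hj => mem_compl.1 (h hj)
    congr 1
    · ext j
      by_cases h1 : j ∈ S <;> by_cases h2 : j ∈ T <;> simp [h1, h2]
    · ext j
      by_cases h1 : j ∈ S <;> by_cases h2 : j ∈ T <;> simp [h1, h2]
      exact this j h2 h1
  · intro c _
    ext1 j
    simp only [mem_filter, mem_univ, true_and]
    generalize c j = i; revert i; decide
  · rintro ⟨S, T⟩ h
    simp only [mem_sigma, mem_univ, true_and, mem_powerset] at h
    have hST : ∀ j, j ∈ T → j ∉ S := fun j hj => mem_compl.1 (h hj)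
    generalize hc : (fun j => if j ∈ S then (0 : Fin 3) else if j ∈ T then 1 else 2) = c
    have hcj : ∀ j, c j = if j ∈ S then (0 : Fin 3) else if j ∈ T then 1 else 2 := fun j => by
      rw [← hc]
    have h0 : fib c 0 = S := by
      ext j
      by_cases h1 : j ∈ S <;> by_cases h2 : j ∈ T <;> simp [hcj, h1, h2]
    have h1 : fib c 1 = T := by
      ext j
      by_cases h1 : j ∈ S <;> by_cases h2 : j ∈ T <;> simp [hcj, h1, h2]
      exact hST j h2 h1
    have h2 : fib c 2 = Sᶜ \ T := by
      ext j
      by_cases h1 : j ∈ S <;> by_cases h2 : j ∈ T <;> simp [hcj, h1, h2]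
    rw [h0, h1, h2]
    congr 1
    rw [koszulSign_eq_pairProd, koszulSign_eq_pairProd, pairProd_mul]
    refine pairProd_congr fun a b _ => ?_
    simp only [splitLabel_lt, mem_sdiff, mem_compl, hcj]
    have ha := hST a
    have hb := hST b
    by_cases h1 : a ∈ S <;> by_cases h2 : a ∈ T <;> by_cases h3 : b ∈ S <;> by_cases h4 : b ∈ T <;>
      simp_all

theorem shuf_add (Φ Ψ : (p q : ℕ) → (Fin p → X) → (Fin q → X) → W) {n : ℕ} (x : Fin n → X) :
    shuf par (fun p q y z => Φ p q y z + Ψ p q y z) x = shuf par Φ x + shuf par Ψ x := by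
  simp only [shuf, smul_add, sum_add_distrib]

theorem map_shuf {W' F : Type*} [AddCommGroup W'] [FunLike F W W'] [AddMonoidHomClass F W W']
    (f : F) (Φ : (p q : ℕ) → (Fin p → X) → (Fin q → X) → W) {n : ℕ} (x : Fin n → X) :
    f (shuf par Φ x) = shuf par (fun p q y z => f (Φ p q y z)) x := by
  simp only [shuf, map_sum, map_zsmul]

theorem shuf_zero {n : ℕ} (x : Fin n → X) :
    shuf par (fun _ _ _ _ => (0 : W)) x = 0 := by
  simp [shuf]

theorem shuf_congr {Φ Ψ : (p q : ℕ) → (Fin p → X) → (Fin q → X) → W} {n : ℕ} {x : Fin n → X}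
    (h : ∀ S : Finset (Fin n), Φ #S #Sᶜ (pick S x) (pick Sᶜ x) = Ψ #S #Sᶜ (pick S x) (pick Sᶜ x)) :
    shuf par Φ x = shuf par Ψ x :=
  sum_congr rfl fun S _ => by rw [h]

theorem koszulSign_cons_perm {n : ℕ} (σ : Equiv.Perm (Fin n)) (u : X) (x : Fin n → X) :
    koszulSign (Equiv.Perm.decomposeFin.symm (0, σ)).symm
      (fun j => par ((Fin.cons u x : Fin (n + 1) → X) j)) =
    koszulSign σ.symm fun j => par (x j) := by
  rw [koszulSign_perm_symm, koszulSign_perm_symm, pairProd_succ]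
  simp

theorem SymmFam.cons {ω : (n : ℕ) → (Fin n → X) → W} (h : SymmFam par ω) (u : X) :
    SymmFam par fun n x => ω (n + 1) (Fin.cons u x) := by
  intro n x σ
  have := h (n + 1) (Fin.cons u x) (Equiv.Perm.decomposeFin.symm (0, σ))
  rw [koszulSign_cons_perm] at this
  rw [← this]
  refine congrArg (ω (n + 1)) (funext fun j => ?_)
  refine Fin.cases ?_ (fun j => ?_) j <;> simp

theorem SymmFam.swap_cons_cons {ω : (n : ℕ) → (Fin n → X) → W} (h : SymmFam par ω) (u v : X)
    {n : ℕ} (x : Fin n → X) :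
    ω (n + 2) (Fin.cons u (Fin.cons v x)) =
      paritySign (par u * par v) • ω (n + 2) (Fin.cons v (Fin.cons u x)) := by
  have := h (n + 2) (Fin.cons v (Fin.cons u x)) (Equiv.swap 0 1)
  have hx : (Fin.cons v (Fin.cons u x) : Fin (n + 2) → X) ∘ Equiv.swap 0 1 =
      Fin.cons u (Fin.cons v x) := by
    ext j
    refine Fin.cases ?_ (fun j => Fin.cases ?_ (fun j => ?_) j) j
    · simp
    · simp
    · rw [Function.comp_apply, Equiv.swap_apply_of_ne_of_ne]
      · rfl
      · exact Fin.succ_ne_zero _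
      · exact fun h => Fin.succ_ne_zero j (Fin.succ_injective _ h)
  rw [hx] at this
  rw [this, koszulSign_perm_symm, pairProd_succ, pairProd_succ]
  congr 1
  have h1 : ∀ j : Fin n, Equiv.swap (0 : Fin (n + 2)) 1 j.succ.succ = j.succ.succ := fun j =>
    Equiv.swap_apply_of_ne_of_ne (Fin.succ_ne_zero _)
      fun h => Fin.succ_ne_zero j (Fin.succ_injective _ h)
  have h2 : pairProd (fun a b : Fin n => if Equiv.swap (0 : Fin (n + 2)) 1 b.succ.succ <
      Equiv.swap (0 : Fin (n + 2)) 1 a.succ.succ then (1 : ℤ) else 1) = 1 := by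
    simp [pairProd_one]
  rw [Fin.prod_univ_succ]
  simp only [h1, Fin.succ_zero_eq_one, Equiv.swap_apply_left, Equiv.swap_apply_right]
  have h3 : ∀ a b : Fin n, a < b → ¬ (b.succ.succ < a.succ.succ) := fun a b h => by
    simpa using h.le
  rw [pairProd_congr (g := fun _ _ => 1) (fun a b h => if_neg (h3 a b h)), pairProd_one]
  have h4 : ∀ j : Fin n, ¬ (j.succ.succ < (0 : Fin (n + 2))) := fun j => by simp
  have h5 : ∀ j : Fin n, ¬ (j.succ.succ < (1 : Fin (n + 2))) := fun j => by
    rw [← Fin.succ_zero_eq_one]; simp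
  simp [h4, h5]

/-! ### The differential as an insertion of brackets, and its square -/

section Coderivation

variable (m : (n : ℕ) → (Fin n → X) → X)

variable (par) in
/-- The sum of `±ω(m(x_S), x_{Sᶜ})` over all subsets `S`. -/
def dFam (ω : (n : ℕ) → (Fin n → X) → W) (n : ℕ) (x : Fin n → X) : W :=
  shuf par (fun p q y z => ω (q + 1) (Fin.cons (m p y) z)) x

variable {m}

theorem dFam_symm {ω : (n : ℕ) → (Fin n → X) → W} (h : SymmFam par ω)
    (hm : ∀ q z, SymmFam par fun p y => ω (q + 1) (Fin.cons (m p y) z)) :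
    SymmFam par (dFam par m ω) :=
  shuf_symm hm fun _ _ => h.cons _

/-- Leibniz rule: the inserted bracket is the first entry of the new sequence, and it falls into
either the left or the right block. -/
theorem dFam_shuf (Φ : (p q : ℕ) → (Fin p → X) → (Fin q → X) → W) {n : ℕ} (x : Fin n → X) :
    dFam par m (fun _ x => shuf par Φ x) n x =
      shuf3 par (fun p q r y z w => Φ (q + 1) r (Fin.cons (m p y) z) w) x +
      shuf3 par (fun p q r y z w => paritySign (par (m p y) * ∑ t, par (z t)) •
        Φ q (r + 1) z (Fin.cons (m p y) w)) x := by
  rw [← shuf_shuf_right, ← shuf_shuf_right, ← shuf_add]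
  refine shuf_congr fun S => ?_
  exact shuf_cons _ _ _

/-- In d² the second bracket either contains the first one, and these terms sum to zero by Jacobi
(`hJ`), or the two brackets are disjoint. The disjoint terms are antisymmetric under exchange of the
two blocks, because the shifted brackets are odd, so twice their sum vanishes. -/
theorem dFam_dFam {ω : (n : ℕ) → (Fin n → X) → W} (h : SymmFam par ω)
    (hpar : ∀ n x, par (m n x) = ∑ t, par (x t) + 1)
    (hJ : ∀ r w n (x : Fin n → X), shuf par (fun p q y z =>
      ω (r + 1) (Fin.cons (m (q + 1) (Fin.cons (m p y) z)) w)) x = 0)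
    (hW : ∀ w : W, w + w = 0 → w = 0) {n : ℕ} (x : Fin n → X) :
    dFam par m (dFam par m ω) n x = 0 := by
  have h1 := dFam_shuf (par := par) (m := m)
    (fun p q y z => ω (q + 1) (Fin.cons (m p y) z)) x
  refine h1.trans ?_
  rw [← shuf_shuf_left, shuf_congr (Ψ := fun _ _ _ _ => 0) (fun S => hJ _ _ _ _), shuf_zero, zero_add]
  apply hW
  -- Exchanging the two bracketed blocks in one copy only makes the two copies cancel partition by
  -- partition.
  conv_lhs => arg 2; rw [shuf3_swap₁₂]
  unfold shuf3
  rw [← sum_add_distrib]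
  refine sum_eq_zero fun c _ => ?_
  beta_reduce
  rw [h.swap_cons_cons]
  simp only [smul_smul]
  rw [← add_smul]
  simp only [hpar]
  generalize ∑ t, par (pick (fib c 0) x t) = e
  generalize ∑ t, par (pick (fib c 1) x t) = f
  have : paritySign ((e + 1) * f) * paritySign ((f + 1) * (e + 1)) +
      paritySign (e * f) * paritySign ((f + 1) * e) = 0 := by
    revert e f; decide
  rw [← mul_add, this, mul_zero, zero_smul]

end Coderivation

end Shuffle

/-! ### Décalage signs -/

/-- The décalage signs absorb (-1)^{ij} and the sign of the unshuffle, leaving only a Koszul sign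
for the shifted parities. The first entry on the left, the bracket of x_S, has parity ∑(|x_s| + 1),
which is that of ∑|x_s| + 2 - #S. -/
theorem jacobi_sign {n : ℕ} (e : Fin n → ZMod 2) (S : Finset (Fin n)) :
    koszulSign (splitLabel S) (fun j => e j + 1) *
      (decalageSign (Fin.cons (∑ s ∈ S, (e s + 1)) (pick Sᶜ e) : Fin (#Sᶜ + 1) → ZMod 2) *
        decalageSign (pick S e)) =
    decalageSign e * ((-1) ^ (#S * #Sᶜ) * koszulSign (splitLabel S) (fun _ => 1) *
      koszulSign (splitLabel S) e) := by
  have h1 : decalageSign (Fin.cons (∑ s ∈ S, (e s + 1)) (pick Sᶜ e) : Fin (#Sᶜ + 1) → ZMod 2) =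
      (∏ s ∈ S, ∏ t ∈ Sᶜ, paritySign (e s + 1)) *
      pairProd fun a b => if a ∈ Sᶜ ∧ b ∈ Sᶜ then paritySign (e a) else 1 := by
    rw [decalageSign_eq_pairProd, pairProd_succ]
    congr 1
    · simp [paritySign_sum, prod_pow]
    · exact pairProd_orderEmbOfFin Sᶜ fun a _ => paritySign (e a)
  have h2 : ((-1) ^ (#S * #Sᶜ) : ℤ) = ∏ s ∈ S, ∏ t ∈ Sᶜ, (-1 : ℤ) := by
    simp [pow_mul, mul_comm (#S)]
  have h3 : decalageSign (pick S e) =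
      pairProd fun a b => if a ∈ S ∧ b ∈ S then paritySign (e a) else 1 := by
    rw [decalageSign_eq_pairProd]
    exact pairProd_orderEmbOfFin S fun a _ => paritySign (e a)
  rw [h1, h2, h3, prod_prod_eq_pairProd _ _ disjoint_compl_right,
    prod_prod_eq_pairProd _ _ disjoint_compl_right]
  simp only [koszulSign_eq_pairProd, decalageSign_eq_pairProd, pairProd_mul]
  refine pairProd_congr fun a b _ => ?_
  simp only [splitLabel_lt, mem_compl]
  generalize e a = f
  generalize e b = g
  by_cases ha : a ∈ S <;> by_cases hb : b ∈ S <;> simp only [ha, hb] <;> revert f g <;> decide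

theorem symm_sign {n : ℕ} (e : Fin n → ZMod 2) (σ : Equiv.Perm (Fin n)) :
    decalageSign (e ∘ σ) * ((Equiv.Perm.sign σ : ℤ) * koszulSign σ.symm e) =
      koszulSign σ.symm (fun j => e j + 1) * decalageSign e := by
  rw [sign_eq_pairProd, koszulSign_perm_symm, koszulSign_perm_symm, decalageSign_eq_pairProd,
    decalageSign_eq_pairProd, pairProd_perm σ fun a _ => paritySign (e a)]
  simp only [pairProd_mul]
  refine pairProd_congr fun a b hab => ?_
  have hne : σ a ≠ σ b := fun h => hab.ne (σ.injective h)
  simp only [Function.comp_apply]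
  generalize e (σ a) = f
  generalize e (σ b) = g
  rcases lt_or_gt_of_ne hne with h | h
  · simp only [h, not_lt_of_gt h]; revert f g; decide
  · simp only [h, not_lt_of_gt h]; revert f g; decide

/-- A multilinear map as a linear map in its first argument. -/
def headMap {k A W : Type*} [Field k] [AddCommGroup A] [Module k A] [AddCommGroup W]
    [Module k W] {n : ℕ} (f : MultilinearMap k (fun _ : Fin (n + 1) => A) W) (z : Fin n → A) :
    A →ₗ[k] W where
  toFun u := f (Fin.cons u z : Fin (n + 1) → A)
  map_add' := f.cons_add z
  map_smul' := f.cons_smul z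

/-! ### Multilinear maps on graded spaces -/

section Graded

variable {k A W : Type*} [Field k] [AddCommGroup A] [Module k A] [AddCommGroup W] [Module k W]

theorem cons_zsmul {n : ℕ} (f : MultilinearMap k (fun _ : Fin (n + 1) => A) W) (c : ℤ) (u : A)
    (z : Fin n → A) : f (Fin.cons (c • u) z : Fin (n + 1) → A) = c • f (Fin.cons u z) :=
  map_zsmul (headMap f z) c u

theorem multilinear_ext_of_homogeneous {gr : ℤ × ℤ → Submodule k A} (h : DirectSum.IsInternal gr)
    {n : ℕ} {f g : MultilinearMap k (fun _ : Fin n => A) W}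
    (hfg : ∀ (d : Fin n → ℤ × ℤ) (x : Fin n → A), (∀ j, x j ∈ gr (d j)) → f x = g x) : f = g := by
  let E := LinearEquiv.ofBijective (DirectSum.coeLinearMap gr) h
  have : f.compLinearMap (fun _ => E.toLinearMap) = g.compLinearMap fun _ => E.toLinearMap := by
    apply MultilinearMap.dfinsupp_ext
    intro p
    ext x
    refine hfg p _ fun j => ?_
    change DirectSum.coeLinearMap gr (DirectSum.lof k _ (fun i => gr i) (p j) (x j)) ∈ _
    rw [DirectSum.coeLinearMap_lof]
    exact (x j).2
  ext x
  have h2 := congrArg (fun F => F fun j => E.symm (x j)) this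
  simpa using h2

/-- The multilinear map that is given by `g d` on homogeneous elements of degrees `d`. -/
noncomputable def ofHomogeneous {gr : ℤ × ℤ → Submodule k A} (h : DirectSum.IsInternal gr) (n : ℕ)
    (g : (Fin n → ℤ × ℤ) → MultilinearMap k (fun _ : Fin n => A) W) :
    MultilinearMap k (fun _ : Fin n => A) W :=
  (MultilinearMap.fromDirectSumEquiv (R := k) (M := fun (_ : Fin n) (i : ℤ × ℤ) => gr i)
    (fun κ => (g κ).compLinearMap fun j => (gr (κ j)).subtype)).compLinearMap
      fun _ => (LinearEquiv.ofBijective (DirectSum.coeLinearMap gr) h).symm.toLinearMap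

theorem ofHomogeneous_apply {gr : ℤ × ℤ → Submodule k A} (h : DirectSum.IsInternal gr) {n : ℕ}
    (g : (Fin n → ℤ × ℤ) → MultilinearMap k (fun _ : Fin n => A) W) (d : Fin n → ℤ × ℤ)
    (x : Fin n → A) (hx : ∀ j, x j ∈ gr (d j)) : ofHomogeneous h n g x = g d x := by
  have h1 : (fun j => (LinearEquiv.ofBijective (DirectSum.coeLinearMap gr) h).symm (x j)) =
      fun j => DirectSum.lof k (ℤ × ℤ) (fun i => gr i) (d j) ⟨x j, hx j⟩ := by
    ext1 j
    rw [LinearEquiv.symm_apply_eq]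
    exact (DirectSum.coeLinearMap_lof gr (d j) ⟨x j, hx j⟩).symm
  simp only [ofHomogeneous, MultilinearMap.compLinearMap_apply, LinearEquiv.coe_coe]
  rw [h1, MultilinearMap.fromDirectSumEquiv_lof]
  rfl

theorem sum_pick_add_sum_pick_compl {X M : Type*} [AddCommMonoid M] {n : ℕ} (S : Finset (Fin n))
    (f : X → M) (x : Fin n → X) :
    ∑ t, f (pick S x t) + ∑ t, f (pick Sᶜ x t) = ∑ j, f (x j) := by
  rw [sum_pick, sum_pick, sum_add_sum_compl]

end Graded

/-! ### Shifted brackets and the Chevalley–Eilenberg complex -/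

namespace LInftyAlg

section

variable {k : Type u} [Field k] {A : Type v} [AddCommGroup A] [Module k A]

/-- A homogeneous element together with its bidegree. -/
abbrev Letter (a : LInftyAlg k A) : Type v := Σ i : ℤ × ℤ, a.gr i

/-- The underlying elements of a sequence of homogeneous elements. -/
abbrev vals (a : LInftyAlg k A) {n : ℕ} (z : Fin n → a.Letter) (j : Fin n) : A := (z j).2

/-- The shifted parity of a homogeneous element. -/
def lpar (a : LInftyAlg k A) (z : a.Letter) : ZMod 2 := parity z.1 + 1

theorem vals_cons (a : LInftyAlg k A) {n : ℕ} (u : a.Letter) (z : Fin n → a.Letter) :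
    a.vals (Fin.cons u z : Fin (n + 1) → a.Letter) = Fin.cons (u.2 : A) (a.vals z) := by
  ext j
  refine Fin.cases rfl (fun j => rfl) j

theorem shiftBr_mem (a : LInftyAlg k A) (n : ℕ) (d : Fin n → ℤ × ℤ) (x : Fin n → A)
    (hx : ∀ j, x j ∈ a.gr (d j)) : a.shiftBr n x ∈ a.gr (∑ j, d j + (2 - (n : ℤ), 0)) := by
  rw [a.shiftBr_apply n d x hx]
  exact zsmul_mem (a.br_mem n d x hx) _

/-- The shifted bracket of homogeneous elements, as a homogeneous element. -/
noncomputable def mL (a : LInftyAlg k A) (n : ℕ) (z : Fin n → a.Letter) : a.Letter :=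
  ⟨∑ j, (z j).1 + (2 - (n : ℤ), 0), a.shiftBr n (a.vals z),
    a.shiftBr_mem n (fun j => (z j).1) _ fun j => (z j).2.2⟩

theorem lpar_mL (a : LInftyAlg k A) (n : ℕ) (z : Fin n → a.Letter) :
    a.lpar (a.mL n z) = ∑ t, a.lpar (z t) + 1 := by
  have h : parity ((2 - (n : ℤ), 0) : ℤ × ℤ) = n := by
    have h2 : (2 : ZMod 2) = 0 := rfl
    simp [parity, h2, CharTwo.neg_eq]
  simp only [lpar, mL, parity_add, parity_sum, h, sum_add_distrib]
  simp

theorem shiftBr_symm (a : LInftyAlg k A) :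
    SymmFam a.lpar fun n z => a.shiftBr n (a.vals z) := by
  intro n z σ
  have h := a.br_antisymm n (fun j => (z j).1) (a.vals z) (fun j => (z j).2.2) σ
  beta_reduce
  rw [a.shiftBr_apply n (fun j => (z j).1) _ (fun j => (z j).2.2),
    a.shiftBr_apply n (fun j => (z (σ j)).1) (a.vals (z ∘ σ)) (fun j => (z (σ j)).2.2)]
  have hv : a.vals (z ∘ σ) = a.vals z ∘ σ := rfl
  rw [hv, h, smul_smul, smul_smul]
  congr 1
  exact symm_sign (fun j => parity (z j).1) σ

/-- Multiplying the Jacobi identity by the décalage sign of the whole sequence gives this form, in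
which Koszul signs are the only signs left; this is the input of `dFam_dFam`. -/
theorem shiftBr_jacobi (a : LInftyAlg k A) {n : ℕ} (x : Fin n → a.Letter) :
    shuf a.lpar (fun p q y z => a.shiftBr (q + 1)
      (a.vals (Fin.cons (a.mL p y) z : Fin (q + 1) → a.Letter))) x = 0 := by
  have h := a.jacobi n (fun j => (x j).1) (a.vals x) (fun j => (x j).2.2)
  have h' := congrArg (fun w => decalageSign (fun j => parity (x j).1) • w) h
  simp only [smul_zero, smul_sum, smul_smul] at h'
  rw [← h']
  refine sum_congr rfl fun S _ => ?_
  rw [← jacobi_sign, mul_smul, mul_smul]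
  have h1 := a.shiftBr_apply (#Sᶜ + 1)
    (fun j => ((Fin.cons (a.mL #S (pick S x)) (pick Sᶜ x) : Fin (#Sᶜ + 1) → a.Letter) j).1)
    (a.vals (Fin.cons (a.mL #S (pick S x)) (pick Sᶜ x) : Fin (#Sᶜ + 1) → a.Letter))
    (fun j => Subtype.prop _)
  have h2 := a.shiftBr_apply #S (fun j => (pick S x j).1) (a.vals (pick S x))
    (fun j => Subtype.prop _)
  have h3 : (fun j => parity ((Fin.cons (a.mL #S (pick S x)) (pick Sᶜ x) :
      Fin (#Sᶜ + 1) → a.Letter) j).1) = Fin.cons (∑ s ∈ S, (parity (x s).1 + 1))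
        (pick Sᶜ fun j => parity (x j).1) := by
    ext j
    refine Fin.cases ?_ (fun j => rfl) j
    simp only [Fin.cons_zero]
    have := a.lpar_mL #S (pick S x)
    simp only [lpar] at this
    rw [add_left_injective _ this, sum_pick S (fun z : a.Letter => parity z.1 + 1)]
  beta_reduce
  rw [h1, h3, vals_cons]
  congr 2
  have h4 : ((a.mL #S (pick S x)).2 : A) =
      decalageSign (pick S fun j => parity (x j).1) • a.br #S (pick S (a.vals x)) := h2
  rw [h4]
  rw [cons_zsmul]
  rfl

/-- The values of a family of multilinear maps on sequences of homogeneous elements. -/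
abbrev ev (a : LInftyAlg k A) {W : Type*} [AddCommGroup W] [Module k W]
    (ω : (n : ℕ) → MultilinearMap k (fun _ : Fin n => A) W) (n : ℕ) (z : Fin n → a.Letter) : W :=
  ω n (a.vals z)

/-- The total bidegree in `A[1]` of a sequence of homogeneous elements. -/
def sdeg (a : LInftyAlg k A) {n : ℕ} (z : Fin n → a.Letter) : ℤ × ℤ := ∑ j, ((z j).1 + (-1, 0))

theorem sdeg_cons (a : LInftyAlg k A) {n : ℕ} (u : a.Letter) (z : Fin n → a.Letter) :
    a.sdeg (Fin.cons u z : Fin (n + 1) → a.Letter) = u.1 + (-1, 0) + a.sdeg z := by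
  simp [sdeg, Fin.sum_univ_succ]

theorem sdeg_pick (a : LInftyAlg k A) {n : ℕ} (S : Finset (Fin n)) (z : Fin n → a.Letter) :
    a.sdeg (pick S z) + a.sdeg (pick Sᶜ z) = a.sdeg z :=
  sum_pick_add_sum_pick_compl S (fun u : a.Letter => u.1 + (-1, 0)) z

theorem mL_deg (a : LInftyAlg k A) {n : ℕ} (z : Fin n → a.Letter) :
    (a.mL n z).1 + (-1, 0) = a.sdeg z + (1, 0) := by
  simp only [mL, sdeg, sum_add_distrib]
  ext
  · simp; ring
  · simp

theorem exists_letters (a : LInftyAlg k A) {n : ℕ} (d : Fin n → ℤ × ℤ) (x : Fin n → A)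
    (hx : ∀ j, x j ∈ a.gr (d j)) :
    ∃ z : Fin n → a.Letter, a.vals z = x ∧ ∀ j, (z j).1 = d j :=
  ⟨fun j => ⟨d j, x j, hx j⟩, rfl, fun _ => rfl⟩

theorem multilinear_ext (a : LInftyAlg k A) {W : Type*} [AddCommGroup W] [Module k W] {n : ℕ}
    {f g : MultilinearMap k (fun _ : Fin n => A) W}
    (h : ∀ z : Fin n → a.Letter, f (a.vals z) = g (a.vals z)) : f = g :=
  multilinear_ext_of_homogeneous a.isInternal fun d x hx => by
    obtain ⟨z, rfl, _⟩ := a.exists_letters d x hx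
    exact h z

theorem forms_ext (a : LInftyAlg k A) {ω η : Forms k A}
    (h : ∀ n (z : Fin n → a.Letter), a.ev ω n z = a.ev η n z) : ω = η :=
  funext fun n => a.multilinear_ext (h n)

/-- On letters, which carry their degrees, the signs no longer need a decomposition by parity, and
the differential becomes the formal operation `dFam`. Identities of cochains are proved there and
returned by `forms_ext`. -/
theorem ev_ceDiff (a : LInftyAlg k A) (ω : Forms k A) {n : ℕ} (z : Fin n → a.Letter) :
    a.ev (a.ceDiff ω) n z = dFam a.lpar a.mL (a.ev ω) n z := by
  refine (a.ceDiff_apply ω n (fun j => (z j).1) (a.vals z) fun j => (z j).2.2).trans ?_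
  refine sum_congr rfl fun S _ => ?_
  simp only [ev, vals_cons]
  rfl

theorem mem_cochains_iff (a : LInftyAlg k A) {p q : ℤ} {ω : Forms k A} :
    ω ∈ a.cochains p q ↔ SymmFam a.lpar (a.ev ω) ∧
      ∀ n (z : Fin n → a.Letter), a.sdeg z ≠ (-p, -q) → a.ev ω n z = 0 := by
  constructor
  · intro h
    exact ⟨fun n z σ => (h n (fun j => (z j).1) (a.vals z) fun j => (z j).2.2).1 σ,
      fun n z => (h n (fun j => (z j).1) (a.vals z) fun j => (z j).2.2).2⟩
  · rintro ⟨h1, h2⟩ n d x hx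
    exact ⟨fun σ => h1 n (fun j => ⟨d j, x j, hx j⟩) σ, h2 n fun j => ⟨d j, x j, hx j⟩⟩

theorem symmFam_ev_mL (a : LInftyAlg k A) {W : Type*} [AddCommGroup W] [Module k W]
    (ω : (n : ℕ) → MultilinearMap k (fun _ : Fin n => A) W) (q : ℕ) (z : Fin q → a.Letter) :
    SymmFam a.lpar fun p y => a.ev ω (q + 1) (Fin.cons (a.mL p y) z) := by
  intro n y σ
  have h := a.shiftBr_symm n y σ
  simp only [ev, vals_cons]
  rw [← cons_zsmul]
  exact congrArg (fun u => ω (q + 1) (Fin.cons u (a.vals z))) h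

theorem shuf_ev_mL (a : LInftyAlg k A) {W : Type*} [AddCommGroup W] [Module k W]
    (ω : (n : ℕ) → MultilinearMap k (fun _ : Fin n => A) W) (r : ℕ) (w : Fin r → a.Letter) (n : ℕ)
    (x : Fin n → a.Letter) : shuf a.lpar (fun p q y z =>
      a.ev ω (r + 1) (Fin.cons (a.mL (q + 1) (Fin.cons (a.mL p y) z)) w)) x = 0 := by
  have h := congrArg (headMap (ω (r + 1)) (a.vals w)) (a.shiftBr_jacobi x)
  rw [map_shuf, map_zero] at h
  rw [← h]
  refine shuf_congr fun S => ?_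
  simp only [ev]
  rw [vals_cons]
  rfl

theorem dFam_dFam_ev [CharZero k] (a : LInftyAlg k A) {W : Type*} [AddCommGroup W] [Module k W]
    (ω : (n : ℕ) → MultilinearMap k (fun _ : Fin n => A) W) (h : SymmFam a.lpar (a.ev ω)) {n : ℕ}
    (z : Fin n → a.Letter) : dFam a.lpar a.mL (dFam a.lpar a.mL (a.ev ω)) n z = 0 := by
  refine dFam_dFam h a.lpar_mL (fun r w n x => a.shuf_ev_mL ω r w n x) (fun w hw => ?_) z
  rw [← two_smul k] at hw
  exact (smul_eq_zero.1 hw).resolve_left two_ne_zero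

theorem ceDiff_mem_cochains (a : LInftyAlg k A) {p q : ℤ} {ω : Forms k A}
    (h : ω ∈ a.cochains p q) : a.ceDiff ω ∈ a.cochains (p + 1) q := by
  rw [mem_cochains_iff] at h ⊢
  have he : a.ev (a.ceDiff ω) = dFam a.lpar a.mL (a.ev ω) :=
    funext fun n => funext fun z => a.ev_ceDiff ω z
  refine ⟨he ▸ dFam_symm h.1 fun q z => a.symmFam_ev_mL ω q z, fun n z hz => ?_⟩
  rw [he]
  unfold dFam shuf
  refine sum_eq_zero fun S _ => ?_
  beta_reduce
  rw [h.2, smul_zero]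
  intro h'
  apply hz
  rw [sdeg_cons, mL_deg, add_right_comm, sdeg_pick] at h'
  rw [← sub_eq_of_eq_add h'.symm]
  ext <;> simp
  ring

theorem ceDiff_ceDiff [CharZero k] (a : LInftyAlg k A) {p q : ℤ} {ω : Forms k A}
    (h : ω ∈ a.cochains p q) : a.ceDiff (a.ceDiff ω) = 0 := by
  rw [mem_cochains_iff] at h
  have he : a.ev (a.ceDiff ω) = dFam a.lpar a.mL (a.ev ω) :=
    funext fun n => funext fun z => a.ev_ceDiff ω z
  refine a.forms_ext fun n z => ?_
  rw [ev_ceDiff, he, a.dFam_dFam_ev ω h.1]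
  rfl

/-- The family of multilinear maps given by a sum over unshuffles. -/
noncomputable def shufMap (a : LInftyAlg k A) {W : Type*} [AddCommGroup W] [Module k W]
    (Φ : (p q : ℕ) → MultilinearMap k (fun _ : Fin p => A)
      (MultilinearMap k (fun _ : Fin q => A) W)) (n : ℕ) :
    MultilinearMap k (fun _ : Fin n => A) W :=
  ofHomogeneous a.isInternal n fun d => ∑ S : Finset (Fin n),
    koszulSign (splitLabel S) (fun j => parity (d j) + 1) •
      (MultilinearMap.uncurrySum (Φ #S #Sᶜ)).domDomCongr (finSumEquivOfFinset (s := S) rfl rfl)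

theorem ev_shufMap (a : LInftyAlg k A) {W : Type*} [AddCommGroup W] [Module k W]
    (Φ : (p q : ℕ) → MultilinearMap k (fun _ : Fin p => A)
      (MultilinearMap k (fun _ : Fin q => A) W)) {n : ℕ} (z : Fin n → a.Letter) :
    a.ev (a.shufMap Φ) n z = shuf a.lpar (fun p q y z => Φ p q (a.vals y) (a.vals z)) z := by
  simp only [ev, shufMap]
  rw [ofHomogeneous_apply a.isInternal _ (fun j => (z j).1) (a.vals z) fun j => (z j).2.2]
  simp only [_root_.sum_apply, _root_.smul_apply, MultilinearMap.domDomCongr_apply,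
    MultilinearMap.uncurrySum_apply]
  rfl

end

end LInftyAlg

/-! ### Strict Lie algebras and the binary bracket -/

section LieIdentities

variable {k : Type*} [Field k] {A : Type*} [AddCommGroup A] [Module k A]

theorem pairProd_fin_zero (f : Fin 0 → Fin 0 → ℤ) : pairProd f = 1 := by simp [pairProd]

theorem cons_eq_vec_two {A : Type*} (y : A) (z : Fin 1 → A) :
    (Fin.cons y z : Fin 2 → A) = ![y, z 0] := by
  ext j
  fin_cases j <;> rfl

/-- With only a binary bracket, the two-element subsets are the only ones that contribute. -/
theorem jacobi_sum_three {br : (n : ℕ) → MultilinearMap k (fun _ : Fin n => A) A}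
    (h : ∀ n, n ≠ 2 → br n = 0) (e : Fin 3 → ZMod 2) (x : Fin 3 → A) :
    ∑ S : Finset (Fin 3), ((-1) ^ (#S * #Sᶜ) * koszulSign (splitLabel S) (fun _ => 1) *
          koszulSign (splitLabel S) e) • br (#Sᶜ + 1) (Fin.cons (br #S (pick S x)) (pick Sᶜ x)) =
      br 2 ![br 2 ![x 0, x 1], x 2] - paritySign (e 1 * e 2) • br 2 ![br 2 ![x 0, x 2], x 1] +
        paritySign (e 0 * (e 1 + e 2)) • br 2 ![br 2 ![x 1, x 2], x 0] := by
  have hsub : ({{0, 1}, {0, 2}, {1, 2}} : Finset (Finset (Fin 3))) ⊆ univ := subset_univ _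
  rw [← sum_subset hsub]
  swap
  · intro S _ hS
    have : #S ≠ 2 := by revert S; decide
    rw [h _ this]
    rw [show (Fin.cons ((0 : MultilinearMap k (fun _ : Fin #S => A) A) (pick S x)) (pick Sᶜ x) :
      Fin (#Sᶜ + 1) → A) = Fin.cons 0 (pick Sᶜ x) from rfl]
    have : br (#Sᶜ + 1) (Fin.cons 0 (pick Sᶜ x) : Fin (#Sᶜ + 1) → A) = 0 :=
      map_zero (headMap (br (#Sᶜ + 1)) (pick Sᶜ x))
    rw [this, smul_zero]
  have key : ∀ (S : Finset (Fin 3)) (i j l : Fin 3), i < j → S = {i, j} → Sᶜ = {l} →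
      br (#Sᶜ + 1) (Fin.cons (br #S (pick S x)) (pick Sᶜ x)) = br 2 ![br 2 ![x i, x j], x l] := by
    intro S i j l hij hS hSc
    rw [pick_eq_of_strictMono (g := ![i, j]) (S := S) (by simpa [Fin.strictMono_iff_lt_succ] using hij)
      (fun t => by rw [hS]; simp [Fin.exists_fin_two, eq_comm]) x fun p y => br p y]
    refine (pick_eq_of_strictMono (g := ![l]) (S := Sᶜ) (Subsingleton.strictMono _)
      (fun t => by rw [hSc]; simp [eq_comm]) x fun p z =>
        br (p + 1) (Fin.cons (br 2 (x ∘ ![i, j])) z)).trans ?_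
    rw [cons_eq_vec_two]
    have : x ∘ ![i, j] = ![x i, x j] := by
      ext t; fin_cases t <;> rfl
    rw [this]
    rfl
  rw [sum_insert (by decide), sum_insert (by decide), sum_singleton,
    key {0, 1} 0 1 2 (by decide) rfl (by decide), key {0, 2} 0 2 1 (by decide) rfl (by decide),
    key {1, 2} 1 2 0 (by decide) rfl (by decide)]
  have hs : ∀ S : Finset (Fin 3), koszulSign (splitLabel S) e =
      (if 1 ∈ S ∧ 0 ∉ S then paritySign (e 0 * e 1) else 1) *
      (if 2 ∈ S ∧ 0 ∉ S then paritySign (e 0 * e 2) else 1) *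
      (if 2 ∈ S ∧ 1 ∉ S then paritySign (e 1 * e 2) else 1) := by
    intro S
    simp [koszulSign_eq_pairProd, pairProd_succ, splitLabel_lt, Fin.prod_univ_succ,
      pairProd_fin_zero]
  simp only [hs]
  have h1 : ((-1) ^ (#({0, 1} : Finset (Fin 3)) * #({0, 1} : Finset (Fin 3))ᶜ) *
    koszulSign (splitLabel ({0, 1} : Finset (Fin 3))) (fun _ => 1) : ℤ) = 1 := by decide
  have h2 : ((-1) ^ (#({0, 2} : Finset (Fin 3)) * #({0, 2} : Finset (Fin 3))ᶜ) *
    koszulSign (splitLabel ({0, 2} : Finset (Fin 3))) (fun _ => 1) : ℤ) = -1 := by decide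
  have h3 : ((-1) ^ (#({1, 2} : Finset (Fin 3)) * #({1, 2} : Finset (Fin 3))ᶜ) *
    koszulSign (splitLabel ({1, 2} : Finset (Fin 3))) (fun _ => 1) : ℤ) = 1 := by decide
  rw [h1, h2, h3]
  simp [mul_add, paritySign_add, sub_eq_add_neg, add_assoc]

theorem jacobi_sum_ne_three {br : (n : ℕ) → MultilinearMap k (fun _ : Fin n => A) A}
    (h : ∀ n, n ≠ 2 → br n = 0) {n : ℕ} (hn : n ≠ 3) (c : Finset (Fin n) → ℤ) (x : Fin n → A) :
    ∑ S : Finset (Fin n), c S • br (#Sᶜ + 1) (Fin.cons (br #S (pick S x)) (pick Sᶜ x)) = 0 := by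
  refine sum_eq_zero fun S _ => ?_
  by_cases hS : #S = 2
  · have := card_add_card_compl S
    rw [Fintype.card_fin] at this
    rw [h (#Sᶜ + 1) (by omega)]
    simp
  · rw [h _ hS]
    have : br (#Sᶜ + 1) (Fin.cons 0 (pick Sᶜ x) : Fin (#Sᶜ + 1) → A) = 0 :=
      map_zero (headMap (br (#Sᶜ + 1)) (pick Sᶜ x))
    rw [_root_.zero_apply, this, smul_zero]

theorem koszulSign_swap_two (e : Fin 2 → ZMod 2) :
    koszulSign (Equiv.swap (0 : Fin 2) 1).symm e = paritySign (e 0 * e 1) := by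
  rw [koszulSign_perm_symm, pairProd_succ, pairProd_succ, pairProd_fin_zero]
  simp [mul_comm (e 1)]

/-- The family of brackets that has only a binary bracket. -/
def binaryFamily (b : MultilinearMap k (fun _ : Fin 2 => A) A) :
    (n : ℕ) → MultilinearMap k (fun _ : Fin n => A) A
  | 2 => b
  | 0 => 0
  | 1 => 0
  | _ + 3 => 0

theorem binaryFamily_of_ne (b : MultilinearMap k (fun _ : Fin 2 => A) A) (n : ℕ) (hn : n ≠ 2) :
    binaryFamily b n = 0 := by
  match n, hn with
  | 0, _ => rfl
  | 1, _ => rfl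
  | 2, h => exact absurd rfl h
  | _ + 3, _ => rfl

theorem eta_two {A : Type*} (x : Fin 2 → A) : x = ![x 0, x 1] := by
  ext j; fin_cases j <;> rfl

end LieIdentities

namespace LInftyAlg

/-- A strict Lie algebra from a graded antisymmetric binary bracket with the Jacobi identity. -/
def ofLie {k : Type u} [Field k] {A : Type v} [AddCommGroup A] [Module k A]
    (gr : ℤ × ℤ → Submodule k A) (h : DirectSum.IsInternal gr)
    (b : MultilinearMap k (fun _ : Fin 2 => A) A)
    (hmem : ∀ i j, ∀ x ∈ gr i, ∀ y ∈ gr j, b ![x, y] ∈ gr (i + j))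
    (hanti : ∀ i j, ∀ x ∈ gr i, ∀ y ∈ gr j,
      b ![y, x] = - (paritySign (parity i * parity j) • b ![x, y]))
    (hjac : ∀ i j l, ∀ x ∈ gr i, ∀ y ∈ gr j, ∀ z ∈ gr l,
      b ![b ![x, y], z] - paritySign (parity j * parity l) • b ![b ![x, z], y] +
        paritySign (parity i * (parity j + parity l)) • b ![b ![y, z], x] = 0) :
    LInftyAlg k A where
  gr := gr
  isInternal := h
  br := binaryFamily b
  br_zero := rfl
  br_mem n d x hx := by
    by_cases hn : n = 2
    · subst hn
      have := hmem _ _ _ (hx 0) _ (hx 1)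
      rw [← eta_two] at this
      simpa [binaryFamily, Fin.sum_univ_two, Prod.mk_zero_zero] using this
    · rw [binaryFamily_of_ne b n hn]
      exact zero_mem _
  br_antisymm n d x hx σ := by
    by_cases hn : n = 2
    · subst hn
      have hσ : σ = 1 ∨ σ = Equiv.swap 0 1 := by revert σ; decide
      rcases hσ with rfl | rfl
      · have : koszulSign (Equiv.symm (1 : Equiv.Perm (Fin 2))) (fun j => parity (d j)) = 1 := by
          rw [koszulSign_perm_symm]
          refine (pairProd_congr fun a b hab => ?_).trans pairProd_one
          exact if_neg (not_lt_of_gt hab)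
        simp [this]
      · rw [koszulSign_swap_two]
        have h1 := hanti _ _ _ (hx 0) _ (hx 1)
        have h2 : x ∘ Equiv.swap 0 1 = ![x 1, x 0] := by
          ext j; fin_cases j <;> rfl
        rw [h2]
        refine h1.trans ?_
        rw [← eta_two x]
        simp [binaryFamily]
    · rw [binaryFamily_of_ne b n hn]; simp
  jacobi n d x hx := by
    by_cases hn : n = 3
    · subst hn
      rw [jacobi_sum_three (binaryFamily_of_ne b)]
      exact hjac _ _ _ _ (hx 0) _ (hx 1) _ (hx 2)
    · exact jacobi_sum_ne_three (binaryFamily_of_ne b) hn _ x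

section

variable {k : Type u} [Field k] {A : Type v} [AddCommGroup A] [Module k A]

/-- The binary bracket. -/
def lie (a : LInftyAlg k A) : A →ₗ[k] A →ₗ[k] A :=
  LinearMap.mk₂ k (fun x y => a.br 2 ![x, y])
    (fun x x' y => by simpa using (a.br 2).cons_add ![y] x x')
    (fun c x y => by simpa using (a.br 2).cons_smul ![y] c x)
    (fun x y y' => by
      have h : ∀ y, Function.update ![x, 0] 1 y = ![x, y] := fun y => by
        ext t; fin_cases t <;> rfl
      have := (a.br 2).map_update_add ![x, 0] 1 y y'
      rwa [h, h, h] at this)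
    (fun c x y => by
      have h : ∀ y, Function.update ![x, 0] 1 y = ![x, y] := fun y => by
        ext t; fin_cases t <;> rfl
      have := (a.br 2).map_update_smul ![x, 0] 1 c y
      rwa [h, h] at this)

theorem lie_apply (a : LInftyAlg k A) (x y : A) : a.lie x y = a.br 2 ![x, y] := rfl

theorem br_two (a : LInftyAlg k A) (x : Fin 2 → A) : a.br 2 x = a.lie (x 0) (x 1) := by
  rw [lie_apply, ← eta_two]

theorem lie_mem (a : LInftyAlg k A) {i j : ℤ × ℤ} {x y : A} (hx : x ∈ a.gr i) (hy : y ∈ a.gr j) :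
    a.lie x y ∈ a.gr (i + j) := by
  have := a.br_mem 2 ![i, j] ![x, y] (fun t => by fin_cases t <;> simpa)
  simpa [lie_apply, Fin.sum_univ_two, Prod.mk_zero_zero] using this

theorem lie_antisymm (a : LInftyAlg k A) {i j : ℤ × ℤ} {x y : A} (hx : x ∈ a.gr i)
    (hy : y ∈ a.gr j) : a.lie y x = -(paritySign (parity i * parity j) • a.lie x y) := by
  have := a.br_antisymm 2 ![i, j] ![x, y] (fun t => by fin_cases t <;> simpa) (Equiv.swap 0 1)
  rw [koszulSign_swap_two] at this
  have h2 : ![x, y] ∘ Equiv.swap (0 : Fin 2) 1 = ![y, x] := by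
    ext j; fin_cases j <;> rfl
  rw [h2] at this
  rw [lie_apply, lie_apply, this]
  simp

theorem IsStrictLie.jacobi {a : LInftyAlg k A} (ha : a.IsStrictLie) {i j l : ℤ × ℤ} {x y z : A}
    (hx : x ∈ a.gr i) (hy : y ∈ a.gr j) (hz : z ∈ a.gr l) :
    a.lie (a.lie x y) z - paritySign (parity j * parity l) • a.lie (a.lie x z) y +
      paritySign (parity i * (parity j + parity l)) • a.lie (a.lie y z) x = 0 := by
  have := a.jacobi 3 ![i, j, l] ![x, y, z] (fun t => by fin_cases t <;> simpa)
  rwa [jacobi_sum_three ha] at this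

theorem IsStrictLie.lie_lie {a : LInftyAlg k A} (ha : a.IsStrictLie) {i j l : ℤ × ℤ} {x y z : A}
    (hx : x ∈ a.gr i) (hy : y ∈ a.gr j) (hz : z ∈ a.gr l) :
    a.lie x (a.lie y z) =
      a.lie (a.lie x y) z - paritySign (parity j * parity l) • a.lie (a.lie x z) y := by
  have h := ha.jacobi hx hy hz
  have h2 := a.lie_antisymm hx (a.lie_mem hy hz)
  rw [parity_add] at h2
  rw [h2, smul_neg, smul_smul, paritySign_mul_self, one_smul, add_neg_eq_zero] at h
  exact h.symm

/-- The Lie algebra given by the binary bracket of a minimal `L_∞` algebra. -/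
def quad (a : LInftyAlg k A) (h : a.IsMinimal) : LInftyAlg k A where
  gr := a.gr
  isInternal := a.isInternal
  br n := if n = 2 then a.br n else 0
  br_zero := by simp
  br_mem n d x hx := by
    split_ifs
    · exact a.br_mem n d x hx
    · exact zero_mem _
  br_antisymm n d x hx σ := by
    split_ifs
    · exact a.br_antisymm n d x hx σ
    · simp
  jacobi n d x hx := by
    by_cases hn : n = 3
    · subst hn
      rw [← a.jacobi 3 d x hx]
      refine sum_congr rfl fun S _ => ?_
      congr 1
      have hc := card_add_card_compl S
      rw [Fintype.card_fin] at hc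
      have hz : ∀ n (f : MultilinearMap k (fun _ : Fin (n + 1) => A) A) (z : Fin n → A),
        f (Fin.cons 0 z : Fin (n + 1) → A) = 0 := fun n f z => map_zero (headMap f z)
      -- For #S = 0, 1 the inner bracket is μ₀ or μ₁, and for #S = 3 the outer one is μ₁; all of
      -- these vanish.
      by_cases h2 : #S = 2
      · rw [if_pos h2, if_pos (by omega)]
      · rw [if_neg h2, _root_.zero_apply, hz]
        have h3 : #S = 0 ∨ #S = 1 ∨ #S = 3 := by omega
        rcases h3 with h3 | h3 | h3
        · have : a.br #S = 0 := by rw [h3]; exact a.br_zero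
          rw [this, _root_.zero_apply, hz]
        · have : a.br #S = 0 := by rw [h3]; exact h
          rw [this, _root_.zero_apply, hz]
        · have : a.br (#Sᶜ + 1) = 0 := by rw [show #Sᶜ + 1 = 1 by omega]; exact h
          rw [this, _root_.zero_apply]
    · exact jacobi_sum_ne_three (fun n hn => if_neg hn) hn _ x

theorem quad_isStrictLie (a : LInftyAlg k A) (h : a.IsMinimal) : (a.quad h).IsStrictLie :=
  fun _ hn => if_neg hn

theorem IsStrictLie.isMinimal {a : LInftyAlg k A} (ha : a.IsStrictLie) : a.IsMinimal :=
  ha 1 (by decide)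

theorem IsStrictLie.quad_eq {a : LInftyAlg k A} (ha : a.IsStrictLie) :
    a.quad ha.isMinimal = a := by
  have h : (fun n => if n = 2 then a.br n else 0) = a.br := by
    funext n
    split_ifs with hn
    · rfl
    · exact (ha n hn).symm
  obtain ⟨gr, hi, br, h0, h1, h2, h3⟩ := a
  simp only at h
  unfold quad
  congr

/-! ### Strict morphisms -/

/-- A linear map of bidegree `(0, 0)` that commutes with all brackets. -/
def IsStrictHom {B : Type*} [AddCommGroup B] [Module k B] (a : LInftyAlg k A) (b : LInftyAlg k B)
    (F : A →ₗ[k] B) : Prop :=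
  (∀ i, ∀ x ∈ a.gr i, F x ∈ b.gr i) ∧ ∀ n (x : Fin n → A), F (a.br n x) = b.br n fun j => F (x j)

theorem isStrictHom_of_lie {B : Type*} [AddCommGroup B] [Module k B] {a : LInftyAlg k A}
    {b : LInftyAlg k B} (ha : a.IsStrictLie) (hb : b.IsStrictLie) {F : A →ₗ[k] B}
    (h1 : ∀ i, ∀ x ∈ a.gr i, F x ∈ b.gr i) (h2 : ∀ x y, F (a.lie x y) = b.lie (F x) (F y)) :
    a.IsStrictHom b F := by
  refine ⟨h1, fun n x => ?_⟩
  by_cases hn : n = 2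
  · subst hn
    rw [br_two, br_two, h2]
  · rw [ha n hn, hb n hn]; simp

/-- The pullback of forms along a linear map. -/
def pullForms {B : Type*} [AddCommGroup B] [Module k B] (F : A →ₗ[k] B) :
    Forms k B →ₗ[k] Forms k A where
  toFun ω n := (ω n).compLinearMap fun _ => F
  map_add' _ _ := rfl
  map_smul' _ _ := rfl

section

variable {B : Type*} [AddCommGroup B] [Module k B] {a : LInftyAlg k A} {b : LInftyAlg k B}
  {F : A →ₗ[k] B}

theorem pullForms_mem_cochains (hF : ∀ i, ∀ x ∈ a.gr i, F x ∈ b.gr i) {p q : ℤ} {ω : Forms k B}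
    (h : ω ∈ b.cochains p q) : pullForms F ω ∈ a.cochains p q :=
  fun n d x hx => h n d (fun j => F (x j)) fun j => hF _ _ (hx j)

theorem IsStrictHom.map_shiftBr (hF : a.IsStrictHom b F) (n : ℕ) (d : Fin n → ℤ × ℤ)
    (x : Fin n → A) (hx : ∀ j, x j ∈ a.gr (d j)) :
    F (a.shiftBr n x) = b.shiftBr n fun j => F (x j) := by
  rw [a.shiftBr_apply n d x hx, b.shiftBr_apply n d _ fun j => hF.1 _ _ (hx j), map_zsmul, hF.2]

theorem IsStrictHom.ceDiff_pullForms (hF : a.IsStrictHom b F) (ω : Forms k B) :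
    a.ceDiff (pullForms F ω) = pullForms F (b.ceDiff ω) := by
  refine a.forms_ext fun n z => ?_
  have h1 := a.ceDiff_apply (pullForms F ω) n (fun j => (z j).1) (a.vals z) fun j => (z j).2.2
  have h2 := b.ceDiff_apply ω n (fun j => (z j).1) (fun j => F (a.vals z j))
    fun j => hF.1 _ _ (z j).2.2
  refine h1.trans (Eq.trans ?_ h2.symm)
  refine sum_congr rfl fun S _ => ?_
  congr 1
  have h3 := hF.map_shiftBr #S (fun j => (pick S z j).1) (a.vals (pick S z)) fun j => (pick S z j).2.2
  change ω (#Sᶜ + 1) _ = _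
  congr 1
  ext j
  refine Fin.cases ?_ (fun j => rfl) j
  exact h3

end

end

end LInftyAlg

/-! ### Homogeneous components and the shifted binary bracket -/

namespace LInftyAlg

section

variable {k : Type u} [Field k] {A : Type v} [AddCommGroup A] [Module k A]

/-- The projection onto the part of bidegree `i`. -/
noncomputable def gproj (a : LInftyAlg k A) (i : ℤ × ℤ) : A →ₗ[k] A :=
  (a.gr i).subtype ∘ₗ DirectSum.component k (ℤ × ℤ) (fun i => a.gr i) i ∘ₗ
    (LinearEquiv.ofBijective (DirectSum.coeLinearMap a.gr) a.bijective_coe).symm.toLinearMap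

theorem gproj_mem (a : LInftyAlg k A) (i : ℤ × ℤ) (x : A) : a.gproj i x ∈ a.gr i :=
  Subtype.prop _

theorem gproj_of_mem' (a : LInftyAlg k A) (i : ℤ × ℤ) {j : ℤ × ℤ} {x : A} (hx : x ∈ a.gr j) :
    a.gproj i x = if j = i then x else 0 := by
  have h : (LinearEquiv.ofBijective (DirectSum.coeLinearMap a.gr) a.bijective_coe).symm x =
      DirectSum.lof k (ℤ × ℤ) (fun i => a.gr i) j ⟨x, hx⟩ := by
    rw [LinearEquiv.symm_apply_eq]
    exact (DirectSum.coeLinearMap_lof a.gr j ⟨x, hx⟩).symm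
  simp only [gproj, LinearMap.comp_apply, LinearEquiv.coe_coe, h]
  split_ifs with hij
  · subst hij
    rw [DirectSum.component.lof_self]; rfl
  · rw [DirectSum.component.of]; simp [hij]

theorem gproj_of_mem (a : LInftyAlg k A) {i : ℤ × ℤ} {x : A} (hx : x ∈ a.gr i) :
    a.gproj i x = x := by
  rw [a.gproj_of_mem' i hx, if_pos rfl]

theorem gproj_of_ne (a : LInftyAlg k A) {i j : ℤ × ℤ} (hij : j ≠ i) {x : A} (hx : x ∈ a.gr j) :
    a.gproj i x = 0 := by
  rw [a.gproj_of_mem' i hx, if_neg hij]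

theorem iSup_gr (a : LInftyAlg k A) : ⨆ i, a.gr i = ⊤ := a.isInternal.submodule_iSup_eq_top

theorem homogeneous_induction (a : LInftyAlg k A) {P : A → Prop}
    (h : ∀ i, ∀ x ∈ a.gr i, P x) (hadd : ∀ x y, P x → P y → P (x + y)) (x : A) : P x := by
  have hx : x ∈ ⨆ i, a.gr i := a.iSup_gr ▸ Submodule.mem_top
  exact Submodule.iSup_induction a.gr (motive := P) hx h (h 0 0 (zero_mem _)) hadd

theorem linearMap_ext (a : LInftyAlg k A) {W : Type*} [AddCommGroup W] [Module k W]
    {f g : A →ₗ[k] W} (h : ∀ i, ∀ x ∈ a.gr i, f x = g x) : f = g := by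
  ext x
  refine a.homogeneous_induction (P := fun x => f x = g x) h (fun x y hx hy => ?_) x
  rw [map_add, map_add, hx, hy]

/-- The shifted binary bracket. -/
noncomputable def slie (b : LInftyAlg k A) : A →ₗ[k] A →ₗ[k] A :=
  LinearMap.mk₂ k (fun x y => b.shiftBr 2 ![x, y])
    (fun x x' y => by simpa using (b.shiftBr 2).cons_add ![y] x x')
    (fun c x y => by simpa using (b.shiftBr 2).cons_smul ![y] c x)
    (fun x y y' => by
      have h : ∀ y, Function.update ![x, 0] 1 y = ![x, y] := fun y => by
        ext t; fin_cases t <;> rfl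
      have := (b.shiftBr 2).map_update_add ![x, 0] 1 y y'
      rwa [h, h, h] at this)
    (fun c x y => by
      have h : ∀ y, Function.update ![x, 0] 1 y = ![x, y] := fun y => by
        ext t; fin_cases t <;> rfl
      have := (b.shiftBr 2).map_update_smul ![x, 0] 1 c y
      rwa [h, h] at this)

theorem slie_apply (b : LInftyAlg k A) (x y : A) : b.slie x y = b.shiftBr 2 ![x, y] := rfl

theorem shiftBr_two (b : LInftyAlg k A) (x : Fin 2 → A) :
    b.shiftBr 2 x = b.slie (x 0) (x 1) := by
  rw [slie_apply, ← eta_two]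

theorem slie_eq (b : LInftyAlg k A) {i : ℤ × ℤ} {x : A} (hx : x ∈ b.gr i) (y : A) :
    b.slie x y = paritySign (parity i) • b.lie x y := by
  refine b.homogeneous_induction (P := fun y => b.slie x y = paritySign (parity i) • b.lie x y)
    (fun j y hy => ?_) (fun y y' h h' => ?_) y
  · rw [slie_apply, b.shiftBr_apply 2 ![i, j] ![x, y] (fun t => by fin_cases t <;> simpa),
      lie_apply]
    congr 1
    simp [decalageSign, Fin.prod_univ_two]
  · rw [map_add, map_add, h, h', smul_add]

theorem slie_mem (b : LInftyAlg k A) {i j : ℤ × ℤ} {x y : A} (hx : x ∈ b.gr i) (hy : y ∈ b.gr j) :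
    b.slie x y ∈ b.gr (i + j) := by
  rw [b.slie_eq hx]
  exact zsmul_mem (b.lie_mem hx hy) _

theorem slie_symm (b : LInftyAlg k A) {i j : ℤ × ℤ} {x y : A} (hx : x ∈ b.gr i)
    (hy : y ∈ b.gr j) :
    b.slie y x = paritySign ((parity i + 1) * (parity j + 1)) • b.slie x y := by
  rw [b.slie_eq hx, b.slie_eq hy, b.lie_antisymm hx hy, smul_neg, smul_smul, smul_smul, ← neg_smul]
  congr 1
  generalize parity i = e; generalize parity j = f
  revert e f; decide

/-- This is the Jacobi identity multiplied by the sign of the middle element, expressed through the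
shifted bracket. -/
theorem IsStrictLie.slie_jacobi {b : LInftyAlg k A} (hb : b.IsStrictLie) {i j l : ℤ × ℤ}
    {x y z : A} (hx : x ∈ b.gr i) (hy : y ∈ b.gr j) (hz : z ∈ b.gr l) :
    b.slie (b.slie x y) z + paritySign ((parity j + 1) * (parity l + 1)) • b.slie (b.slie x z) y +
      paritySign ((parity i + 1) * ((parity j + 1) + (parity l + 1))) • b.slie (b.slie y z) x = 0 := by
  have h := congrArg (fun w => paritySign (parity j) • w) (hb.jacobi hx hy hz)
  simp only [smul_zero, smul_add, smul_sub, smul_smul] at h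
  rw [← h, b.slie_eq (b.slie_mem hx hy), b.slie_eq (b.slie_mem hx hz), b.slie_eq (b.slie_mem hy hz),
    b.slie_eq hx, b.slie_eq hx, b.slie_eq hy, sub_eq_add_neg, ← neg_smul]
  simp only [map_zsmul, LinearMap.smul_apply, smul_smul, parity_add]
  generalize parity i = e; generalize parity j = f; generalize parity l = g
  congr 1
  · congr 1
    · congr 1
      revert e f; decide
    · congr 1
      revert e f g; decide
  · congr 1
    revert e f g; decide

theorem parity_sdeg (a : LInftyAlg k A) {n : ℕ} (z : Fin n → a.Letter) :
    parity (a.sdeg z) = ∑ t, a.lpar (z t) := by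
  simp only [sdeg, parity_sum, lpar, parity_add]
  refine sum_congr rfl fun t _ => ?_
  congr 1

end

/-! ### The Maurer–Cartan equation: the quadratic term is closed -/

section MaurerCartan

variable {k : Type u} [Field k] {A B : Type*} [AddCommGroup A] [Module k A]
  [AddCommGroup B] [Module k B]

/-- The quadratic expression `½ ∑_S ±[t(x_S), t(x_{Sᶜ})]`. -/
noncomputable def mcSquare (a : LInftyAlg k A) (b : LInftyAlg k B)
    (t : (n : ℕ) → (Fin n → a.Letter) → B) (n : ℕ) (z : Fin n → a.Letter) : B :=
  shuf a.lpar (fun p q y z => (2 : k)⁻¹ • b.slie (t p y) (t q z)) z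

/-- Bianchi identity: d(½[t, t]) = [dt, t] = ½[[t, t], t] = 0, the last step by Jacobi. The equation
dt = ½[t, t] is needed only on proper subsequences, since `t 0 = 0` kills the term in which dt takes
all the arguments. This permits induction on the internal degree. -/
theorem dFam_mcSquare [CharZero k] (a : LInftyAlg k A) {b : LInftyAlg k B} (hb : b.IsStrictLie)
    {t : (n : ℕ) → (Fin n → a.Letter) → B} (h0 : ∀ z, t 0 z = 0)
    (hmem : ∀ n z, t n z ∈ b.gr (a.sdeg z + (1, 0))) {n : ℕ} (z : Fin n → a.Letter)
    (hz : ∀ P : Finset (Fin n), Pᶜ.Nonempty →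
      dFam a.lpar a.mL t #P (pick P z) = a.mcSquare b t #P (pick P z)) :
    dFam a.lpar a.mL (a.mcSquare b t) n z = 0 := by
  have hpar : ∀ n (z : Fin n → a.Letter),
      parity (a.sdeg z + (1, 0)) + 1 = ∑ t, a.lpar (z t) := by
    intro n z
    rw [parity_add, parity_sdeg, add_assoc]
    exact add_zero _
  have h1 := dFam_shuf (par := a.lpar) (m := a.mL)
    (fun p q y z => (2 : k)⁻¹ • b.slie (t p y) (t q z)) z
  refine h1.trans ?_
  rw [shuf3_swap₂₃]
  -- Graded symmetry of the shifted bracket turns [t, dt] into [dt, t], so the two halves of the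
  -- Leibniz rule coincide.
  have h2 : ∀ (p q r : ℕ) (x : Fin p → a.Letter) (y : Fin q → a.Letter) (w : Fin r → a.Letter),
      paritySign (a.lpar (a.mL p x) * ∑ s, a.lpar (y s)) •
        (2 : k)⁻¹ • b.slie (t q y) (t (r + 1) (Fin.cons (a.mL p x) w)) =
      paritySign ((∑ s, a.lpar (y s)) * ∑ s, a.lpar (w s)) •
        (2 : k)⁻¹ • b.slie (t (r + 1) (Fin.cons (a.mL p x) w)) (t q y) := by
    intro p q r x y w
    rw [b.slie_symm (hmem _ (Fin.cons (a.mL p x) w)) (hmem _ y), hpar, hpar, Fin.sum_univ_succ]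
    simp only [Fin.cons_zero, Fin.cons_succ, lpar_mL]
    rw [smul_comm (2 : k)⁻¹, smul_smul]
    congr 1
    generalize ∑ s, a.lpar (x s) = e
    generalize ∑ s, a.lpar (y s) = f
    generalize ∑ s, a.lpar (w s) = g
    revert e f g; decide
  simp only [h2]
  have h3 := shuf3_swap₂₃ (par := a.lpar) (fun p q r x y w =>
    (2 : k)⁻¹ • b.slie (t (q + 1) (Fin.cons (a.mL p x) y)) (t r w)) z
  rw [← h3]
  have ht : ∀ (m : ℕ) (z : Fin m → a.Letter), m = 0 → t m z = 0 := by
    rintro m z rfl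
    exact h0 z
  have h4 : shuf3 a.lpar (fun p q r x y w =>
      (2 : k)⁻¹ • b.slie (t (q + 1) (Fin.cons (a.mL p x) y)) (t r w)) z =
      shuf3 a.lpar (fun p q r x y w =>
        (2 : k)⁻¹ • (2 : k)⁻¹ • b.slie (b.slie (t p x) (t q y)) (t r w)) z := by
    rw [← shuf_shuf_left, ← shuf_shuf_left]
    refine shuf_congr fun S => ?_
    have e1 := map_shuf (par := a.lpar) ((2 : k)⁻¹ • b.slie.flip (t #Sᶜ (pick Sᶜ z)))
      (fun p q y z_1 => t (q + 1) (Fin.cons (a.mL p y) z_1)) (pick S z)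
    have e2 := map_shuf (par := a.lpar) ((2 : k)⁻¹ • b.slie.flip (t #Sᶜ (pick Sᶜ z)))
      (fun p q y z_1 => (2 : k)⁻¹ • b.slie (t p y) (t q z_1)) (pick S z)
    refine e1.symm.trans (Eq.trans ?_ (e2.trans (shuf_congr fun T => ?_)))
    · by_cases hS : Sᶜ.Nonempty
      · exact congrArg _ (hz S hS)
      · have : t #Sᶜ (pick Sᶜ z) = 0 := ht _ _ (by simpa [not_nonempty_iff_eq_empty] using hS)
        rw [this, map_zero, smul_zero]
        rfl
    · simp
  rw [h4]
  set Y := shuf3 a.lpar (fun p q r x y w =>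
        (2 : k)⁻¹ • (2 : k)⁻¹ • b.slie (b.slie (t p x) (t q y)) (t r w)) z with hY
  -- Writing the sum with its blocks in three different orders produces the three terms of the
  -- Jacobi identity; dividing by 3 then gives Y = 0.
  suffices hYYY : Y + Y + Y = 0 by
    have h3Y : (3 : k) • Y = 0 := by
      rw [← hYYY, show (3 : k) = 1 + 1 + 1 by norm_num, add_smul, add_smul, one_smul]
    rw [(smul_eq_zero.1 h3Y).resolve_left (by norm_num), add_zero]
  have hY2 := hY.trans (shuf3_swap₂₃ _ z)
  have hY3 := hY2.trans (shuf3_swap₁₂ _ z)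
  nth_rewrite 1 [hY]
  nth_rewrite 1 [hY2]
  rw [hY3]
  unfold shuf3
  rw [← sum_add_distrib, ← sum_add_distrib]
  refine sum_eq_zero fun c _ => ?_
  rw [← smul_add, ← smul_add]
  beta_reduce
  have hJ := hb.slie_jacobi (hmem _ (pick (fib c 0) z)) (hmem _ (pick (fib c 1) z))
    (hmem _ (pick (fib c 2) z))
  simp only [hpar] at hJ
  rw [mul_add, paritySign_add, mul_smul] at hJ
  simp only [smul_comm _ (2 : k)⁻¹]
  rw [← smul_add, ← smul_add, ← smul_add, ← smul_add, hJ]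
  simp

end MaurerCartan

end LInftyAlg

namespace LInftyAlg

/-! ### Linear families -/

section LinearFamily

variable {k : Type u} [Field k] {A : Type v} [AddCommGroup A] [Module k A] {W : Type*}
  [AddCommGroup W] [Module k W]

/-- The family that is concentrated in arity one, where it is given by `g`. -/
noncomputable def linearFamily (g : A →ₗ[k] W) : (n : ℕ) → MultilinearMap k (fun _ : Fin n => A) W
  | 0 => 0
  | 1 => MultilinearMap.ofSubsingleton k A W (0 : Fin 1) g
  | _ + 2 => 0

theorem linearFamily_of_ne (g : A →ₗ[k] W) {n : ℕ} (hn : n ≠ 1) : linearFamily g n = 0 := by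
  match n, hn with
  | 0, _ => rfl
  | 1, h => exact absurd rfl h
  | _ + 2, _ => rfl

theorem symmFam_linearFamily (a : LInftyAlg k A) (g : A →ₗ[k] W) :
    SymmFam a.lpar (a.ev (linearFamily g)) := by
  intro n z σ
  by_cases hn : n = 1
  · subst hn
    have hσ : σ = 1 := Subsingleton.elim _ _
    have : koszulSign (Equiv.symm σ) (fun j => a.lpar (z j)) = 1 := by
      rw [koszulSign_perm_symm]
      refine (pairProd_congr fun a b hab => ?_).trans pairProd_one
      exact absurd hab (by simp [Subsingleton.elim a b])
    rw [this, one_smul, hσ]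
    rfl
  · simp [ev, linearFamily_of_ne g hn]

/-- A linear form accepts a bracket only if that bracket uses all the arguments, so d of a linear
form is the form composed with the brackets. Hence the closed linear maps are those that kill all
brackets. -/
theorem dFam_linearFamily (a : LInftyAlg k A) (g : A →ₗ[k] W) {n : ℕ} (z : Fin n → a.Letter) :
    dFam a.lpar a.mL (a.ev (linearFamily g)) n z = g (a.shiftBr n (a.vals z)) := by
  unfold dFam shuf
  rw [sum_eq_single univ]
  · have h1 : koszulSign (splitLabel (univ : Finset (Fin n))) (fun j => a.lpar (z j)) = 1 := by
      rw [koszulSign_eq_pairProd]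
      refine (pairProd_congr fun a b hab => ?_).trans pairProd_one
      simp [splitLabel]
    rw [h1, one_smul]
    beta_reduce
    rw [pick_univ z fun m y =>
      a.ev (linearFamily g) (#(univ : Finset (Fin n))ᶜ + 1) (Fin.cons (a.mL m y) (pick univᶜ z))]
    rw [compl_univ, pick_empty z fun m y =>
      a.ev (linearFamily g) (m + 1) (Fin.cons (a.mL n z) y)]
    rfl
  · intro S _ hS
    have : #Sᶜ + 1 ≠ 1 := by
      simpa [compl_eq_empty_iff] using hS
    simp [ev, linearFamily_of_ne g this]
  · simp

theorem forms_ext_of_pos (a : LInftyAlg k A) (ha : a.IsPositive) {n : ℕ}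
    {f g : MultilinearMap k (fun _ : Fin n => A) W}
    (h : ∀ z : Fin n → a.Letter, (∀ j, 0 < (z j).1.2) → f (a.vals z) = g (a.vals z)) : f = g := by
  refine a.multilinear_ext fun z => ?_
  by_cases hz : ∀ j, 0 < (z j).1.2
  · exact h z hz
  · push Not at hz
    obtain ⟨j, hj⟩ := hz
    have h0 : a.vals z j = 0 := by
      exact (Submodule.mem_bot k).1 ((ha _ hj).le (z j).2.2)
    rw [f.map_coord_zero j h0, g.map_coord_zero j h0]

end LinearFamily

/-! ### Exactness with values in a vector space -/

section Solve

variable {k : Type u} [Field k] {A : Type v} [AddCommGroup A] [Module k A]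

/-- Closed cochains of internal degree `q` without components of arity at most one are exact. -/
def IsExactAt (a : LInftyAlg k A) (q : ℤ) : Prop :=
  ∀ p, ∀ ω ∈ a.cochains p q, a.ceDiff ω = 0 → ω 0 = 0 → ω 1 = 0 →
    ∃ η ∈ a.cochains (p - 1) q, a.ceDiff η = ω

theorem map_dFam {W W' : Type*} [AddCommGroup W] [Module k W] [AddCommGroup W'] [Module k W']
    (a : LInftyAlg k A) (g : W →ₗ[k] W') (t : (n : ℕ) → MultilinearMap k (fun _ : Fin n => A) W)
    {n : ℕ} (z : Fin n → a.Letter) :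
    g (dFam a.lpar a.mL (a.ev t) n z) =
      dFam a.lpar a.mL (a.ev fun n => g.compMultilinearMap (t n)) n z :=
  map_shuf g _ z

/-- The equation is solved in each coordinate of a basis of B. As B need not be finite dimensional,
the collected solutions only define a family with values in the full product of copies of k. -/
theorem IsExactAt.exists_vector {a : LInftyAlg k A} {q : ℤ} (h : a.IsExactAt q)
    (ha : a.IsPositive) {B : Type*} [AddCommGroup B] [Module k B] (p : ℤ)
    (ρ : (n : ℕ) → MultilinearMap k (fun _ : Fin n => A) B) (hs : SymmFam a.lpar (a.ev ρ))
    (hd : ∀ n (z : Fin n → a.Letter), a.sdeg z ≠ (-p, -q) → a.ev ρ n z = 0)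
    (hc : ∀ n (z : Fin n → a.Letter), (∀ j, 0 < (z j).1.2) →
      dFam a.lpar a.mL (a.ev ρ) n z = 0) (h0 : ρ 0 = 0) (h1 : ρ 1 = 0) :
    ∃ E : (n : ℕ) → MultilinearMap k (fun _ : Fin n => A) B, SymmFam a.lpar (a.ev E) ∧
      (∀ n (z : Fin n → a.Letter), a.sdeg z ≠ (-(p - 1), -q) → a.ev E n z = 0) ∧
      ∀ n (z : Fin n → a.Letter), dFam a.lpar a.mL (a.ev E) n z = a.ev ρ n z := by
  let e := Module.Basis.ofVectorSpace k B
  let coord (c : Module.Basis.ofVectorSpaceIndex k B) : B →ₗ[k] k := e.coord c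
  let inj : B →ₗ[k] (Module.Basis.ofVectorSpaceIndex k B → k) := LinearMap.pi coord
  have hinj : LinearMap.ker inj = ⊥ := by
    rw [LinearMap.ker_eq_bot]
    intro x y hxy
    exact e.ext_elem fun c => congrFun hxy c
  -- A linear retraction of the product onto B brings the solution back into B. It commutes with d,
  -- which acts on the arguments only.
  obtain ⟨r, hr⟩ := inj.exists_leftInverse_of_injective hinj
  have hω : ∀ c, ∃ η ∈ a.cochains (p - 1) q,
      a.ceDiff η = (fun n => (coord c).compMultilinearMap (ρ n) : Forms k A) := by
    intro c
    refine h p _ ?_ ?_ ?_ ?_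
    · refine a.mem_cochains_iff.2 ⟨fun n z σ => ?_, fun n z hz => ?_⟩
      · have := congrArg (coord c) (hs n z σ)
        rwa [map_zsmul] at this
      · have := congrArg (coord c) (hd n z hz)
        rwa [map_zero] at this
    · refine funext fun n => a.forms_ext_of_pos ha fun z hz => ?_
      refine (a.ev_ceDiff _ z).trans ((a.map_dFam (coord c) ρ z).symm.trans ?_)
      rw [hc n z hz, map_zero]
      rfl
    · change (coord c).compMultilinearMap (ρ 0) = 0
      rw [h0, LinearMap.compMultilinearMap_zero]
    · change (coord c).compMultilinearMap (ρ 1) = 0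
      rw [h1, LinearMap.compMultilinearMap_zero]
  choose η hη hηd using hω
  have hη' := fun c => a.mem_cochains_iff.1 (hη c)
  let P : (n : ℕ) → MultilinearMap k (fun _ : Fin n => A) (Module.Basis.ofVectorSpaceIndex k B → k) :=
    fun n => MultilinearMap.pi fun c => η c n
  refine ⟨fun n => r.compMultilinearMap (P n), fun n z σ => ?_, fun n z hz => ?_, fun n z => ?_⟩
  · change r (P n _) = _ • r (P n _)
    rw [← map_zsmul]
    congr 1
    funext c
    exact (hη' c).1 n z σ
  · have : P n (a.vals z) = 0 := funext fun c => (hη' c).2 n z hz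
    change r (P n _) = 0
    rw [this, map_zero]
  · rw [← a.map_dFam r P z]
    have : dFam a.lpar a.mL (a.ev P) n z = inj (a.ev ρ n z) := by
      funext c
      have h1 := a.map_dFam (LinearMap.proj c : _ →ₗ[k] k) P z
      refine h1.trans ?_
      have h2 := congrFun (hηd c) n
      have h3 := congrArg (fun f => f (a.vals z)) h2
      exact (a.ev_ceDiff (η c) z).symm.trans h3
    rw [this]
    exact LinearMap.congr_fun hr _

end Solve

section Stage

/-- The multilinear map `(x, y) ↦ β (f x) (g y)`. -/
def pairing {k A B B' W : Type*} [Field k] [AddCommGroup A] [Module k A] [AddCommGroup B]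
    [Module k B] [AddCommGroup B'] [Module k B'] [AddCommGroup W] [Module k W]
    (β : B →ₗ[k] B' →ₗ[k] W) {p q : ℕ} (f : MultilinearMap k (fun _ : Fin p => A) B)
    (g : MultilinearMap k (fun _ : Fin q => A) B') :
    MultilinearMap k (fun _ : Fin p => A) (MultilinearMap k (fun _ : Fin q => A) W) :=
  LinearMap.compMultilinearMap
    { toFun x := (β x).compMultilinearMap g
      map_add' x y := by ext; simp
      map_smul' c x := by ext; simp } f

variable {k : Type u} [Field k] {A : Type v} [AddCommGroup A] [Module k A] {B : Type*}
  [AddCommGroup B] [Module k B]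

/-- The expression `mcSquare` of a family of multilinear maps, as a family of multilinear maps. -/
noncomputable def mcMap (a : LInftyAlg k A) (b : LInftyAlg k B)
    (t : (n : ℕ) → MultilinearMap k (fun _ : Fin n => A) B) (n : ℕ) :
    MultilinearMap k (fun _ : Fin n => A) B :=
  a.shufMap (fun p q => pairing ((2 : k)⁻¹ • b.slie) (t p) (t q)) n

theorem ev_mcMap (a : LInftyAlg k A) (b : LInftyAlg k B)
    (t : (n : ℕ) → MultilinearMap k (fun _ : Fin n => A) B) {n : ℕ} (z : Fin n → a.Letter) :
    a.ev (a.mcMap b t) n z = a.mcSquare b (a.ev t) n z :=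
  (a.ev_shufMap (fun p q => pairing ((2 : k)⁻¹ • b.slie) (t p) (t q)) z).trans rfl

end Stage

end LInftyAlg

namespace LInftyAlg

/-! ### Solving the Maurer–Cartan equation by internal degree -/

section Stage

variable {k : Type u} [Field k] {A : Type v} [AddCommGroup A] [Module k A] {B : Type*}
  [AddCommGroup B] [Module k B]

theorem sdeg_comp_perm (a : LInftyAlg k A) {n : ℕ} (z : Fin n → a.Letter)
    (σ : Equiv.Perm (Fin n)) : a.sdeg (z ∘ σ) = a.sdeg z :=
  Equiv.sum_comp σ fun j => (z j).1 + (-1, 0)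

theorem sdeg_snd (a : LInftyAlg k A) {n : ℕ} (z : Fin n → a.Letter) :
    (a.sdeg z).2 = ∑ j, (z j).1.2 := by
  simp [sdeg, Prod.snd_sum]

theorem sdeg_snd_pick_pos (a : LInftyAlg k A) {n : ℕ} {z : Fin n → a.Letter}
    (hz : ∀ j, 0 < (z j).1.2) {S : Finset (Fin n)} (hS : S.Nonempty) :
    0 < (a.sdeg (pick S z)).2 := by
  rw [sdeg_snd, sum_pick S fun u : a.Letter => u.1.2]
  exact sum_pos (fun j _ => hz j) hS

theorem dFam_congr_sdeg (a : LInftyAlg k A) {W : Type*} [AddCommGroup W]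
    {s t : (n : ℕ) → (Fin n → a.Letter) → W} {n : ℕ} {z : Fin n → a.Letter}
    (h : ∀ m (y : Fin m → a.Letter), a.sdeg y = a.sdeg z + (1, 0) → s m y = t m y) :
    dFam a.lpar a.mL s n z = dFam a.lpar a.mL t n z := by
  refine shuf_congr fun S => h _ _ ?_
  rw [sdeg_cons, mL_deg, ← a.sdeg_pick S z, add_right_comm]

/-- The quadratic term is triangular: empty blocks contribute zero, and nonempty blocks of letters
of positive degree leave strictly less internal degree for the other factor. -/
theorem mcSquare_congr (a : LInftyAlg k A) {b : LInftyAlg k B}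
    {s t : (n : ℕ) → (Fin n → a.Letter) → B} (hs : ∀ z, s 0 z = 0) (ht : ∀ z, t 0 z = 0)
    {n : ℕ} {z : Fin n → a.Letter} (hz : ∀ j, 0 < (z j).1.2)
    (h : ∀ m (y : Fin m → a.Letter), (a.sdeg y).2 < (a.sdeg z).2 → s m y = t m y) :
    a.mcSquare b s n z = a.mcSquare b t n z := by
  have hs' : ∀ m (y : Fin m → a.Letter), m = 0 → s m y = 0 := by rintro m y rfl; exact hs y
  have ht' : ∀ m (y : Fin m → a.Letter), m = 0 → t m y = 0 := by rintro m y rfl; exact ht y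
  refine shuf_congr fun S => ?_
  rcases S.eq_empty_or_nonempty with hS | hS
  · rw [hs' _ _ (card_eq_zero.2 hS), ht' _ _ (card_eq_zero.2 hS)]
    simp
  rcases Sᶜ.eq_empty_or_nonempty with hS' | hS'
  · rw [hs' _ _ (card_eq_zero.2 hS'), ht' _ _ (card_eq_zero.2 hS')]
    simp
  have h1 := congrArg Prod.snd (a.sdeg_pick S z)
  rw [Prod.snd_add] at h1
  have h2 := a.sdeg_snd_pick_pos hz hS
  have h3 := a.sdeg_snd_pick_pos hz hS'
  rw [h _ (pick S z) (by omega), h _ (pick Sᶜ z) (by omega)]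

theorem mcSquare_of_le_one (a : LInftyAlg k A) {b : LInftyAlg k B}
    {t : (n : ℕ) → (Fin n → a.Letter) → B} (ht : ∀ z, t 0 z = 0) {n : ℕ} (hn : n ≤ 1)
    (z : Fin n → a.Letter) : a.mcSquare b t n z = 0 := by
  have ht' : ∀ m (y : Fin m → a.Letter), m = 0 → t m y = 0 := by rintro m y rfl; exact ht y
  refine (shuf_congr fun S => ?_).trans (shuf_zero z)
  have hc := card_add_card_compl S
  rw [Fintype.card_fin] at hc
  have : #S = 0 ∨ #Sᶜ = 0 := by omega
  rcases this with h | h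
  · rw [ht' _ _ h]; simp
  · rw [ht' _ _ h]; simp

theorem mcSquare_mem (a : LInftyAlg k A) {b : LInftyAlg k B}
    {t : (n : ℕ) → (Fin n → a.Letter) → B} (hmem : ∀ n z, t n z ∈ b.gr (a.sdeg z + (1, 0)))
    {n : ℕ} (z : Fin n → a.Letter) : a.mcSquare b t n z ∈ b.gr (a.sdeg z + (2, 0)) := by
  unfold mcSquare shuf
  refine sum_mem fun S _ => zsmul_mem (Submodule.smul_mem _ _ ?_) _
  have := b.slie_mem (hmem _ (pick S z)) (hmem _ (pick Sᶜ z))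
  rwa [add_add_add_comm, a.sdeg_pick] at this

theorem mcSquare_symm (a : LInftyAlg k A) (b : LInftyAlg k B)
    {t : (n : ℕ) → (Fin n → a.Letter) → B} (h : SymmFam a.lpar t) :
    SymmFam a.lpar (a.mcSquare b t) := by
  refine shuf_symm (fun q z n y σ => ?_) fun p y n z σ => ?_
  · beta_reduce
    rw [h n y σ, map_zsmul, LinearMap.smul_apply, smul_comm]
  · beta_reduce
    rw [h n z σ, map_zsmul, smul_comm]

theorem symmFam_add {X W : Type*} [AddCommGroup W] {par : X → ZMod 2}
    {s t : (n : ℕ) → (Fin n → X) → W} (hs : SymmFam par s) (ht : SymmFam par t) :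
    SymmFam par fun n z => s n z + t n z := by
  intro n z σ
  beta_reduce
  rw [hs n z σ, ht n z σ, smul_add]

/-- A solution of the Maurer–Cartan equation in internal degrees less than `w` that extends
`φ` on the range of `π`. -/
structure MCStage (a : LInftyAlg k A) (b : LInftyAlg k B) (φ : A →ₗ[k] B) (π : A →ₗ[k] A) (w : ℕ)
    (τ : (n : ℕ) → MultilinearMap k (fun _ : Fin n => A) B) : Prop where
  zero : τ 0 = 0
  mem : ∀ n z, a.ev τ n z ∈ b.gr (a.sdeg z + (1, 0))
  symm : SymmFam a.lpar (a.ev τ)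
  van : ∀ n z, (w : ℤ) ≤ (a.sdeg z).2 → a.ev τ n z = 0
  eqn : ∀ n z, (∀ j, 0 < (z j).1.2) → (a.sdeg z).2 < w →
    dFam a.lpar a.mL (a.ev τ) n z = a.mcSquare b (a.ev τ) n z
  one : ∀ i, i.2 < (w : ℤ) → ∀ u ∈ a.gr i, τ 1 (fun _ => π u) = φ (π u)

/-- Obstruction theory: in internal degree w the quadratic term is closed by `dFam_mcSquare` and
vanishes in arities 0 and 1, so by exactness it has a primitive. The primitive is adjusted by a
closed linear term to have the prescribed values on the range of `π`, and its degree w part is added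
to `τ`. -/
theorem MCStage.exists_step [CharZero k] {a : LInftyAlg k A} {b : LInftyAlg k B}
    (ha : a.IsPositive) (hb : b.IsStrictLie) {φ : A →ₗ[k] B} {π : A →ₗ[k] A}
    (hφ : ∀ i, ∀ x ∈ a.gr i, φ x ∈ b.gr i) (hπ : ∀ i, ∀ x ∈ a.gr i, π x ∈ a.gr i)
    (hππ : ∀ x, π (π x) = π x) (hπbr : ∀ n x, π (a.br n x) = 0) {w : ℕ} (hw : 1 ≤ w)
    (hex : a.IsExactAt (-w)) {τ : (n : ℕ) → MultilinearMap k (fun _ : Fin n => A) B}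
    (hτ : a.MCStage b φ π w τ) :
    ∃ τ', a.MCStage b φ π (w + 1) τ' ∧
      ∀ n z, (a.sdeg z).2 < w → a.ev τ' n z = a.ev τ n z := by
  have hτ0 : ∀ z, a.ev τ 0 z = 0 := fun z => by simp [ev, hτ.zero]
  have hR : ∀ n z, a.ev (a.mcMap b τ) n z ∈ b.gr (a.sdeg z + (2, 0)) := fun n z => by
    rw [ev_mcMap]
    exact a.mcSquare_mem hτ.mem z
  have hR1 : ∀ n, n ≤ 1 → a.mcMap b τ n = 0 := fun n hn => a.multilinear_ext fun z =>
    (a.ev_mcMap b τ z).trans (a.mcSquare_of_le_one hτ0 hn z)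
  -- The quadratic term takes values in degree `sdeg z + (2, 0)`. Its component of degree i is
  -- therefore a cochain of bidegree (2 - i.1, -w) with values in B, to which exactness applies.
  have hE : ∀ i : ℤ × ℤ, i.2 = w → ∃ E : (n : ℕ) → MultilinearMap k (fun _ : Fin n => A) B,
      SymmFam a.lpar (a.ev E) ∧ ∀ n (z : Fin n → a.Letter),
        dFam a.lpar a.mL (a.ev E) n z = b.gproj i (a.ev (a.mcMap b τ) n z) := by
    intro i hi
    have hdeg : ∀ n (z : Fin n → a.Letter), a.sdeg z ≠ (-(2 - i.1), - -(w : ℤ)) →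
        b.gproj i (a.ev (a.mcMap b τ) n z) = 0 := fun n z hz => by
      refine b.gproj_of_ne (fun h => hz ?_) (hR n z)
      rw [← h] at hi
      simp only [Prod.snd_add, add_zero] at hi
      rw [← h]
      ext <;> simp [hi]
    obtain ⟨E, h1, -, h3⟩ := hex.exists_vector ha (2 - i.1)
      (fun n => (b.gproj i).compMultilinearMap (a.mcMap b τ n)) (fun n z σ => by
        have := a.mcSquare_symm b hτ.symm n z σ
        rw [← ev_mcMap, ← ev_mcMap] at this
        have := congrArg (b.gproj i) this
        rwa [map_zsmul] at this) hdeg (fun n z hz => by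
        by_cases hzw : (a.sdeg z).2 = w
        · rw [← map_dFam]
          have h1 : a.ev (a.mcMap b τ) = a.mcSquare b (a.ev τ) :=
            funext fun n => funext fun z => a.ev_mcMap b τ z
          rw [h1, a.dFam_mcSquare hb hτ0 hτ.mem, map_zero]
          intro P hP
          refine hτ.eqn _ _ (fun j => hz _) ?_
          have h1 := congrArg Prod.snd (a.sdeg_pick P z)
          rw [Prod.snd_add] at h1
          have h2 := a.sdeg_snd_pick_pos hz hP
          omega
        · rw [a.dFam_congr_sdeg (t := fun _ _ => 0)]
          · exact shuf_zero z
          · intro m y hy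
            refine hdeg m y fun h => hzw ?_
            rw [hy] at h
            have := congrArg Prod.snd h
            simpa using this)
      (by rw [hR1 0 (by simp), LinearMap.compMultilinearMap_zero])
      (by rw [hR1 1 le_rfl, LinearMap.compMultilinearMap_zero])
    exact ⟨E, h1, h3⟩
  choose! E hEs hEd using hE
  -- This replaces the arity one part of `E i` by `φ` on the range of `π`. It does not change dE,
  -- because `π` kills all brackets.
  let l (i : ℤ × ℤ) : A →ₗ[k] B :=
    (φ - (MultilinearMap.ofSubsingleton k A B (0 : Fin 1)).symm (E i 1)) ∘ₗ π
  let E' (i : ℤ × ℤ) (n : ℕ) := E i n + linearFamily (l i) n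
  have hEs' : ∀ i : ℤ × ℤ, i.2 = w → SymmFam a.lpar (a.ev (E' i)) := fun i hi =>
    symmFam_add (hEs i hi) (a.symmFam_linearFamily (l i))
  have hEd' : ∀ i : ℤ × ℤ, i.2 = w → ∀ n (z : Fin n → a.Letter),
      dFam a.lpar a.mL (a.ev (E' i)) n z = b.gproj i (a.ev (a.mcMap b τ) n z) := fun i hi n z => by
    have h1 : dFam a.lpar a.mL (a.ev (E' i)) n z = dFam a.lpar a.mL (a.ev (E i)) n z +
      dFam a.lpar a.mL (a.ev (linearFamily (l i))) n z := shuf_add _ _ z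
    have h2 : l i (a.br n (a.vals z)) = 0 := by
      change (φ - _) (π _) = 0
      rw [hπbr, map_zero]
    rw [h1, hEd i hi, dFam_linearFamily,
      a.shiftBr_apply n (fun j => (z j).1) (a.vals z) fun j => (z j).2.2, map_zsmul, h2, smul_zero,
      add_zero]
  -- The primitives for the various target degrees are assembled: on a sequence z only the primitive
  -- for the degree `sdeg z + (1, 0)` of the value of τ is kept.
  let η (n : ℕ) : MultilinearMap k (fun _ : Fin n => A) B :=
    ofHomogeneous a.isInternal n fun d => if (∑ j, (d j + (-1, 0)) + (1, 0) : ℤ × ℤ).2 = w then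
      (b.gproj (∑ j, (d j + (-1, 0)) + (1, 0))).compMultilinearMap
        (E' (∑ j, (d j + (-1, 0)) + (1, 0)) n) else 0
  have hη : ∀ n (z : Fin n → a.Letter), a.ev η n z = if (a.sdeg z).2 = w then
      b.gproj (a.sdeg z + (1, 0)) (a.ev (E' (a.sdeg z + (1, 0))) n z) else 0 := fun n z => by
    have h1 := ofHomogeneous_apply a.isInternal (fun d : Fin n → ℤ × ℤ =>
      if (∑ j, (d j + (-1, 0)) + (1, 0) : ℤ × ℤ).2 = w then
      (b.gproj (∑ j, (d j + (-1, 0)) + (1, 0))).compMultilinearMap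
        (E' (∑ j, (d j + (-1, 0)) + (1, 0)) n) else 0) (fun j => (z j).1) (a.vals z)
        fun j => (z j).2.2
    refine h1.trans ?_
    have h2 : (∑ j, ((z j).1 + (-1, 0)) + (1, 0) : ℤ × ℤ).2 = (a.sdeg z).2 := by
      rw [Prod.snd_add, add_zero]; rfl
    rw [h2]
    split_ifs <;> rfl
  have hτ' : ∀ n z, a.ev (fun n => τ n + η n) n z = a.ev τ n z + a.ev η n z := fun n z => rfl
  have hlt : ∀ n z, (a.sdeg z).2 < w → a.ev (fun n => τ n + η n) n z = a.ev τ n z := by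
    intro n z hz
    rw [hτ', hη, if_neg hz.ne, add_zero]
  have hge : ∀ n z, (a.sdeg z).2 = w → a.ev (fun n => τ n + η n) n z =
      b.gproj (a.sdeg z + (1, 0)) (a.ev (E' (a.sdeg z + (1, 0))) n z) := by
    intro n z hz
    rw [hτ', hη, if_pos hz, hτ.van n z hz.ge, zero_add]
  have h0 : ∀ z, a.ev (fun n => τ n + η n) 0 z = 0 := fun z => by
    rw [hlt, hτ0]
    simp [sdeg]; omega
  refine ⟨fun n => τ n + η n, ⟨a.multilinear_ext h0, fun n z => ?_, ?_, fun n z hz => ?_,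
    fun n z hz hzw => ?_, fun i hi u hu => ?_⟩, hlt⟩
  · rw [hτ', hη]
    refine add_mem (hτ.mem n z) ?_
    split_ifs
    · exact b.gproj_mem _ _
    · exact zero_mem _
  · refine symmFam_add hτ.symm fun n z σ => ?_
    change a.ev η n _ = _ • a.ev η n _
    rw [hη, hη, sdeg_comp_perm]
    split_ifs with h
    · rw [hEs' _ (by simpa using h) n z σ, map_zsmul]
    · simp
  · push_cast at hz
    rw [hτ', hη, if_neg (by omega), hτ.van n z (by omega), zero_add]
  · push_cast at hzw
    rw [a.mcSquare_congr h0 hτ0 hz fun m y hy => hlt m y (by omega)]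
    rcases (Int.lt_add_one_iff.1 hzw).lt_or_eq with h | h
    · rw [← hτ.eqn n z hz h]
      refine a.dFam_congr_sdeg fun m y hy => hlt m y ?_
      rw [hy]
      simpa using h
    · have h2 : a.sdeg z + (1, 0) + (1, 0) = a.sdeg z + (2, 0) := by
        rw [add_assoc]; rfl
      rw [a.dFam_congr_sdeg (t := a.ev fun n =>
        (b.gproj (a.sdeg z + (2, 0))).compMultilinearMap (E' (a.sdeg z + (2, 0)) n)),
        ← map_dFam, hEd' _ (by simpa using h), b.gproj_of_mem (b.gproj_mem _ _),
        b.gproj_of_mem (hR n z), ev_mcMap]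
      intro m y hy
      rw [hge m y (by rw [hy]; simpa using h), hy, h2]
      rfl
  · push_cast at hi
    have h1 : a.sdeg (fun _ : Fin 1 => (⟨i, π u, hπ i u hu⟩ : a.Letter)) = i + (-1, 0) := by
      simp [sdeg]
    rcases (Int.lt_add_one_iff.1 hi).lt_or_eq with h | h
    · rw [← hτ.one i h u hu]
      exact hlt 1 (fun _ => ⟨i, π u, hπ i u hu⟩) (by rw [h1]; simpa using h)
    · refine (hge 1 (fun _ => ⟨i, π u, hπ i u hu⟩) (by rw [h1]; simpa using h)).trans ?_
      have h2 : i + (-1, 0) + (1, 0) = i := by ext <;> simp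
      rw [h1, h2]
      have h3 : a.ev (E' i) 1 (fun _ => ⟨i, π u, hπ i u hu⟩) = φ (π u) := by
        change E i 1 (fun _ => π u) + (φ (π (π u)) - E i 1 (fun _ => π (π u))) = _
        rw [hππ, add_sub_cancel]
      rw [h3, b.gproj_of_mem (hφ i _ (hπ i u hu))]

end Stage

end LInftyAlg

namespace LInftyAlg

/-! ### L∞ morphisms into strict Lie algebras -/

section Hom

variable {k : Type u} [Field k] {A : Type v} [AddCommGroup A] [Module k A] {B : Type*}
  [AddCommGroup B] [Module k B]

theorem shiftBr_eq_zero (a : LInftyAlg k A) {n : ℕ} (h : a.br n = 0) : a.shiftBr n = 0 :=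
  a.multilinear_ext fun z => by
    rw [a.shiftBr_apply n (fun j => (z j).1) (a.vals z) fun j => (z j).2.2, h]
    simp

theorem ev_cons_eq_zero (a : LInftyAlg k A) (t : (n : ℕ) → MultilinearMap k (fun _ : Fin n => A) B)
    {n : ℕ} {u : a.Letter} (hu : (u.2 : A) = 0) (z : Fin n → a.Letter) :
    a.ev t (n + 1) (Fin.cons u z) = 0 :=
  (t (n + 1)).map_coord_zero 0 hu

theorem dFam_of_vals_eq_zero (a : LInftyAlg k A)
    (t : (n : ℕ) → MultilinearMap k (fun _ : Fin n => A) B) {n : ℕ} {z : Fin n → a.Letter}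
    {j : Fin n} (hj : a.vals z j = 0) : dFam a.lpar a.mL (a.ev t) n z = 0 := by
  refine (shuf_congr fun S => ?_).trans (shuf_zero z)
  by_cases hS : j ∈ S
  · obtain ⟨s, hs⟩ := mem_iff_exists_orderEmbOfFin.1 hS
    exact a.ev_cons_eq_zero t ((a.shiftBr #S).map_coord_zero s
      ((congrArg (a.vals z) hs).trans hj)) _
  · obtain ⟨s, hs⟩ := mem_iff_exists_orderEmbOfFin.1 (mem_compl.2 hS)
    exact (t (#Sᶜ + 1)).map_coord_zero s.succ ((congrArg (a.vals z) hs).trans hj)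

/-- A strict target leaves only partitions into r = 2 blocks, and 1/2! is the factor ½. Labellings
that are not surjective have an empty block and are killed by `f 0 = 0`, so the sum runs over all
subsets. -/
theorem sum_partitions_eq_mcSquare (a : LInftyAlg k A) {b : LInftyAlg k B} (hb : b.IsStrictLie)
    {f : (n : ℕ) → MultilinearMap k (fun _ : Fin n => A) B} (hf : f 0 = 0) {n : ℕ}
    (z : Fin n → a.Letter) :
    ∑ r ∈ range (n + 1), ((r.factorial : k)⁻¹) •
        ∑ c : Fin n → Fin r with Function.Surjective c,
          koszulSign c (fun j => parity (z j).1 + 1) •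
            b.shiftBr r (fun t => f _ (pick (univ.filter fun j => c j = t) (a.vals z))) =
      a.mcSquare b (a.ev f) n z := by
  have hf' : ∀ m (x : Fin m → A), m = 0 → f m x = 0 := by rintro m y rfl; rw [hf]; rfl
  rw [sum_eq_single 2]
  · rw [sum_filter_of_ne]
    · rw [smul_sum]
      symm
      unfold mcSquare shuf
      refine sum_bij' (fun S _ => splitLabel S) (fun c _ => fib c 0) (fun _ _ => mem_univ _)
        (fun _ _ => mem_univ _) ?_ ?_ ?_
      · intro S _
        ext j
        by_cases h : j ∈ S <;> simp [splitLabel, h]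
      · intro c _
        ext j
        simp only [splitLabel, mem_filter, mem_univ, true_and]
        generalize c j = i
        revert i; decide
      · intro S _
        rw [smul_comm, shiftBr_two]
        have h0 : fib (splitLabel S) 0 = S := by
          ext j
          by_cases h : j ∈ S <;> simp [splitLabel, h]
        have h1 : fib (splitLabel S) 1 = Sᶜ := by
          ext j
          by_cases h : j ∈ S <;> simp [splitLabel, h]
        have key : ∀ T U : Finset (Fin n), T = U →
            f _ (pick T (a.vals z)) = f _ (pick U (a.vals z)) := by rintro T U rfl; rfl
        have e0 := key _ _ h0
        have e1 := key _ _ h1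
        rw [e0, e1, Nat.factorial_two]
        rfl
    · intro c _ hc
      by_contra h
      refine hc ?_
      simp only [Function.Surjective, not_forall] at h
      obtain ⟨t, ht⟩ := h
      rw [(b.shiftBr 2).map_coord_zero t, smul_zero]
      refine hf' _ _ ?_
      rw [card_eq_zero, filter_eq_empty_iff]
      exact fun j _ hj => ht ⟨j, hj⟩
  · intro r _ hr
    rw [b.shiftBr_eq_zero (hb r hr)]
    simp
  · intro hn
    rw [filter_false_of_mem, sum_empty, smul_zero]
    intro c _ hc
    have := Fintype.card_le_of_surjective c hc
    simp at this hn
    omega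

theorem exists_mcStage_seq [CharZero k] {a : LInftyAlg k A} {b : LInftyAlg k B}
    (ha : a.IsPositive) (hb : b.IsStrictLie) {φ : A →ₗ[k] B} {π : A →ₗ[k] A}
    (hφ : ∀ i, ∀ x ∈ a.gr i, φ x ∈ b.gr i) (hπ : ∀ i, ∀ x ∈ a.gr i, π x ∈ a.gr i)
    (hππ : ∀ x, π (π x) = π x) (hπbr : ∀ n x, π (a.br n x) = 0) (hex : ∀ q, a.IsExactAt q) :
    ∃ T : ℕ → (n : ℕ) → MultilinearMap k (fun _ : Fin n => A) B,
      (∀ w, a.MCStage b φ π (w + 1) (T w)) ∧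
      ∀ (w : ℕ) n z, (a.sdeg z).2 < w + 1 → a.ev (T (w + 1)) n z = a.ev (T w) n z := by
  -- The induction starts with τ = 0: there are no elements of internal degree at most 0.
  have h0 : a.MCStage b φ π (0 + 1) (0 : (n : ℕ) → MultilinearMap k (fun _ : Fin n => A) B) := by
    refine ⟨rfl, fun n z => zero_mem _, fun n z σ => (smul_zero _).symm, fun n z hz => rfl,
      fun n z hz hw => ?_, fun i hi u hu => ?_⟩
    · refine (shuf_zero z).trans (Eq.symm ?_)
      refine (shuf_congr fun S => ?_).trans (shuf_zero z)
      change (2 : k)⁻¹ • b.slie 0 0 = 0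
      simp
    · have : π u = 0 := by
        have := hπ i u hu
        rwa [ha i (Int.lt_add_one_iff.1 (by simpa using hi)), Submodule.mem_bot] at this
      rw [this, map_zero]
      rfl
  have hs : ∀ (w : ℕ) (t : {τ : (n : ℕ) → MultilinearMap k (fun _ : Fin n => A) B //
      a.MCStage b φ π (w + 1) τ}), ∃ t' : {τ : (n : ℕ) → MultilinearMap k (fun _ : Fin n => A) B //
      a.MCStage b φ π (w + 1 + 1) τ}, ∀ n z, (a.sdeg z).2 < w + 1 → a.ev t'.1 n z = a.ev t.1 n z := by
    intro w t
    obtain ⟨t', h1, h2⟩ := MCStage.exists_step ha hb hφ hπ hππ hπbr (Nat.le_add_left 1 w) (hex _) t.2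
    exact ⟨⟨t', h1⟩, fun n z hz => h2 n z (by exact_mod_cast hz)⟩
  choose F hF using hs
  let T (w : ℕ) : {τ : (n : ℕ) → MultilinearMap k (fun _ : Fin n => A) B //
      a.MCStage b φ π (w + 1) τ} :=
    Nat.rec (motive := fun w => {τ : (n : ℕ) → MultilinearMap k (fun _ : Fin n => A) B //
      a.MCStage b φ π (w + 1) τ}) ⟨0, h0⟩ F w
  exact ⟨fun w => (T w).1, fun w => (T w).2, fun w => hF w (T w)⟩

end Hom

section Exists

variable {k : Type u} [Field k] {A B : Type v} [AddCommGroup A] [Module k A]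
  [AddCommGroup B] [Module k B]

/-- The successive solutions agree in the degrees already treated, so they have a limit, and the
Maurer–Cartan equation for the limit is the morphism equation. The hypotheses `hππ` and `hπbr`
express that `π` is a projection killing the brackets; only the linear part on its range can be
prescribed. -/
theorem exists_lInftyHom [CharZero k] {a : LInftyAlg k A} {b : LInftyAlg k B}
    (ha : a.IsPositive) (hb : b.IsStrictLie) {φ : A →ₗ[k] B} {π : A →ₗ[k] A}
    (hφ : ∀ i, ∀ x ∈ a.gr i, φ x ∈ b.gr i) (hπ : ∀ i, ∀ x ∈ a.gr i, π x ∈ a.gr i)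
    (hππ : ∀ x, π (π x) = π x) (hπbr : ∀ n x, π (a.br n x) = 0) (hex : ∀ q, a.IsExactAt q) :
    ∃ f : LInftyHom a b, ∀ x, f.f 1 (fun _ => π x) = φ (π x) := by
  obtain ⟨T, hT, hTs⟩ := exists_mcStage_seq ha hb hφ hπ hππ hπbr hex
  have hmono : ∀ w w' : ℕ, w ≤ w' → ∀ n z, (a.sdeg z).2 < w + 1 →
      a.ev (T w') n z = a.ev (T w) n z := by
    intro w w' hw
    induction w', hw using Nat.le_induction with
    | base => intros; rfl
    | succ m hm ih =>
      intro n z hz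
      rw [hTs m n z (by omega), ih n z hz]
  -- On arguments of total internal degree d the solution `T d` is used, which is valid in degrees
  -- less than d + 1.
  let f (n : ℕ) : MultilinearMap k (fun _ : Fin n => A) B :=
    ofHomogeneous a.isInternal n fun d => T (∑ j, (d j + (-1, 0)) : ℤ × ℤ).2.toNat n
  have hf : ∀ (w : ℕ) n z, (a.sdeg z).2 < w + 1 → a.ev f n z = a.ev (T w) n z := by
    intro w n z hz
    refine (ofHomogeneous_apply a.isInternal (fun d : Fin n → ℤ × ℤ =>
      T (∑ j, (d j + (-1, 0)) : ℤ × ℤ).2.toNat n) (fun j => (z j).1) (a.vals z)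
        fun j => (z j).2.2).trans ?_
    change a.ev (T (a.sdeg z).2.toNat) n z = _
    exact (hmono _ w (by omega) n z (by omega)).symm
  have hfd : ∀ n z, ∃ w : ℕ, (a.sdeg z).2 < w + 1 ∧ a.ev f n z = a.ev (T w) n z := fun n z =>
    ⟨(a.sdeg z).2.toNat, by omega, hf _ _ _ (by omega)⟩
  have hf0 : f 0 = 0 := a.multilinear_ext fun z => by
    obtain ⟨w, -, h⟩ := hfd 0 z
    exact h.trans (by simp [ev, (hT w).zero])
  have hmem : ∀ n z, a.ev f n z ∈ b.gr (a.sdeg z + (1, 0)) := fun n z => by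
    obtain ⟨w, -, h⟩ := hfd n z
    rw [h]
    exact (hT w).mem n z
  refine ⟨⟨f, hf0, fun n d x hx => ?_, fun n d x hx σ => ?_, fun n d x hx => ?_⟩, fun x => ?_⟩
  · have := hmem n fun j => ⟨d j, x j, hx j⟩
    convert this using 2
    simp only [sdeg, sum_add_distrib, add_assoc]
    congr 1
    ext
    · simp; ring
    · simp
  · obtain ⟨w, hw, h⟩ := hfd n fun j => ⟨d j, x j, hx j⟩
    have h2 := hf w n ((fun j => (⟨d j, x j, hx j⟩ : a.Letter)) ∘ σ) (by rwa [sdeg_comp_perm])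
    change a.ev f n ((fun j => (⟨d j, x j, hx j⟩ : a.Letter)) ∘ σ) =
      _ • a.ev f n fun j => ⟨d j, x j, hx j⟩
    rw [h, h2]
    exact (hT w).symm n _ σ
  · let z : Fin n → a.Letter := fun j => ⟨d j, x j, hx j⟩
    refine Eq.trans ?_ (a.sum_partitions_eq_mcSquare hb hf0 z).symm
    have h1 : dFam a.lpar a.mL (a.ev f) n z = a.mcSquare b (a.ev f) n z := by
      by_cases hz : ∀ j, 0 < (z j).1.2
      · have hw : (a.sdeg z).2 < (((a.sdeg z).2.toNat : ℕ) : ℤ) + 1 := by omega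
        rw [a.dFam_congr_sdeg (t := a.ev (T (a.sdeg z).2.toNat)),
          (hT _).eqn n z hz (by simp)]
        · refine a.mcSquare_congr ?_ ?_ hz fun m y hy => (hf _ m y (by omega)).symm
          · intro z
            simp [ev, (hT _).zero]
          · intro z
            simp [ev, hf0]
        · intro m y hy
          refine hf _ m y ?_
          rw [hy]
          simp only [Prod.snd_add, add_zero]
          exact hw
      · push Not at hz
        obtain ⟨j, hj⟩ := hz
        have h0 : a.vals z j = 0 := (Submodule.mem_bot k).1 ((ha _ hj).le (z j).2.2)
        rw [a.dFam_of_vals_eq_zero f h0, ← ev_mcMap]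
        exact ((a.mcMap b f n).map_coord_zero j h0).symm
    rw [← h1]
    refine sum_congr rfl fun S _ => ?_
    simp only [ev, vals_cons]
    rfl
  · refine a.homogeneous_induction (P := fun x => f 1 (fun _ => π x) = φ (π x)) (fun i x hx => ?_)
      (fun x y hx hy => ?_) x
    · obtain ⟨w, hw, h⟩ := hfd 1 fun _ => ⟨i, π x, hπ i x hx⟩
      refine h.trans ((hT w).one i ?_ x hx)
      simpa [sdeg_snd] using hw
    · have h1 : ∀ x, f 1 (fun _ => π x) =
        (MultilinearMap.ofSubsingleton k A B (0 : Fin 1)).symm (f 1) (π x) := fun x => rfl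
      rw [h1] at hx hy ⊢
      rw [map_add, map_add, map_add, hx, hy]

/-- The linear part of an `L_∞` morphism. -/
noncomputable def _root_.LInftyHom.linear {a : LInftyAlg k A} {b : LInftyAlg k B}
    (f : LInftyHom a b) : A →ₗ[k] B :=
  (MultilinearMap.ofSubsingleton k A B (0 : Fin 1)).symm (f.f 1)

theorem _root_.LInftyHom.linear_apply {a : LInftyAlg k A} {b : LInftyAlg k B}
    (f : LInftyHom a b) (x : A) : f.linear x = f.f 1 fun _ => x := rfl

theorem _root_.LInftyHom.linear_mem {a : LInftyAlg k A} {b : LInftyAlg k B}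
    (f : LInftyHom a b) {i : ℤ × ℤ} {x : A} (hx : x ∈ a.gr i) : f.linear x ∈ b.gr i := by
  have := f.f_mem 1 (fun _ => i) (fun _ => x) fun _ => hx
  simpa [LInftyHom.linear_apply, Prod.mk_zero_zero] using this

/-- In arity two, with μ₁ = 0 in the source and a strict target, the morphism equation reads f₁m₂(x,
y) = ½([f₁x, f₁y] ± [f₁y, f₁x]) for shifted brackets, and the two terms are equal by symmetry. -/
theorem _root_.LInftyHom.linear_lie [CharZero k] {a : LInftyAlg k A} {b : LInftyAlg k B}
    (f : LInftyHom a b) (ha : a.IsMinimal) (hb : b.IsStrictLie) (x y : A) :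
    f.linear (a.lie x y) = b.lie (f.linear x) (f.linear y) := by
  revert y
  refine a.homogeneous_induction (P := fun x => ∀ y, f.linear (a.lie x y) =
    b.lie (f.linear x) (f.linear y)) (fun i x hx y => ?_) (fun x x' h h' y => ?_) x
  swap
  · rw [map_add, LinearMap.add_apply, map_add, h, h', map_add, map_add, LinearMap.add_apply]
  refine a.homogeneous_induction (P := fun y => f.linear (a.lie x y) =
    b.lie (f.linear x) (f.linear y)) (fun j y hy => ?_) (fun y y' h h' => ?_) y
  swap
  · rw [map_add, map_add, h, h', map_add, map_add]
  let u : a.Letter := ⟨i, x, hx⟩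
  let v : a.Letter := ⟨j, y, hy⟩
  let z : Fin 2 → a.Letter := Fin.cons u (Fin.cons v Fin.elim0)
  have h1 := f.f_br 2 (fun t => (z t).1) (a.vals z) fun t => (z t).2.2
  rw [a.sum_partitions_eq_mcSquare hb f.f_zero] at h1
  have h2 : dFam a.lpar a.mL (a.ev f.f) 2 z = a.mcSquare b (a.ev f.f) 2 z := by
    refine Eq.trans ?_ h1
    unfold dFam shuf
    refine sum_congr rfl fun S _ => ?_
    simp only [ev, vals_cons]
    rfl
  have hf : ∀ y, a.ev f.f 0 y = 0 := fun y => by simp [ev, f.f_zero]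
  have hm0 : ∀ q (y : Fin 0 → a.Letter) (z : Fin q → a.Letter),
      a.ev f.f (q + 1) (Fin.cons (a.mL 0 y) z) = 0 := fun q y z =>
    a.ev_cons_eq_zero f.f (by simp [mL, a.shiftBr_eq_zero a.br_zero]) z
  have hm1 : ∀ q (y : Fin 1 → a.Letter) (z : Fin q → a.Letter),
      a.ev f.f (q + 1) (Fin.cons (a.mL 1 y) z) = 0 := fun q y z =>
    a.ev_cons_eq_zero f.f (by simp [mL, a.shiftBr_eq_zero ha]) z
  unfold dFam mcSquare at h2
  simp only [z, shuf_cons, shuf_nil, hf, hm0, hm1, map_zero, LinearMap.zero_apply, smul_zero,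
    add_zero, zero_add, Finset.univ_eq_empty, Finset.sum_empty, mul_zero, paritySign_zero,
    one_smul, Fin.sum_univ_succ, Fin.cons_zero] at h2
  have hu : a.ev f.f 1 (Fin.cons u ![]) = f.linear x :=
    congrArg (f.f 1) (funext fun t => by rw [Subsingleton.elim t 0]; rfl)
  have hv : a.ev f.f 1 (Fin.cons v ![]) = f.linear y :=
    congrArg (f.f 1) (funext fun t => by rw [Subsingleton.elim t 0]; rfl)
  have huv : a.ev f.f 1 (Fin.cons (a.mL 2 (Fin.cons u (Fin.cons v ![]))) ![]) =
      paritySign (parity i) • f.linear (a.lie x y) := by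
    rw [← map_zsmul, ← a.slie_eq hx, slie_apply]
    refine congrArg (f.f 1) (funext fun t => ?_)
    rw [Subsingleton.elim t 0]
    refine congrArg (a.shiftBr 2) (funext fun t => ?_)
    fin_cases t <;> rfl
  rw [hu, hv, huv, b.slie_symm (f.linear_mem hx) (f.linear_mem hy), smul_comm (2 : k)⁻¹ (_ : ℤ),
    smul_smul] at h2
  change _ = _ + (paritySign ((parity i + 1) * (parity j + 1)) * _) • _ at h2
  rw [paritySign_mul_self, one_smul, ← add_smul, ← two_mul, mul_inv_cancel₀ two_ne_zero, one_smul,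
    b.slie_eq (f.linear_mem hx)] at h2
  have h3 := congrArg (fun w => paritySign (parity i) • w) h2
  simpa only [smul_smul, paritySign_mul_self, one_smul] using h3

end Exists

end LInftyAlg

theorem paritySign_eq_or (e : ZMod 2) : paritySign e = 1 ∨ paritySign e = -1 := by
  revert e; decide

section Internal

variable {k A : Type*} [Field k] [AddCommGroup A] [Module k A]

theorem isInternal_of_proj {gr : ℤ × ℤ → Submodule k A} (P : ℤ × ℤ → A →ₗ[k] A)
    (h1 : ∀ i, ∀ x ∈ gr i, P i x = x) (h2 : ∀ i j, i ≠ j → ∀ x ∈ gr j, P i x = 0)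
    (htop : ⨆ i, gr i = ⊤) : DirectSum.IsInternal gr := by
  refine DirectSum.isInternal_submodule_of_iSupIndep_of_iSup_eq_top ?_ htop
  intro i
  rw [Submodule.disjoint_def]
  intro x hx hx'
  rw [← h1 i x hx]
  have : ⨆ j, ⨆ (_ : j ≠ i), gr j ≤ LinearMap.ker (P i) :=
    iSup₂_le fun j hj y hy => h2 i j hj.symm y hy
  exact this hx'

end Internal

namespace LInftyAlg

/-! ### Lie algebras from graded bilinear and associative products -/

section OfBilin

variable {k : Type u} [Field k] {A : Type v} [AddCommGroup A] [Module k A]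

/-- A bilinear map as a multilinear map. -/
noncomputable def bilinMultilinear (β : A →ₗ[k] A →ₗ[k] A) :
    MultilinearMap k (fun _ : Fin 2 => A) A :=
  MultilinearMap.mk' (fun x => β (x 0) (x 1))
    (fun m i x y => by
      fin_cases i <;> simp)
    (fun m i c x => by
      fin_cases i <;> simp)

/-- A strict Lie algebra, its bracket on `gr i × gr j` being given by `g i j`. -/
noncomputable def ofBilin (gr : ℤ × ℤ → Submodule k A) (h : DirectSum.IsInternal gr)
    (g : ℤ × ℤ → ℤ × ℤ → A →ₗ[k] A →ₗ[k] A)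
    (hmem : ∀ i j, ∀ x ∈ gr i, ∀ y ∈ gr j, g i j x y ∈ gr (i + j))
    (hanti : ∀ i j, ∀ x ∈ gr i, ∀ y ∈ gr j,
      g j i y x = - (paritySign (parity i * parity j) • g i j x y))
    (hjac : ∀ i j l, ∀ x ∈ gr i, ∀ y ∈ gr j, ∀ z ∈ gr l,
      g (i + j) l (g i j x y) z -
        paritySign (parity j * parity l) • g (i + l) j (g i l x z) y +
        paritySign (parity i * (parity j + parity l)) • g (j + l) i (g j l y z) x = 0) :
    LInftyAlg k A :=
  have hb : ∀ i j, ∀ x ∈ gr i, ∀ y ∈ gr j,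
      ofHomogeneous h 2 (fun d => bilinMultilinear (g (d 0) (d 1))) ![x, y] = g i j x y :=
    fun i j x hx y hy => ofHomogeneous_apply h _ ![i, j] ![x, y] fun t => by fin_cases t <;> simpa
  ofLie gr h (ofHomogeneous h 2 fun d => bilinMultilinear (g (d 0) (d 1)))
    (fun i j x hx y hy => by rw [hb i j x hx y hy]; exact hmem i j x hx y hy)
    (fun i j x hx y hy => by rw [hb i j x hx y hy, hb j i y hy x hx]; exact hanti i j x hx y hy)
    (fun i j l x hx y hy z hz => by
      rw [hb i j x hx y hy, hb i l x hx z hz, hb j l y hy z hz,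
        hb _ _ _ (hmem i j x hx y hy) z hz, hb _ _ _ (hmem i l x hx z hz) y hy,
        hb _ _ _ (hmem j l y hy z hz) x hx]
      exact hjac i j l x hx y hy z hz)

variable {gr : ℤ × ℤ → Submodule k A} {h : DirectSum.IsInternal gr}
    {g : ℤ × ℤ → ℤ × ℤ → A →ₗ[k] A →ₗ[k] A}
    {hmem : ∀ i j, ∀ x ∈ gr i, ∀ y ∈ gr j, g i j x y ∈ gr (i + j)}
    {hanti : ∀ i j, ∀ x ∈ gr i, ∀ y ∈ gr j,
      g j i y x = - (paritySign (parity i * parity j) • g i j x y)}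
    {hjac : ∀ i j l, ∀ x ∈ gr i, ∀ y ∈ gr j, ∀ z ∈ gr l,
      g (i + j) l (g i j x y) z -
        paritySign (parity j * parity l) • g (i + l) j (g i l x z) y +
        paritySign (parity i * (parity j + parity l)) • g (j + l) i (g j l y z) x = 0}

theorem ofBilin_isStrictLie : (ofBilin gr h g hmem hanti hjac).IsStrictLie :=
  fun n hn => binaryFamily_of_ne _ n hn

theorem ofBilin_lie {i j : ℤ × ℤ} {x y : A} (hx : x ∈ gr i) (hy : y ∈ gr j) :
    (ofBilin gr h g hmem hanti hjac).lie x y = g i j x y :=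
  ofHomogeneous_apply h (fun d => bilinMultilinear (g (d 0) (d 1))) ![i, j] ![x, y]
    fun t => by fin_cases t <;> simpa

end OfBilin

section OfAssoc

variable {k : Type u} [Field k] {N : Type v} [AddCommGroup N] [Module k N]

/-- The Lie superalgebra of a graded associative algebra. -/
noncomputable def ofAssoc (gr : ℤ × ℤ → Submodule k N) (h : DirectSum.IsInternal gr)
    (m : N →ₗ[k] N →ₗ[k] N) (hm : ∀ i j, ∀ x ∈ gr i, ∀ y ∈ gr j, m x y ∈ gr (i + j))
    (hassoc : ∀ x y z, m (m x y) z = m x (m y z)) : LInftyAlg k N :=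
  ofBilin gr h (fun i j => m - paritySign (parity i * parity j) • m.flip)
    (fun i j x hx y hy => sub_mem (hm i j x hx y hy)
      (zsmul_mem (add_comm j i ▸ hm j i y hy x hx) _))
    (fun i j x hx y hy => by
      simp only [LinearMap.sub_apply, LinearMap.smul_apply, LinearMap.flip_apply]
      rw [mul_comm (parity j), smul_sub, smul_smul, paritySign_mul_self, one_smul, neg_sub])
    (fun i j l x hx y hy z hz => by
      simp only [LinearMap.sub_apply, LinearMap.smul_apply, LinearMap.flip_apply, map_sub,
        map_zsmul, hassoc, parity_add]
      generalize parity i = a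
      generalize parity j = b
      generalize parity l = c
      simp only [smul_sub, smul_smul, mul_add, add_mul, paritySign_add, mul_comm c, mul_comm b a]
      obtain h1 | h1 := paritySign_eq_or (a * b) <;> obtain h2 | h2 := paritySign_eq_or (a * c) <;>
        obtain h3 | h3 := paritySign_eq_or (b * c) <;> simp only [h1, h2, h3] <;> simp <;> abel)

variable {gr : ℤ × ℤ → Submodule k N} {h : DirectSum.IsInternal gr} {m : N →ₗ[k] N →ₗ[k] N}
  {hm : ∀ i j, ∀ x ∈ gr i, ∀ y ∈ gr j, m x y ∈ gr (i + j)}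
  {hassoc : ∀ x y z, m (m x y) z = m x (m y z)}

theorem ofAssoc_isStrictLie : (ofAssoc gr h m hm hassoc).IsStrictLie := ofBilin_isStrictLie

theorem ofAssoc_lie {i j : ℤ × ℤ} {x y : N} (hx : x ∈ gr i) (hy : y ∈ gr j) :
    (ofAssoc gr h m hm hassoc).lie x y = m x y - paritySign (parity i * parity j) • m y x := by
  unfold ofAssoc
  rw [ofBilin_lie hx hy]
  rfl

end OfAssoc

/-! ### Semidirect products with right modules -/

section Semidirect

variable {k : Type u} [Field k] {A N : Type v} [AddCommGroup A] [Module k A] [AddCommGroup N]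
  [Module k N]

theorem isInternal_prod {gA : ℤ × ℤ → Submodule k A} (hA : DirectSum.IsInternal gA)
    {gN : ℤ × ℤ → Submodule k N} (hN : DirectSum.IsInternal gN) (P : ℤ × ℤ → A →ₗ[k] A)
    (Q : ℤ × ℤ → N →ₗ[k] N)
    (h1 : ∀ i, ∀ x ∈ gA i, P i x = x) (h2 : ∀ i j, i ≠ j → ∀ x ∈ gA j, P i x = 0)
    (h3 : ∀ i, ∀ x ∈ gN i, Q i x = x) (h4 : ∀ i j, i ≠ j → ∀ x ∈ gN j, Q i x = 0) :
    DirectSum.IsInternal fun i => (gA i).prod (gN i) := by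
  refine isInternal_of_proj (fun i => (P i).prodMap (Q i)) ?_ ?_ ?_
  · rintro i ⟨x, n⟩ ⟨hx, hn⟩
    exact Prod.ext (h1 i x hx) (h3 i n hn)
  · rintro i j hij ⟨x, n⟩ ⟨hx, hn⟩
    exact Prod.ext (h2 i j hij x hx) (h4 i j hij n hn)
  · rw [eq_top_iff]
    rintro ⟨x, n⟩ -
    have hx : x ∈ ⨆ i, gA i := hA.submodule_iSup_eq_top ▸ Submodule.mem_top
    have hn : n ∈ ⨆ i, gN i := hN.submodule_iSup_eq_top ▸ Submodule.mem_top
    have e1 : (⨆ i, gA i).map (LinearMap.inl k A N) ≤ ⨆ i, (gA i).prod (gN i) := by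
      rw [Submodule.map_iSup]
      refine iSup_mono fun i => ?_
      rintro _ ⟨y, hy, rfl⟩
      exact ⟨hy, zero_mem _⟩
    have e2 : (⨆ i, gN i).map (LinearMap.inr k A N) ≤ ⨆ i, (gA i).prod (gN i) := by
      rw [Submodule.map_iSup]
      refine iSup_mono fun i => ?_
      rintro _ ⟨y, hy, rfl⟩
      exact ⟨zero_mem _, hy⟩
    have := add_mem (e1 ⟨x, hx, rfl⟩) (e2 ⟨n, hn, rfl⟩)
    simpa using this

/-- A bigraded right module over the Lie algebra `a`, `ρ x n` being `n · x`. -/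
structure RightModule (a : LInftyAlg k A) (N : Type v) [AddCommGroup N] [Module k N] where
  gr : ℤ × ℤ → Submodule k N
  isInternal : DirectSum.IsInternal gr
  proj : ℤ × ℤ → N →ₗ[k] N
  proj_of_mem : ∀ i, ∀ x ∈ gr i, proj i x = x
  proj_of_ne : ∀ i j, i ≠ j → ∀ x ∈ gr j, proj i x = 0
  ρ : A →ₗ[k] N →ₗ[k] N
  ρ_mem : ∀ i j, ∀ n ∈ gr i, ∀ x ∈ a.gr j, ρ x n ∈ gr (i + j)
  ρ_lie : ∀ i j, ∀ x ∈ a.gr i, ∀ y ∈ a.gr j, ∀ n,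
    ρ (a.lie x y) n = ρ y (ρ x n) - paritySign (parity i * parity j) • ρ x (ρ y n)

/-- The semidirect product of a Lie algebra with a right module. -/
noncomputable def semidirect (a : LInftyAlg k A) (ha : a.IsStrictLie) (M : a.RightModule N) :
    LInftyAlg k (A × N) :=
  ofBilin (fun i => (a.gr i).prod (M.gr i))
    (isInternal_prod a.isInternal M.isInternal a.gproj M.proj (fun i x hx => a.gproj_of_mem hx)
      (fun i j hij x hx => a.gproj_of_ne hij.symm hx) M.proj_of_mem M.proj_of_ne)
    (fun i j => LinearMap.mk₂ k (fun X Y => (a.lie X.1 Y.1,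
        M.ρ Y.1 X.2 - paritySign (parity i * parity j) • M.ρ X.1 Y.2))
      (fun X X' Y => by ext <;> simp; abel)
      (fun c X Y => by ext <;> simp [smul_sub, smul_comm c])
      (fun X Y Y' => by ext <;> simp; abel)
      (fun c X Y => by ext <;> simp [smul_sub, smul_comm c]))
    (fun i j X hX Y hY => ⟨a.lie_mem hX.1 hY.1, sub_mem (M.ρ_mem i j _ hX.2 _ hY.1)
      (zsmul_mem (add_comm j i ▸ M.ρ_mem j i _ hY.2 _ hX.1) _)⟩)
    (fun i j X hX Y hY => by
      refine Prod.ext (a.lie_antisymm hX.1 hY.1) ?_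
      simp only [LinearMap.mk₂_apply, Prod.snd_neg, Prod.smul_snd]
      rw [mul_comm (parity j), smul_sub, smul_smul, paritySign_mul_self, one_smul, neg_sub])
    (fun i j l X hX Y hY Z hZ => by
      refine Prod.ext (ha.jacobi hX.1 hY.1 hZ.1) ?_
      simp only [LinearMap.mk₂_apply, Prod.snd_add, Prod.snd_sub, Prod.smul_snd, Prod.snd_zero,
        M.ρ_lie i j X.1 hX.1 Y.1 hY.1, M.ρ_lie i l X.1 hX.1 Z.1 hZ.1,
        M.ρ_lie j l Y.1 hY.1 Z.1 hZ.1, map_sub, map_zsmul, parity_add]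
      generalize parity i = a
      generalize parity j = b
      generalize parity l = c
      simp only [smul_sub, smul_smul, mul_add, add_mul, paritySign_add, mul_comm c, mul_comm b a]
      obtain h1 | h1 := paritySign_eq_or (a * b) <;> obtain h2 | h2 := paritySign_eq_or (a * c) <;>
        obtain h3 | h3 := paritySign_eq_or (b * c) <;> simp only [h1, h2, h3] <;> simp <;> abel)


end Semidirect

end LInftyAlg

section Shuffle

variable {X W : Type*} [AddCommGroup W] {par : X → ZMod 2}

theorem shuf_of_left {Φ : (p q : ℕ) → (Fin p → X) → (Fin q → X) → W}
    (h : ∀ p q y z, p ≠ 0 → Φ p q y z = 0) {n : ℕ} (x : Fin n → X) :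
    shuf par Φ x = Φ 0 n ![] x := by
  unfold shuf
  rw [sum_eq_single ∅]
  · have h1 : koszulSign (splitLabel (∅ : Finset (Fin n))) (fun j => par (x j)) = 1 := by
      rw [koszulSign_eq_pairProd]
      refine (pairProd_congr fun a b hab => ?_).trans pairProd_one
      simp [splitLabel]
    rw [h1, one_smul, pick_empty x fun m y => Φ m #(∅ : Finset (Fin n))ᶜ y (pick ∅ᶜ x), compl_empty,
      pick_univ x fun m y => Φ 0 m _ y]
  · intro S _ hS
    rw [h _ _ _ _ (card_ne_zero.2 (nonempty_iff_ne_empty.2 hS)), smul_zero]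
  · simp

theorem shuf_of_right {Φ : (p q : ℕ) → (Fin p → X) → (Fin q → X) → W}
    (h : ∀ p q y z, q ≠ 0 → Φ p q y z = 0) {n : ℕ} (x : Fin n → X) :
    shuf par Φ x = Φ n 0 x ![] := by
  unfold shuf
  rw [sum_eq_single univ]
  · have h1 : koszulSign (splitLabel (univ : Finset (Fin n))) (fun j => par (x j)) = 1 := by
      rw [koszulSign_eq_pairProd]
      refine (pairProd_congr fun a b hab => ?_).trans pairProd_one
      simp [splitLabel]
    rw [h1, one_smul, pick_univ x fun m y => Φ m #(univ : Finset (Fin n))ᶜ y (pick univᶜ x),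
      compl_univ, pick_empty x fun m y => Φ n m _ y]
  · intro S _ hS
    rw [h _ _ _ _ (by simpa [compl_eq_empty_iff] using hS), smul_zero]
  · simp

/-- The first argument is either inside the bracket or outside it. In the second case the odd
bracket is carried past u, which gives the global sign of u. -/
theorem dFam_cons {m : (n : ℕ) → (Fin n → X) → X}
    (hpar : ∀ n x, par (m n x) = ∑ t, par (x t) + 1) {ω : (n : ℕ) → (Fin n → X) → W}
    (h : SymmFam par ω) (u : X) {n : ℕ} (x : Fin n → X) :
    dFam par m ω (n + 1) (Fin.cons u x) =
      shuf par (fun p q y z => ω (q + 1) (Fin.cons (m (p + 1) (Fin.cons u y)) z)) x +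
      paritySign (par u) • dFam par m (fun n z => ω (n + 1) (Fin.cons u z)) n x := by
  refine (shuf_cons (par := par) _ u x).trans ?_
  congr 1
  refine Eq.trans ?_ (map_shuf (par := par) (DistribSMul.toAddMonoidHom W (paritySign (par u)))
    (fun p q y z => ω (q + 2) (Fin.cons u (Fin.cons (m p y) z))) x).symm
  refine shuf_congr fun S => ?_
  simp only [DistribSMul.toAddMonoidHom_apply]
  rw [h.swap_cons_cons, smul_smul, hpar]
  congr 1
  generalize ∑ t, par (pick S x t) = e
  generalize par u = f
  revert e f; decide

end Shuffle

namespace LInftyAlg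

/-! ### Forms linear in the module: cochains with coefficients -/

section Semidirect

variable {k : Type u} [Field k] {A N : Type v} [AddCommGroup A] [Module k A] [AddCommGroup N]
  [Module k N] {a : LInftyAlg k A} (ha : a.IsStrictLie) (M : a.RightModule N)

theorem semidirect_isStrictLie : (a.semidirect ha M).IsStrictLie := ofBilin_isStrictLie

theorem semidirect_lie {i j : ℤ × ℤ} {X Y : A × N} (hX : X ∈ (a.semidirect ha M).gr i)
    (hY : Y ∈ (a.semidirect ha M).gr j) : (a.semidirect ha M).lie X Y =
      (a.lie X.1 Y.1, M.ρ Y.1 X.2 - paritySign (parity i * parity j) • M.ρ X.1 Y.2) :=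
  ofBilin_lie (gr := fun i => (a.gr i).prod (M.gr i)) hX hY

theorem isStrictHom_of_homogeneous_lie {B C : Type*} [AddCommGroup B] [Module k B]
    [AddCommGroup C] [Module k C] {b : LInftyAlg k B} {c : LInftyAlg k C} (hb : b.IsStrictLie)
    (hc : c.IsStrictLie) {F : B →ₗ[k] C} (h1 : ∀ i, ∀ x ∈ b.gr i, F x ∈ c.gr i)
    (h2 : ∀ i, ∀ x ∈ b.gr i, ∀ j, ∀ y ∈ b.gr j, F (b.lie x y) = c.lie (F x) (F y)) :
    b.IsStrictHom c F := by
  refine isStrictHom_of_lie hb hc h1 fun x y => ?_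
  have : b.lie.compr₂ F = c.lie.compl₁₂ F F :=
    b.linearMap_ext fun i x hx => b.linearMap_ext fun j y hy => h2 i x hx j y hy
  exact LinearMap.congr_fun₂ this x y

theorem isStrictHom_inl : a.IsStrictHom (a.semidirect ha M) (LinearMap.inl k A N) := by
  refine isStrictHom_of_homogeneous_lie ha (semidirect_isStrictLie ha M)
    (fun i x hx => ⟨hx, zero_mem _⟩) fun i x hx j y hy => ?_
  rw [semidirect_lie ha M (i := i) (j := j) ⟨hx, zero_mem _⟩ ⟨hy, zero_mem _⟩]
  simp

/-- The automorphism of the semidirect product that multiplies the module by two. -/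
def scaleTwo (k A N : Type*) [Field k] [AddCommGroup A] [Module k A] [AddCommGroup N]
    [Module k N] : A × N →ₗ[k] A × N :=
  LinearMap.id.prodMap ((2 : k) • LinearMap.id)

/-- The module is an abelian ideal, so scaling it is compatible with the brackets. The eigenvalue 2
of the pullback characterizes forms linear in N, and the differential preserves this eigenspace. -/
theorem isStrictHom_scaleTwo :
    (a.semidirect ha M).IsStrictHom (a.semidirect ha M) (scaleTwo k A N) := by
  have h : ∀ i, ∀ X ∈ (a.semidirect ha M).gr i, scaleTwo k A N X ∈ (a.semidirect ha M).gr i :=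
    fun i X hX => ⟨hX.1, Submodule.smul_mem _ _ hX.2⟩
  refine isStrictHom_of_homogeneous_lie (semidirect_isStrictLie ha M)
    (semidirect_isStrictLie ha M) h fun i X hX j Y hY => ?_
  rw [semidirect_lie ha M hX hY, semidirect_lie ha M (h i X hX) (h j Y hY)]
  simp [scaleTwo, smul_sub, smul_comm (2 : k)]

/-- The letter `(x, 0)`. -/
def inlL (x : a.Letter) : (a.semidirect ha M).Letter := ⟨x.1, (x.2, 0), x.2.2, zero_mem _⟩

/-- The letter `(0, n)`. -/
def inrL {i : ℤ × ℤ} (n : N) (hn : n ∈ M.gr i) : (a.semidirect ha M).Letter :=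
  ⟨i, (0, n), zero_mem _, hn⟩

/-- The family of forms on `A` that is obtained from a form on `A × N` by inserting an element
of `N` as the first argument. -/
noncomputable def contr (η : Forms k (A × N)) : N →ₗ[k] Forms k A where
  toFun n := fun q => ((η (q + 1)).curryLeft (0, n)).compLinearMap fun _ => LinearMap.inl k A N
  map_add' n n' := by
    funext q
    ext x
    have := map_add (headMap (η (q + 1)) fun j => LinearMap.inl k A N (x j)) (0, n) (0, n')
    rw [Prod.mk_add_mk, add_zero] at this
    exact this
  map_smul' c n := by
    funext q
    ext x
    have := map_smul (headMap (η (q + 1)) fun j => LinearMap.inl k A N (x j)) c (0, n)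
    rw [Prod.smul_mk, smul_zero] at this
    exact this

theorem contr_apply (η : Forms k (A × N)) (n : N) (q : ℕ) (x : Fin q → A) :
    contr η n q x = η (q + 1) (Fin.cons (0, n) fun j => (x j, 0)) := rfl

theorem ev_contr (η : Forms k (A × N)) {i : ℤ × ℤ} {n : N} (hn : n ∈ M.gr i) {q : ℕ}
    (x : Fin q → a.Letter) : a.ev (contr η n) q x =
      (a.semidirect ha M).ev η (q + 1) (Fin.cons (inrL ha M n hn) fun j => inlL ha M (x j)) := by
  simp only [ev, vals_cons]
  rfl

theorem sdeg_inlL {n : ℕ} (x : Fin n → a.Letter) :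
    (a.semidirect ha M).sdeg (fun j => inlL ha M (x j)) = a.sdeg x := rfl

theorem contr_mem_cochains {η : Forms k (A × N)} {p q : ℤ}
    (h : η ∈ (a.semidirect ha M).cochains p q) {i : ℤ × ℤ} {n : N} (hn : n ∈ M.gr i) :
    contr η n ∈ a.cochains (p + i.1 - 1) (q + i.2) := by
  rw [mem_cochains_iff] at h ⊢
  refine ⟨fun m z σ => ?_, fun m z hz => ?_⟩
  · rw [ev_contr ha M η hn, ev_contr ha M η hn]
    exact h.1.cons (inrL ha M n hn) m (fun j => inlL ha M (z j)) σ
  · rw [ev_contr ha M η hn]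
    refine h.2 _ _ fun h2 => hz ?_
    rw [sdeg_cons, sdeg_inlL] at h2
    have h3 : a.sdeg z = (-p, -q) - (i + (-1, 0)) := by rw [← h2]; simp [inrL]
    rw [h3]
    ext <;> simp <;> ring

theorem ev_mL_inrL (η : Forms k (A × N)) {i : ℤ × ℤ} {n : N} (hn : n ∈ M.gr i) {p q : ℕ}
    (y : Fin p → a.Letter) (z : Fin q → a.Letter) :
    (a.semidirect ha M).ev η (q + 1) (Fin.cons ((a.semidirect ha M).mL (p + 1)
        (Fin.cons (inrL ha M n hn) fun j => inlL ha M (y j))) fun j => inlL ha M (z j)) =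
      paritySign (parity i) •
        a.ev (contr η (linearFamily (M.ρ.flip n) p (a.vals y))) q z := by
  by_cases hp : p = 1
  · subst hp
    have h1 : (((a.semidirect ha M).mL (1 + 1)
        (Fin.cons (inrL ha M n hn) fun j => inlL ha M (y j))).2 : A × N) =
        paritySign (parity i) • (0, M.ρ (y 0).2 n) := by
      change (a.semidirect ha M).shiftBr 2 _ = _
      rw [shiftBr_two]
      refine ((a.semidirect ha M).slie_eq (inrL ha M n hn).2.2 _).trans ?_
      congr 1
      refine (semidirect_lie ha M (inrL ha M n hn).2.2 (inlL ha M (y 0)).2.2).trans ?_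
      simp [inrL, inlL]
    simp only [ev, vals_cons]
    rw [h1, cons_zsmul]
    rfl
  · rw [linearFamily_of_ne _ hp]
    refine (ev_cons_eq_zero _ (B := k) η ?_ _).trans ?_
    · change (a.semidirect ha M).shiftBr (p + 1) _ = 0
      rw [shiftBr_eq_zero _ (semidirect_isStrictLie ha M _ (by omega))]
      rfl
    · rw [_root_.zero_apply, map_zero]
      exact (smul_zero _).symm

/-- On forms linear in N this is the differential with coefficients in the dual of N: an argument
acts on n, or the form contracted with n is differentiated. -/
theorem ev_contr_ceDiff {η : Forms k (A × N)} {p q : ℤ}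
    (h : η ∈ (a.semidirect ha M).cochains p q) {i : ℤ × ℤ} {n : N} (hn : n ∈ M.gr i) {m : ℕ}
    (x : Fin m → a.Letter) :
    a.ev (contr ((a.semidirect ha M).ceDiff η) n) m x =
      paritySign (parity i) • shuf a.lpar (fun p q y z =>
        a.ev (contr η (linearFamily (M.ρ.flip n) p (a.vals y))) q z) x +
      paritySign (parity i + 1) • a.ev (a.ceDiff (contr η n)) m x := by
  rw [mem_cochains_iff] at h
  rw [ev_contr ha M _ hn, ev_ceDiff, dFam_cons (lpar_mL _) h.1]
  congr 1
  · refine Eq.trans ?_ (map_shuf (DistribSMul.toAddMonoidHom k (paritySign (parity i))) _ x).symm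
    exact shuf_congr (X := a.Letter) (par := a.lpar) (W := k) (x := x)
      (Φ := fun p q y z => (a.semidirect ha M).ev η (q + 1) (Fin.cons ((a.semidirect ha M).mL (p + 1)
        (Fin.cons (inrL ha M n hn) fun j => inlL ha M (y j))) fun j => inlL ha M (z j)))
      fun S => ev_mL_inrL ha M η hn _ _
  · congr 1
    rw [ev_ceDiff]
    refine shuf_congr (X := a.Letter) (par := a.lpar) (W := k) (x := x)
      (Φ := fun p q y z => (a.semidirect ha M).ev η (q + 1 + 1) (Fin.cons (inrL ha M n hn)
        (Fin.cons ((a.semidirect ha M).mL p fun j => inlL ha M (y j)) fun j => inlL ha M (z j))))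
      fun S => ?_
    simp only [ev, vals_cons]
    refine congrArg (η _) (congrArg (Fin.cons _) (funext fun j => ?_))
    refine Fin.cases ?_ (fun j => rfl) j
    exact ((isStrictHom_inl ha M).map_shiftBr _ (fun j => (pick S x j).1) (a.vals (pick S x))
      fun j => (pick S x j).2.2).symm


/-- The family of forms on `A × N` that inserts one element of `N`, in all possible positions, into
a family of forms on `A` that depends linearly on `N`. -/
noncomputable def ext (Z : N →ₗ[k] Forms k A) : Forms k (A × N) :=
  (a.semidirect ha M).shufMap fun p q => linearFamily
    { toFun X := (Z X.2 q).compLinearMap fun _ => LinearMap.fst k A N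
      map_add' X Y := by rw [Prod.snd_add, map_add]; rfl
      map_smul' c X := by rw [Prod.smul_snd, map_smul]; rfl } p

/-- The summands of `ext`. -/
noncomputable def extTerm (Z : N →ₗ[k] Forms k A) (p q : ℕ) (y : Fin p → (a.semidirect ha M).Letter)
    (z : Fin q → (a.semidirect ha M).Letter) : k :=
  if h : p = 1 then Z (y ⟨0, by omega⟩).2.1.2 q fun j => (z j).2.1.1 else 0

theorem ev_ext (Z : N →ₗ[k] Forms k A) {m : ℕ} (z : Fin m → (a.semidirect ha M).Letter) :
    (a.semidirect ha M).ev (ext ha M Z) m z =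
      shuf (a.semidirect ha M).lpar (extTerm ha M Z) z := by
  refine (ev_shufMap _ _ z).trans (shuf_congr fun S => ?_)
  unfold extTerm
  generalize pick S z = y
  generalize pick Sᶜ z = x
  revert y x
  generalize #S = p
  generalize #Sᶜ = q
  intro y x
  split_ifs with hp
  · subst hp
    rfl
  · rw [linearFamily_of_ne _ hp]
    rfl

theorem ext_zero_arity (Z : N →ₗ[k] Forms k A) : ext ha M Z 0 = 0 :=
  multilinear_ext _ fun z => by
    refine (ev_ext ha M Z z).trans ?_
    rw [shuf_nil]
    rfl

theorem contr_ext (Z : N →ₗ[k] Forms k A) : contr (ext ha M Z) = Z := by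
  have h : ∀ i, ∀ n ∈ M.gr i, contr (ext ha M Z) n = Z n := by
    intro i n hn
    refine a.forms_ext fun m x => ?_
    rw [ev_contr ha M _ hn, ev_ext, shuf_cons, shuf_of_left, shuf_congr (Ψ := fun _ _ _ _ => 0),
      shuf_zero, add_zero]
    · rfl
    · intro S
      unfold extTerm
      split_ifs with h
      · have : (pick S (fun j => inlL ha M (x j)) ⟨0, by omega⟩).2.1.2 = 0 := rfl
        rw [this, map_zero]
        exact smul_zero _
      · exact smul_zero _
    · intro p q y z hp
      exact dif_neg (by omega)
  refine LinearMap.ext fun n => ?_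
  have hn : n ∈ ⨆ i, M.gr i := M.isInternal.submodule_iSup_eq_top ▸ Submodule.mem_top
  refine Submodule.iSup_induction M.gr (motive := fun n => contr (ext ha M Z) n = Z n) hn h ?_ ?_
  · rw [map_zero, map_zero]
  · intro x y hx hy
    rw [map_add, map_add, hx, hy]

theorem ext_mem_cochains {Z : N →ₗ[k] Forms k A} {p q : ℤ}
    (hZ : ∀ i, ∀ n ∈ M.gr i, Z n ∈ a.cochains (p + i.1 - 1) (q + i.2)) :
    ext ha M Z ∈ (a.semidirect ha M).cochains p q := by
  have hZ' := fun i n hn => a.mem_cochains_iff.1 (hZ i n hn)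
  rw [mem_cochains_iff]
  refine ⟨?_, fun m z hz => ?_⟩
  · have : (a.semidirect ha M).ev (ext ha M Z) =
        fun n z => shuf (a.semidirect ha M).lpar (extTerm ha M Z) z :=
      funext fun n => funext fun z => ev_ext ha M Z z
    rw [this]
    refine shuf_symm (fun q z n y σ => ?_) fun p y n z σ => ?_
    · unfold extTerm
      by_cases h : n = 1
      · subst h
        rw [Subsingleton.elim σ 1]
        have : koszulSign (Equiv.symm (1 : Equiv.Perm (Fin 1)))
            (fun j => (a.semidirect ha M).lpar (y j)) = 1 := by
          rw [koszulSign_perm_symm]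
          refine (pairProd_congr fun a b hab => ?_).trans pairProd_one
          exact absurd hab (by simp [Subsingleton.elim a b])
        rw [this, one_smul]
        rfl
      · simp [h]
    · unfold extTerm
      by_cases h : p = 1
      · simp only [h, dite_true]
        exact (hZ' _ _ (y _).2.2.2).1 n (fun j => ⟨(z j).1, (z j).2.1.1, (z j).2.2.1⟩) σ
      · simp [h]
  · rw [ev_ext]
    refine (shuf_congr fun S => ?_).trans (shuf_zero z)
    unfold extTerm
    split_ifs with h
    · refine (hZ' _ _ (pick S z ⟨0, by omega⟩).2.2.2).2 _
        (fun j => ⟨(pick Sᶜ z j).1, (pick Sᶜ z j).2.1.1, (pick Sᶜ z j).2.2.1⟩) fun h2 => hz ?_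
      rw [← sdeg_pick _ S z]
      have h3 : (a.semidirect ha M).sdeg (pick S z) = (pick S z ⟨0, by omega⟩).1 + (-1, 0) := by
        have h5 : ∀ (r : ℕ) (hr : r = 1) (y : Fin r → (a.semidirect ha M).Letter),
            (a.semidirect ha M).sdeg y = (y ⟨0, by omega⟩).1 + (-1, 0) := by
          rintro r rfl y
          exact Fin.sum_univ_one _
        exact h5 _ h _
      rw [h3]
      have h4 : (a.semidirect ha M).sdeg (pick Sᶜ z) = _ := h2
      rw [h4]
      ext
      · simp; ring
      · simp
    · rfl

theorem pullForms_scaleTwo_ext (Z : N →ₗ[k] Forms k A) :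
    pullForms (scaleTwo k A N) (ext ha M Z) = (2 : k) • ext ha M Z := by
  refine forms_ext (a.semidirect ha M) fun m z => ?_
  let z' : Fin m → (a.semidirect ha M).Letter := fun j =>
    ⟨(z j).1, scaleTwo k A N (z j).2.1, (isStrictHom_scaleTwo ha M).1 _ _ (z j).2.2⟩
  have h1 : (a.semidirect ha M).ev (ext ha M Z) m z' =
      (2 : k) • (a.semidirect ha M).ev (ext ha M Z) m z := by
    rw [ev_ext, ev_ext]
    refine Eq.trans ?_ (map_shuf ((2 : k) • (LinearMap.id : k →ₗ[k] k)) _ z).symm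
    refine sum_congr rfl fun S _ => ?_
    congr 1
    unfold extTerm
    split_ifs with h
    · have : (pick S z' ⟨0, by omega⟩).2.1.2 = (2 : k) • (pick S z ⟨0, by omega⟩).2.1.2 := rfl
      rw [this, map_smul]
      simp only [LinearMap.smul_apply, dif_pos h]
      rfl
    · simp [h]
  exact h1

/-- A family of forms on `A × N` that is linear in `N` is determined by its contraction. -/
theorem eq_zero_of_contr_eq_zero [CharZero k] {η : Forms k (A × N)} {p q : ℤ}
    (h : η ∈ (a.semidirect ha M).cochains p q)
    (h2 : pullForms (scaleTwo k A N) η = (2 : k) • η) (hc : contr η = 0) : η = 0 := by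
  have hs := ((mem_cochains_iff _).1 h).1
  refine forms_ext (a.semidirect ha M) fun m z => ?_
  have e1 : (a.semidirect ha M).vals z =
      (fun j => ((z j).2.1.1, (0 : N))) + fun j => ((0 : A), (z j).2.1.2) := by
    ext j <;> simp
  refine (congrArg (η m) e1).trans ?_
  rw [MultilinearMap.map_add_univ]
  refine sum_eq_zero fun s _ => ?_
  let z' : Fin m → (a.semidirect ha M).Letter := fun j => if j ∈ s then
    ⟨(z j).1, ((z j).2.1.1, 0), (z j).2.2.1, zero_mem _⟩ else inrL ha M (z j).2.1.2 (z j).2.2.2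
  have v1 : ∀ j ∈ s, (a.semidirect ha M).vals z' j = ((z j).2.1.1, 0) := fun j hj => by
    exact congrArg (fun u : (a.semidirect ha M).Letter => (u.2 : A × N)) (if_pos hj)
  have v2 : ∀ j, j ∉ s → (a.semidirect ha M).vals z' j = (0, (z j).2.1.2) := fun j hj => by
    exact congrArg (fun u : (a.semidirect ha M).Letter => (u.2 : A × N)) (if_neg hj)
  have e2 : s.piecewise (fun j => ((z j).2.1.1, (0 : N))) (fun j => ((0 : A), (z j).2.1.2)) =
      (a.semidirect ha M).vals z' := by
    ext1 j
    by_cases hj : j ∈ s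
    · rw [piecewise_eq_of_mem _ _ _ hj, v1 j hj]
    · rw [piecewise_eq_of_notMem _ _ _ hj, v2 j hj]
  rw [e2]
  have e3 := congrArg (fun f => f ((a.semidirect ha M).vals z')) (congrFun h2 m)
  have e4 : (fun j => scaleTwo k A N ((a.semidirect ha M).vals z' j)) =
      fun j => (if j ∈ s then 1 else 2 : k) • (a.semidirect ha M).vals z' j := by
    ext1 j
    by_cases hj : j ∈ s
    · rw [v1 j hj]; simp [scaleTwo, hj]
    · rw [v2 j hj]; simp [scaleTwo, hj]
  have e5 : η m (fun j => scaleTwo k A N ((a.semidirect ha M).vals z' j)) =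
    (2 : k) • η m ((a.semidirect ha M).vals z') := e3
  rw [e4, MultilinearMap.map_smul_univ] at e5
  -- On arguments with #sᶜ entries from N, pullback multiplies by 2^#sᶜ, while by assumption it
  -- multiplies by 2. So either the value is zero or exactly one entry comes from N.
  have e6 : ∏ j : Fin m, (if j ∈ s then 1 else 2 : k) = 2 ^ #sᶜ := by
    rw [prod_ite]
    simp [← compl_filter]
  rw [e6, ← sub_eq_zero, ← sub_smul] at e5
  rcases smul_eq_zero.1 e5 with h0 | h0
  swap
  · exact h0
  have h1 : #sᶜ = 1 := by
    have : ((2 ^ #sᶜ : ℕ) : k) = ((2 ^ 1 : ℕ) : k) := by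
      push_cast
      simpa using sub_eq_zero.1 h0
    exact Nat.pow_right_injective le_rfl (Nat.cast_injective this)
  obtain ⟨j₀, hj₀⟩ := card_eq_one.1 h1
  have hmem : ∀ j, j ∈ s ↔ j ≠ j₀ := fun j => by
    rw [← mem_compl.not_left, hj₀, mem_singleton]
  cases m with
  | zero => exact j₀.elim0
  | succ m =>
    -- Symmetry moves the single entry from N to the front, where the value is read off from the
    -- contraction.
    have e7 := hs (m + 1) (z' ∘ Equiv.swap 0 j₀) (Equiv.swap 0 j₀)
    have e8 : (z' ∘ Equiv.swap 0 j₀) ∘ Equiv.swap 0 j₀ = z' := by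
      ext1 j
      simp
    rw [e8] at e7
    refine Eq.trans e7 ?_
    let x : Fin m → a.Letter := fun j => ⟨(z (Equiv.swap 0 j₀ j.succ)).1,
      (z (Equiv.swap 0 j₀ j.succ)).2.1.1, (z (Equiv.swap 0 j₀ j.succ)).2.2.1⟩
    have e9 : z' ∘ Equiv.swap 0 j₀ =
        Fin.cons (inrL ha M (z j₀).2.1.2 (z j₀).2.2.2) fun j => inlL ha M (x j) := by
      ext1 j
      refine Fin.cases ?_ (fun j => ?_) j
      · change z' (Equiv.swap 0 j₀ 0) = _
        rw [Equiv.swap_apply_left]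
        exact if_neg (by simp [hmem])
      · have : Equiv.swap 0 j₀ j.succ ≠ j₀ := fun h => by
          rw [Equiv.swap_apply_eq_iff, Equiv.swap_apply_right] at h
          exact Fin.succ_ne_zero j h
        exact if_pos ((hmem _).2 this)
    rw [e9, ← ev_contr ha M η (z j₀).2.2.2, hc]
    exact smul_zero _

end Semidirect

end LInftyAlg

/-- Nonempty words: the word with last letter `v`, preceded by the letters of `l` (in reverse
order), is `(v, l)`. -/
abbrev Word (ι : Type*) := ι × List ι

/-! ### The free associative algebra without unit -/

namespace Word

variable {ι : Type*}

/-- The number of letters. -/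
def len (u : Word ι) : ℕ := u.2.length + 1

/-- Concatenation. -/
def mul (u w : Word ι) : Word ι := (w.1, w.2 ++ u.1 :: u.2)

theorem mul_assoc (u w x : Word ι) : mul (mul u w) x = mul u (mul w x) := by simp [mul]

theorem len_mul (u w : Word ι) : (mul u w).len = u.len + w.len := by
  simp [mul, len]; omega

/-- The total degree of a word. -/
def degree (deg : ι → ℤ × ℤ) (u : Word ι) : ℤ × ℤ := deg u.1 + (u.2.map deg).sum

theorem degree_mul (deg : ι → ℤ × ℤ) (u w : Word ι) :
    (mul u w).degree deg = u.degree deg + w.degree deg := by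
  simp [mul, degree]; abel

/-- With positive generators, internal degree bounds word length, so a form of fixed internal degree
sees only words of bounded length and the descent terminates. -/
theorem len_le_degree {deg : ι → ℤ × ℤ} (h : ∀ t, 0 < (deg t).2) (u : Word ι) :
    (u.len : ℤ) ≤ (u.degree deg).2 := by
  obtain ⟨v, l⟩ := u
  simp only [len, degree]
  have : (l.length : ℤ) ≤ (l.map deg).sum.2 := by
    induction l with
    | nil => simp
    | cons t l ih =>
      have := h t
      simp only [List.length_cons, List.map_cons, List.sum_cons, Prod.snd_add]
      push_cast
      omega
  have := h v
  simp only [Prod.snd_add]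
  push_cast
  omega

section Algebra

variable {k : Type u} [Field k] {N : Type v} [AddCommGroup N] [Module k N]
  (β : Module.Basis (Word ι) k N) (deg : ι → ℤ × ℤ)

/-- The span of the words of degree `i`. -/
def gr (i : ℤ × ℤ) : Submodule k N := Submodule.span k (β '' {u | u.degree deg = i})

/-- The projection onto the span of the words of degree `i`. -/
noncomputable def proj (i : ℤ × ℤ) : N →ₗ[k] N :=
  β.constr k fun u => if u.degree deg = i then β u else 0

theorem basis_mem (u : Word ι) : β u ∈ gr β deg (u.degree deg) :=
  Submodule.subset_span ⟨u, rfl, rfl⟩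

theorem proj_of_mem (i : ℤ × ℤ) : ∀ x ∈ gr β deg i, proj β deg i x = x := by
  intro x hx
  have : gr β deg i ≤ LinearMap.eqLocus (proj β deg i) LinearMap.id := by
    refine Submodule.span_le.2 ?_
    rintro _ ⟨u, hu, rfl⟩
    exact (β.constr_basis k _ u).trans (if_pos hu)
  exact this hx

theorem proj_of_ne (i j : ℤ × ℤ) (hij : i ≠ j) : ∀ x ∈ gr β deg j, proj β deg i x = 0 := by
  intro x hx
  have : gr β deg j ≤ LinearMap.ker (proj β deg i) := by
    refine Submodule.span_le.2 ?_
    rintro _ ⟨u, hu, rfl⟩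
    exact (β.constr_basis k _ u).trans (if_neg fun h => hij (h.symm.trans hu))
  exact this hx

theorem isInternal : DirectSum.IsInternal (gr β deg) := by
  refine isInternal_of_proj (proj β deg) (proj_of_mem β deg) (proj_of_ne β deg) ?_
  rw [eq_top_iff, ← β.span_eq, Submodule.span_le]
  rintro _ ⟨u, rfl⟩
  exact Submodule.mem_iSup_of_mem _ (basis_mem β deg u)

/-- The concatenation product. -/
noncomputable def mulMap : N →ₗ[k] N →ₗ[k] N :=
  β.constr k fun u => β.constr k fun w => β (mul u w)

theorem mulMap_basis (u w : Word ι) : mulMap β (β u) (β w) = β (mul u w) := by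
  rw [mulMap, β.constr_basis, β.constr_basis]

theorem mulMap_assoc (x y z : N) :
    mulMap β (mulMap β x y) z = mulMap β x (mulMap β y z) := by
  have : (mulMap β).compr₂ (mulMap β) =
      ((LinearMap.llcomp k N N N).flip ∘ₗ mulMap β).flip ∘ₗ mulMap β := by
    refine β.ext fun u => β.ext fun w => β.ext fun t => ?_
    change mulMap β (mulMap β (β u) (β w)) (β t) = mulMap β (β u) (mulMap β (β w) (β t))
    rw [mulMap_basis, mulMap_basis, mulMap_basis, mulMap_basis, mul_assoc]
  exact LinearMap.congr_fun (LinearMap.congr_fun₂ this x y) z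

theorem mulMap_mem (i j : ℤ × ℤ) : ∀ x ∈ gr β deg i, ∀ y ∈ gr β deg j,
    mulMap β x y ∈ gr β deg (i + j) := by
  intro x hx y hy
  induction hx using Submodule.span_induction with
  | zero => rw [map_zero]; exact zero_mem _
  | add x x' _ _ h h' => rw [map_add]; exact add_mem h h'
  | smul c x _ h => rw [map_smul]; exact Submodule.smul_mem _ _ h
  | mem x hx =>
    obtain ⟨u, hu, rfl⟩ := hx
    induction hy using Submodule.span_induction with
    | zero => rw [map_zero]; exact zero_mem _
    | add x x' _ _ h h' => rw [map_add]; exact add_mem h h'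
    | smul c x _ h => rw [map_smul]; exact Submodule.smul_mem _ _ h
    | mem y hy =>
      obtain ⟨w, hw, rfl⟩ := hy
      rw [mulMap_basis, ← hu, ← hw, ← degree_mul]
      exact basis_mem β deg _

/-- Words are nonempty, so multiplication strictly increases length. -/
theorem map_mulMap_eq_zero {W : Type*} [AddCommGroup W] [Module k W] {f : N →ₗ[k] W} {L : ℕ}
    (h : ∀ u : Word ι, L < u.len → f (β u) = 0) {u : Word ι} (hu : L ≤ u.len) (m : N) :
    f (mulMap β (β u) m) = 0 := by
  have : f ∘ₗ mulMap β (β u) = 0 := β.ext fun w => by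
    refine (congrArg f (mulMap_basis β u w)).trans (h _ ?_)
    rw [len_mul]
    have : 0 < w.len := Nat.succ_pos _
    omega
  exact LinearMap.congr_fun this m

theorem map_mulMap_mulMap_eq_zero {W : Type*} [AddCommGroup W] [Module k W] {f : N →ₗ[k] W} {L : ℕ}
    (h : ∀ u : Word ι, L + 1 < u.len → f (β u) = 0) {u : Word ι} (hu : L ≤ u.len) (m m' : N) :
    f (mulMap β (β u) (mulMap β m m')) = 0 := by
  rw [← mulMap_assoc]
  have : f ∘ₗ (mulMap β).flip m' ∘ₗ mulMap β (β u) = 0 := β.ext fun w => by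
    refine (congrArg (fun x => f (mulMap β x m')) (mulMap_basis β u w)).trans ?_
    refine map_mulMap_eq_zero β h ?_ m'
    rw [len_mul]
    have : 0 < w.len := Nat.succ_pos _
    omega
  exact LinearMap.congr_fun this m

/-- The free associative algebra, as a Lie superalgebra. -/
noncomputable def lieAlg : LInftyAlg k N :=
  LInftyAlg.ofAssoc (gr β deg) (isInternal β deg) (mulMap β) (mulMap_mem β deg) (mulMap_assoc β)

theorem lieAlg_isStrictLie : (lieAlg β deg).IsStrictLie := LInftyAlg.ofAssoc_isStrictLie

theorem lieAlg_lie {i j : ℤ × ℤ} {x y : N} (hx : x ∈ gr β deg i) (hy : y ∈ gr β deg j) :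
    (lieAlg β deg).lie x y =
      mulMap β x y - paritySign (parity i * parity j) • mulMap β y x :=
  LInftyAlg.ofAssoc_lie hx hy

/-- The free associative algebra as a right module over a Lie algebra mapping to it. -/
noncomputable def rightModule {A : Type v} [AddCommGroup A] [Module k A] {a : LInftyAlg k A}
    {j : A →ₗ[k] N} (hj : a.IsStrictHom (lieAlg β deg) j) : a.RightModule N where
  gr := gr β deg
  isInternal := isInternal β deg
  proj := proj β deg
  proj_of_mem := proj_of_mem β deg
  proj_of_ne := proj_of_ne β deg
  ρ := (mulMap β).flip ∘ₗ j
  ρ_mem i l n hn x hx := mulMap_mem β deg i l n hn (j x) (hj.1 l x hx)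
  ρ_lie i l x hx y hy n := by
    have h : j (a.lie x y) = (lieAlg β deg).lie (j x) (j y) := by
      rw [LInftyAlg.lie_apply, hj.2, LInftyAlg.br_two]
      rfl
    simp only [LinearMap.comp_apply, LinearMap.flip_apply]
    rw [h, lieAlg_lie β deg (hj.1 i x hx) (hj.1 l y hy), map_sub, map_zsmul, mulMap_assoc,
      mulMap_assoc]

end Algebra

end Word

namespace LInftyAlg

/-! ### Generation by brackets and the iterated bracket map -/

section Generation

variable {k : Type u} [Field k] {A : Type v} [AddCommGroup A] [Module k A]

/-- The span of the brackets of total degree `i`. -/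
def decAt (a : LInftyAlg k A) (i : ℤ × ℤ) : Submodule k A :=
  Submodule.span k {z | ∃ i₁ i₂, i₁ + i₂ = i ∧ ∃ x ∈ a.gr i₁, ∃ y ∈ a.gr i₂, a.lie x y = z}

/-- By positivity both factors of a bracket have smaller internal degree than the bracket. Thus
generation in degrees below w suffices for an induction below w; this bounded form is needed in
`quad_generated`, where generation is itself being proved by induction. -/
theorem IsPositive.gen_induction {a : LInftyAlg k A} (ha : a.IsPositive)
    {V : ℤ × ℤ → Submodule k A} {w : ℤ} (hG : ∀ i : ℤ × ℤ, i.2 < w → a.gr i ≤ V i ⊔ a.decAt i)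
    {P : ℤ × ℤ → A → Prop} (h0 : ∀ i, P i 0)
    (hadd : ∀ i x y, P i x → P i y → P i (x + y)) (hsmul : ∀ i (c : k) x, P i x → P i (c • x))
    (hV : ∀ i, ∀ x ∈ V i, P i x)
    (hlie : ∀ i j : ℤ × ℤ, i.2 < w → j.2 < w → ∀ x ∈ a.gr i, ∀ y ∈ a.gr j, P i x → P j y →
      P (i + j) (a.lie x y)) {i : ℤ × ℤ} (hi : i.2 < w) {x : A} (hx : x ∈ a.gr i) : P i x := by
  obtain ⟨m, hm⟩ : ∃ m : ℕ, i.2 < m := ⟨i.2.toNat + 1, by push_cast; omega⟩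
  induction m generalizing i x with
  | zero =>
    have := ha i (by push_cast at hm; omega)
    rw [this, Submodule.mem_bot] at hx
    exact hx ▸ h0 i
  | succ m ih =>
    obtain ⟨y, hy, z, hz, rfl⟩ := Submodule.mem_sup.1 (hG i hi hx)
    refine hadd i y z (hV i y hy) ?_
    clear hx
    induction hz using Submodule.span_induction with
    | zero => exact h0 i
    | add x y _ _ h h' => exact hadd i x y h h'
    | smul c x _ h => exact hsmul i c x h
    | mem z hz =>
      obtain ⟨i₁, i₂, rfl, x, hx, y, hy, rfl⟩ := hz
      rw [Prod.snd_add] at hi hm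
      push_cast at hm
      by_cases h1 : i₁.2 ≤ 0
      · rw [ha _ h1, Submodule.mem_bot] at hx
        rw [hx, map_zero, LinearMap.zero_apply]
        exact h0 _
      by_cases h2 : i₂.2 ≤ 0
      · rw [ha _ h2, Submodule.mem_bot] at hy
        rw [hy, map_zero]
        exact h0 _
      exact hlie i₁ i₂ (by omega) (by omega) x hx y hy (ih (by omega) hx (by omega))
        (ih (by omega) hy (by omega))

theorem IsStrictLie.lie_lie' {a : LInftyAlg k A} (ha : a.IsStrictLie) {j l : ℤ × ℤ} {y z : A}
    (hy : y ∈ a.gr j) (hz : z ∈ a.gr l) (x : A) :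
    a.lie x (a.lie y z) =
      a.lie (a.lie x y) z - paritySign (parity j * parity l) • a.lie (a.lie x z) y := by
  refine a.homogeneous_induction (P := fun x => a.lie x (a.lie y z) =
      a.lie (a.lie x y) z - paritySign (parity j * parity l) • a.lie (a.lie x z) y)
    (fun i x hx => ha.lie_lie hx hy hz) (fun x x' h h' => ?_) x
  simp only [map_add, LinearMap.add_apply, h, h', smul_add]
  abel

end Generation

section Words

variable {k : Type u} [Field k] {A N : Type v} [AddCommGroup A] [Module k A] [AddCommGroup N]
  [Module k N] {ι : Type*} (β : Module.Basis (Word ι) k N) (deg : ι → ℤ × ℤ)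
  (a : LInftyAlg k A) (e : ι → A)

/-- The iterated bracket `[[[v₁, v₂], …], vₙ]` along a word `v₁ ⋯ vₙ`. -/
def wordBr (e : ι → A) : ι → List ι → A
  | v, [] => e v
  | v, v' :: l => a.lie (wordBr e v' l) (e v)

/-- The linear extension of the iterated bracket. -/
noncomputable def wordBrMap : N →ₗ[k] A := β.constr k fun u => a.wordBr e u.1 u.2

variable {a e} {deg}

theorem wordBr_mem (he : ∀ t, e t ∈ a.gr (deg t)) (v : ι) (l : List ι) :
    a.wordBr e v l ∈ a.gr (Word.degree deg (v, l)) := by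
  induction l generalizing v with
  | nil => simpa [wordBr, Word.degree] using he v
  | cons t l ih =>
    have := a.lie_mem (ih t) (he v)
    rw [add_comm] at this
    simpa [wordBr, Word.degree] using this

theorem wordBrMap_mem (he : ∀ t, e t ∈ a.gr (deg t)) {i : ℤ × ℤ} {n : N}
    (hn : n ∈ Word.gr β deg i) : a.wordBrMap β e n ∈ a.gr i := by
  have : Word.gr β deg i ≤ (a.gr i).comap (a.wordBrMap β e) := by
    refine Submodule.span_le.2 ?_
    rintro _ ⟨u, rfl, rfl⟩
    have h1 := wordBr_mem he u.1 u.2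
    have h2 : a.wordBrMap β e (β u) = a.wordBr e u.1 u.2 := β.constr_basis k _ u
    exact Submodule.mem_comap.2 (h2 ▸ h1)
  exact this hn

variable {β} (ha : a.IsStrictLie) (hpos : a.IsPositive) {w : ℤ}
  (hG : ∀ i : ℤ × ℤ, i.2 < w → a.gr i ≤ Submodule.span k (e '' {t | deg t = i}) ⊔ a.decAt i)
  {j : A →ₗ[k] N} (hj : a.IsStrictHom (Word.lieAlg β deg) j) (hje : ∀ t, j (e t) = β (t, []))

include ha hpos hG hj hje

/-- The iterated bracket is a map of right modules from N to A with its adjoint action. For a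
generator this is the recursive definition of `wordBr`, and the property passes to brackets by
Jacobi. -/
theorem wordBrMap_mulMap {i : ℤ × ℤ} (hi : i.2 < w) {x : A} (hx : x ∈ a.gr i) (n : N) :
    a.wordBrMap β e (Word.mulMap β n (j x)) = a.lie (a.wordBrMap β e n) x := by
  revert n
  refine hpos.gen_induction hG (P := fun i x => ∀ n,
    a.wordBrMap β e (Word.mulMap β n (j x)) = a.lie (a.wordBrMap β e n) x) ?_ ?_ ?_ ?_ ?_ hi hx
  · simp
  · intro i x y h h' n
    simp [h, h']
  · intro i c x h n
    simp [h]
  · intro i x hx n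
    induction hx using Submodule.span_induction with
    | zero => simp
    | add x x' _ _ h h' => simp [h, h']
    | smul c x _ h => simp [h]
    | mem x hx =>
      obtain ⟨t, ht, rfl⟩ := hx
      have : a.wordBrMap β e ∘ₗ (Word.mulMap β).flip (j (e t)) =
          a.lie.flip (e t) ∘ₗ a.wordBrMap β e := β.ext fun u => by
        simp only [LinearMap.comp_apply, LinearMap.flip_apply]
        rw [hje, Word.mulMap_basis, wordBrMap, β.constr_basis, β.constr_basis]
        rfl
      exact LinearMap.congr_fun this n
  · intro i l _ _ x hx y hy h h' n
    have h1 : j (a.lie x y) = (Word.lieAlg β deg).lie (j x) (j y) := by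
      rw [lie_apply, hj.2, br_two]
      rfl
    rw [h1, Word.lieAlg_lie β deg (hj.1 i x hx) (hj.1 l y hy), map_sub, map_zsmul,
      ← Word.mulMap_assoc, ← Word.mulMap_assoc, map_sub, map_zsmul, h', h, h, h',
      ha.lie_lie' hx hy]

/-- The second component D of F is a derivation into N. Since `wordBrMap` is a module map, its
composite with D is a derivation of A that multiplies each generator by its internal degree, hence
multiplies each element by its internal degree. -/
theorem wordBrMap_section {F : A →ₗ[k] A × N}
    (hF : a.IsStrictHom (a.semidirect ha (Word.rightModule β deg hj)) F)
    (hFe : ∀ t, F (e t) = (e t, ((deg t).2 : k) • β (t, []))) {i : ℤ × ℤ} (hi : i.2 < w) {x : A}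
    (hx : x ∈ a.gr i) : (F x).1 = x ∧ a.wordBrMap β e (F x).2 = (i.2 : k) • x := by
  refine hpos.gen_induction hG (P := fun i x => (F x).1 = x ∧
    a.wordBrMap β e (F x).2 = (i.2 : k) • x) ?_ ?_ ?_ ?_ ?_ hi hx
  · simp
  · rintro i x y ⟨h1, h2⟩ ⟨h3, h4⟩
    simp [h1, h2, h3, h4]
  · rintro i c x ⟨h1, h2⟩
    simp [h1, h2, smul_comm c]
  · intro i x hx
    induction hx using Submodule.span_induction with
    | zero => simp
    | add x x' _ _ h h' => simp [h, h']
    | smul c x _ h => simp [h, smul_comm c]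
    | mem x hx =>
      obtain ⟨t, rfl, rfl⟩ := hx
      rw [hFe]
      refine ⟨rfl, ?_⟩
      rw [map_smul, wordBrMap, β.constr_basis]
      rfl
  · rintro i l hi hl x hx y hy ⟨h1, h2⟩ ⟨h3, h4⟩
    have h5 : F (a.lie x y) = (a.semidirect ha (Word.rightModule β deg hj)).lie (F x) (F y) := by
      rw [lie_apply, hF.2, br_two]
      rfl
    rw [h5, semidirect_lie ha _ (hF.1 i x hx) (hF.1 l y hy), h1, h3]
    refine ⟨rfl, ?_⟩
    change a.wordBrMap β e (Word.mulMap β (F x).2 (j y) -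
      paritySign (parity i * parity l) • Word.mulMap β (F y).2 (j x)) = _
    rw [map_sub, map_zsmul, wordBrMap_mulMap ha hpos hG hj hje hl hy,
      wordBrMap_mulMap ha hpos hG hj hje hi hx, h2, h4, map_smul, map_smul, LinearMap.smul_apply,
      LinearMap.smul_apply, a.lie_antisymm hx hy, smul_neg, smul_neg, smul_comm _ (_ : k),
      smul_smul (paritySign _), paritySign_mul_self, one_smul, sub_neg_eq_add, ← add_smul]
    simp

end Words

end LInftyAlg

/-- Euler's identity: moving each argument in turn to the front and weighting it by f gives the form
times the total weight. Symmetry makes all the signs cancel. -/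
theorem shuf_euler {X W k : Type*} [Field k] [AddCommGroup W] [Module k W] {par : X → ZMod 2}
    (f : X → k) {ω : (n : ℕ) → (Fin n → X) → W} (h : SymmFam par ω) {n : ℕ} (x : Fin n → X) :
    shuf par (fun p q y z => if h : p = 1 then
      f (y ⟨0, by omega⟩) • ω (q + 1) (Fin.cons (y ⟨0, by omega⟩) z) else 0) x =
      (∑ j, f (x j)) • ω n x := by
  induction n generalizing ω with
  | zero => rw [shuf_nil]; simp
  | succ n ih =>
    obtain ⟨u, x, rfl⟩ : ∃ u y, x = Fin.cons u y := ⟨x 0, Fin.tail x, (Fin.cons_self_tail x).symm⟩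
    rw [shuf_cons, shuf_of_left, Fin.sum_univ_succ, add_smul]
    · congr 1
      simp only [Fin.cons_succ]
      rw [← ih (h.cons u)]
      refine shuf_congr fun S => ?_
      have key : ∀ (p : ℕ) (y : Fin p → X) (q : ℕ) (z : Fin q → X),
          (paritySign (par u * ∑ t, par (y t)) • if h : p = 1 then
            f (y ⟨0, by omega⟩) • ω (q + 1 + 1) (Fin.cons (y ⟨0, by omega⟩) (Fin.cons u z)) else 0) =
          if h : p = 1 then f (y ⟨0, by omega⟩) •
            ω (q + 1 + 1) (Fin.cons u (Fin.cons (y ⟨0, by omega⟩) z)) else 0 := by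
        intro p y q z
        split_ifs with hp
        · subst hp
          rw [Fin.sum_univ_one, smul_comm, h.swap_cons_cons u]
          rfl
        · exact smul_zero _
      exact key _ _ _ _
    · intro p q y z hp
      exact dif_neg (by omega)

namespace LInftyAlg

/-! ### Arity and the splitting off of linear components -/

section Arity

variable {k : Type u} [Field k] {A : Type v} [AddCommGroup A] [Module k A]

/-- With only a binary bracket the differential raises arity by exactly one. -/
theorem IsStrictLie.ceDiff_congr {a : LInftyAlg k A} (ha : a.IsStrictLie) {ω ω' : Forms k A}
    {n : ℕ} (h : ω n = ω' n) : a.ceDiff ω (n + 1) = a.ceDiff ω' (n + 1) := by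
  have h' : ∀ m, m = n → ω m = ω' m := by rintro m rfl; exact h
  refine a.multilinear_ext fun z => ?_
  refine (a.ev_ceDiff ω z).trans (Eq.trans (shuf_congr fun S => ?_) (a.ev_ceDiff ω' z).symm)
  by_cases hS : #S = 2
  · have hc := card_add_card_compl S
    rw [Fintype.card_fin] at hc
    simp only [ev]
    rw [h' _ (by omega)]
  · have h0 : ((a.mL #S (pick S z)).2 : A) = 0 := by
      simp [mL, a.shiftBr_eq_zero (ha _ hS)]
    exact (a.ev_cons_eq_zero ω h0 _).trans (a.ev_cons_eq_zero ω' h0 _).symm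

theorem IsStrictLie.ceDiff_eq_zero {a : LInftyAlg k A} (ha : a.IsStrictLie) {ω : Forms k A}
    {n : ℕ} (h : ω n = 0) : a.ceDiff ω (n + 1) = 0 :=
  (ha.ceDiff_congr (ω' := 0) h).trans (by rw [map_zero]; rfl)

theorem ceDiff_arity_zero (a : LInftyAlg k A) (ω : Forms k A) : a.ceDiff ω 0 = 0 :=
  a.multilinear_ext fun z => by
    refine (a.ev_ceDiff ω z).trans ?_
    unfold dFam
    rw [shuf_nil]
    refine (a.ev_cons_eq_zero ω ?_ _).trans rfl
    simp [mL, a.shiftBr_eq_zero a.br_zero]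

/-- The constant family of forms. -/
noncomputable def constForm (k : Type u) [Field k] (A : Type v) [AddCommGroup A] [Module k A]
    (c : k) : Forms k A
  | 0 => MultilinearMap.constOfIsEmpty k _ c
  | _ + 1 => 0

theorem constForm_of_ne (c : k) {n : ℕ} (hn : n ≠ 0) : constForm k A c n = 0 := by
  cases n with
  | zero => exact absurd rfl hn
  | succ n => rfl

theorem constForm_zero : constForm k A 0 = 0 := by
  funext n
  cases n <;> rfl

theorem constForm_add (c c' : k) :
    constForm k A (c + c') = constForm k A c + constForm k A c' := by
  funext n
  cases n
  · ext; rfl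
  · exact (add_zero _).symm

theorem constForm_smul (c c' : k) : constForm k A (c * c') = c • constForm k A c' := by
  funext n
  cases n
  · ext; rfl
  · exact (smul_zero c).symm

theorem constForm_mem (a : LInftyAlg k A) {c : k} {p q : ℤ} (h : c ≠ 0 → p = 0 ∧ q = 0) :
    constForm k A c ∈ a.cochains p q := by
  rw [mem_cochains_iff]
  constructor
  · intro n z σ
    cases n with
    | zero =>
      have : koszulSign (Equiv.symm σ) (fun j => a.lpar (z j)) = 1 := rfl
      rw [this, one_smul]
      rfl
    | succ n => exact (smul_zero _).symm
  · intro n z hz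
    cases n with
    | zero =>
      change c = 0
      by_contra hc
      obtain ⟨rfl, rfl⟩ := h hc
      exact hz rfl
    | succ n => rfl

theorem ceDiff_constForm (a : LInftyAlg k A) (c : k) : a.ceDiff (constForm k A c) = 0 := by
  refine a.forms_ext fun n z => ?_
  rw [ev_ceDiff]
  exact (shuf_congr fun S => rfl).trans (shuf_zero z)

/-- The family of forms that is concentrated in arity one, where it is given by `g`. -/
noncomputable def linearForm (g : A →ₗ[k] k) : Forms k A := linearFamily g

theorem linearForm_mem (a : LInftyAlg k A) {ω : Forms k A} {p q : ℤ} (h : ω ∈ a.cochains p q) :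
    linearForm ((MultilinearMap.ofSubsingleton k A k (0 : Fin 1)).symm (ω 1)) ∈
      a.cochains p q := by
  refine a.mem_cochains_iff.2 ⟨a.symmFam_linearFamily _, fun n z hz => ?_⟩
  by_cases hn : n = 1
  · subst hn
    exact (congrArg (ω 1) (funext fun j => by rw [Subsingleton.elim j 0])).trans
      ((a.mem_cochains_iff.1 h).2 1 z hz)
  · have h0 : linearForm ((MultilinearMap.ofSubsingleton k A k (0 : Fin 1)).symm (ω 1)) n = 0 :=
      linearFamily_of_ne _ hn
    exact congrArg (fun f => f (a.vals z)) h0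

theorem linearForm_zero : linearForm (0 : A →ₗ[k] k) = 0 := by
  funext n
  by_cases hn : n = 1
  · subst hn
    rfl
  · exact linearFamily_of_ne _ hn

theorem cochains_ext_of_sdeg {a : LInftyAlg k A} (ha : a.IsPositive) {p q : ℤ} {ω ω' : Forms k A}
    (h : ω ∈ a.cochains p q) (h' : ω' ∈ a.cochains p q)
    (he : ∀ n (z : Fin n → a.Letter), (∀ t, 0 < (z t).1.2) → a.sdeg z = (-p, -q) →
      a.ev ω n z = a.ev ω' n z) : ω = ω' := by
  refine funext fun n => a.forms_ext_of_pos ha fun z hz => ?_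
  by_cases hd : a.sdeg z = (-p, -q)
  · exact he n z hz hd
  · exact ((a.mem_cochains_iff.1 h).2 n z hd).trans ((a.mem_cochains_iff.1 h').2 n z hd).symm

/-- A cochain of internal degree q is determined by letters of internal degree at most -q, because
all letters are positive. This is how information about A in a bounded range of degrees becomes
sufficient. -/
theorem cochains_ext {a : LInftyAlg k A} (ha : a.IsPositive) {p q : ℤ} {ω ω' : Forms k A}
    (h : ω ∈ a.cochains p q) (h' : ω' ∈ a.cochains p q)
    (he : ∀ n (z : Fin n → a.Letter), (∀ t, 0 < (z t).1.2 ∧ (z t).1.2 ≤ -q) →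
      a.ev ω n z = a.ev ω' n z) : ω = ω' := by
  refine cochains_ext_of_sdeg ha h h' fun n z hz hd => he n z fun t => ⟨hz t, ?_⟩
  have h1 := congrArg Prod.snd hd
  rw [sdeg_snd] at h1
  exact (single_le_sum (fun i _ => (hz i).le) (mem_univ t)).trans h1.le

theorem ceDiff_linearForm (a : LInftyAlg k A) {g : A →ₗ[k] k} (hg : ∀ n x, g (a.br n x) = 0) :
    a.ceDiff (linearForm g) = 0 := by
  refine a.forms_ext fun n z => ?_
  rw [ev_ceDiff]
  refine (a.dFam_linearFamily g z).trans ?_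
  rw [a.shiftBr_apply n (fun j => (z j).1) (a.vals z) fun j => (z j).2.2, map_zsmul, hg, smul_zero]
  rfl

/-- A closed linear form vanishes on brackets. -/
theorem map_br_eq_zero_of_ceDiff (a : LInftyAlg k A) {g : A →ₗ[k] k} {n : ℕ}
    (hg : a.ceDiff (linearForm g) n = 0) (x : Fin n → A) : g (a.br n x) = 0 := by
  have : g.compMultilinearMap (a.br n) = 0 := a.multilinear_ext fun z => by
    have h1 := (a.dFam_linearFamily g z).symm.trans (a.ev_ceDiff (linearForm g) z).symm
    rw [a.shiftBr_apply n (fun j => (z j).1) (a.vals z) fun j => (z j).2.2, map_zsmul] at h1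
    have h2 : a.ev (a.ceDiff (linearForm g)) n z = 0 := by
      simp only [ev]
      rw [hg]
      rfl
    rw [h2] at h1
    have h3 := congrArg (fun c => decalageSign (fun j => parity (z j).1) • c) h1
    beta_reduce at h3
    rwa [smul_smul, decalageSign_sq, one_smul, smul_zero] at h3
  exact congrArg (fun f => f x) this

/-- For a strict algebra each arity component of a cocycle is closed separately. The linear one
kills brackets, and the rest is exact by hypothesis. -/
theorem IsStrictLie.exists_linear_add_exact {a : LInftyAlg k A} (ha : a.IsStrictLie) {p q : ℤ}
    (hex : a.IsExactAt q) {θ : Forms k A} (hθ : θ ∈ a.cochains p q) (hd : a.ceDiff θ = 0)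
    (h0 : θ 0 = 0) : ∃ φ : A →ₗ[k] k, ∃ ζ ∈ a.cochains (p - 1) q,
      linearForm φ ∈ a.cochains p q ∧ (∀ x y, φ (a.lie x y) = 0) ∧
        θ = linearForm φ + a.ceDiff ζ := by
  let φ := (MultilinearMap.ofSubsingleton k A k (0 : Fin 1)).symm (θ 1)
  have hφ1 : linearForm φ 1 = θ 1 := by
    ext x
    exact congrArg (θ 1) (funext fun j => by rw [Subsingleton.elim j 0])
  have hφ2 : a.ceDiff (linearForm φ) 2 = 0 := by
    rw [ha.ceDiff_congr hφ1, hd]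
    rfl
  have hφ3 := a.map_br_eq_zero_of_ceDiff hφ2
  have hφ4 : a.ceDiff (linearForm φ) = 0 := a.ceDiff_linearForm fun n x => by
    by_cases hn : n = 2
    · subst hn
      exact hφ3 x
    · rw [ha n hn]
      exact map_zero φ
  have hmem := a.linearForm_mem hθ
  obtain ⟨ζ, hζ, hζd⟩ := hex p (θ - linearForm φ) (sub_mem hθ hmem)
    (by rw [map_sub, hd, hφ4, sub_zero])
    (by
      change θ 0 - linearForm φ 0 = 0
      rw [h0, show linearForm φ 0 = 0 from linearFamily_of_ne φ (by decide), sub_zero])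
    (by
      change θ 1 - linearForm φ 1 = 0
      rw [hφ1, sub_self])
  refine ⟨φ, ζ, hζ, hmem, fun x y => hφ3 _, ?_⟩
  rw [hζd]
  exact (add_sub_cancel _ _).symm

end Arity

/-! ### Exactness with coefficients in the dual of a free module -/

section Descent

variable {k : Type u} [Field k] {A N : Type v} [AddCommGroup A] [Module k A]
  [AddCommGroup N] [Module k N] {ι : Type*} {β : Module.Basis (Word ι) k N} {deg : ι → ℤ × ℤ}
  {a : LInftyAlg k A} {e : ι → A} (ha : a.IsStrictLie) (hpos : a.IsPositive)
  (hdeg : ∀ t, 0 < (deg t).2) {w : ℤ}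
  (hG : ∀ i : ℤ × ℤ, i.2 < w → a.gr i ≤ Submodule.span k (e '' {t | deg t = i}) ⊔ a.decAt i)
  {j : A →ₗ[k] N} (hj : a.IsStrictHom (Word.lieAlg β deg) j) (hje : ∀ t, j (e t) = β (t, []))

/-- The constants `±φ_u(v)` attached to the words `u v`. -/
noncomputable def tailTerm (deg : ι → ℤ × ℤ) (e : ι → A) (φ : Word ι → A →ₗ[k] k) :
    Word ι → Forms k A
  | (_, []) => 0
  | (v, v' :: l) => constForm k A (paritySign (parity (Word.degree deg (v', l))) • φ (v', l) (e v))


theorem tailTerm_eq_zero {φ : Word ι → A →ₗ[k] k} {L : ℕ} (h : ∀ u, u.len ≠ L → φ u = 0)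
    {u : Word ι} (hu : u.len ≠ L + 1) : tailTerm deg e φ u = 0 := by
  match u, hu with
  | (v, []), _ => rfl
  | (v, v' :: l), hu =>
    have : φ (v', l) = 0 := h _ fun h => hu (by rw [← h]; rfl)
    rw [tailTerm, this, LinearMap.zero_apply, smul_zero, constForm_zero]

theorem ceDiff_tailTerm (φ : Word ι → A →ₗ[k] k) (u : Word ι) :
    a.ceDiff (tailTerm deg e φ u) = 0 := by
  match u with
  | (v, []) => exact map_zero _
  | (v, v' :: l) => exact a.ceDiff_constForm _

include hj in
theorem map_linearFamily_eq_zero {W : Type*} [AddCommGroup W] [Module k W] {f : N →ₗ[k] W} {L : ℕ}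
    (h : ∀ u : Word ι, L < u.len → f (β u) = 0) {u : Word ι} (hu : L ≤ u.len) (p : ℕ)
    (y : Fin p → A) : f (linearFamily ((Word.rightModule β deg hj).ρ.flip (β u)) p y) = 0 := by
  by_cases hp : p = 1
  · subst hp
    exact Word.map_mulMap_eq_zero β h hu _
  · rw [linearFamily_of_ne _ hp]
    exact map_zero f

include hpos hG hj hje in
/-- A linear map that is given by the constants `φ (v)` on the words `u v` and vanishes on longer
words is given by `φ` on the action on `u`. -/
theorem map_mulMap_eq_constForm {Z : N →ₗ[k] Forms k A} {φ : A →ₗ[k] k} {u : Word ι}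
    (hφ : ∀ x y, φ (a.lie x y) = 0)
    (hZ : ∀ t, Z (β (t, u.1 :: u.2)) = constForm k A (φ (e t)))
    (hZ' : ∀ u' : Word ι, u.len + 1 < u'.len → Z (β u') = 0) {i : ℤ × ℤ} (hi : i.2 < w) {x : A}
    (hx : x ∈ a.gr i) : Z (Word.mulMap β (β u) (j x)) = constForm k A (φ x) := by
  refine hpos.gen_induction hG (P := fun i x =>
    Z (Word.mulMap β (β u) (j x)) = constForm k A (φ x)) ?_ ?_ ?_ ?_ ?_ hi hx
  · simp [constForm_zero]
  · intro i x y h h'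
    simp [h, h', constForm_add]
  · intro i c x h
    simp [h, constForm_smul]
  · intro i x hx
    induction hx using Submodule.span_induction with
    | zero => simp [constForm_zero]
    | add x x' _ _ h h' => simp [h, h', constForm_add]
    | smul c x _ h => simp [h, constForm_smul]
    | mem x hx =>
      obtain ⟨t, ht, rfl⟩ := hx
      rw [hje, Word.mulMap_basis]
      exact hZ t
  · intro i l _ _ x hx y hy h h'
    have h1 : j (a.lie x y) = (Word.lieAlg β deg).lie (j x) (j y) := by
      rw [lie_apply, hj.2, br_two]
      rfl
    rw [h1, Word.lieAlg_lie β deg (hj.1 i x hx) (hj.1 l y hy), map_sub, map_zsmul, map_sub,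
      map_zsmul, Word.map_mulMap_mulMap_eq_zero β hZ' le_rfl,
      Word.map_mulMap_mulMap_eq_zero β hZ' le_rfl, hφ, constForm_zero, smul_zero, sub_zero]

theorem tailTerm_mem {φ : Word ι → A →ₗ[k] k} {p q : ℤ} (he : ∀ t, e t ∈ a.gr (deg t))
    (h : ∀ u : Word ι, linearForm (φ u) ∈
      a.cochains (p + (u.degree deg).1 - 1) (q + (u.degree deg).2)) (u : Word ι) :
    tailTerm deg e φ u ∈ a.cochains (p - 1 + (u.degree deg).1 - 1) (q + (u.degree deg).2) := by
  match u with
  | (v, []) => exact zero_mem _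
  | (v, v' :: l) =>
    refine a.constForm_mem fun hc => ?_
    by_contra h2
    refine hc ?_
    have h3 := (a.mem_cochains_iff.1 (h (v', l))).2 1 (fun _ => ⟨deg v, e v, he v⟩) fun h4 => h2 ?_
    · have h5 : φ (v', l) (e v) = 0 := h3
      rw [h5, smul_zero]
    · have h6 : deg v + (-1, 0) = (-(p + (Word.degree deg (v', l)).1 - 1),
          -(q + (Word.degree deg (v', l)).2)) := by
        rw [← h4]; simp [sdeg]
      have h7 := congrArg Prod.fst h6
      have h8 := congrArg Prod.snd h6
      simp only [Word.degree, List.map_cons, List.sum_cons, Prod.fst_add, Prod.snd_add] at h7 h8 ⊢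
      constructor <;> omega

include hpos hdeg hG hje in
-- Descent on the length J of the longest words seen by η. On the longest words u the action of A
-- contributes nothing, so the contraction of η with u is closed. Its weight is smaller than that of
-- η, so it equals a closed linear form φ_u plus some dζ_u; there is no constant because `η 1 = 0`.
-- The term dζ_u is removed by inserting ζ_u at u. The class of φ_u is removed because N is free:
-- constants φ_u(v) may be prescribed on the longer words uv, and the action produces φ_u from them.
theorem exists_primitive_of_contr {p q : ℤ} (he : ∀ t, e t ∈ a.gr (deg t)) (hq : -q ≤ w)
    (hex : ∀ q', -q' < w → a.IsExactAt q') (J : ℕ) [CharZero k]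
    {η : Forms k (A × N)}
    (hη : η ∈ (a.semidirect ha (Word.rightModule β deg hj)).cochains p q)
    (hd : (a.semidirect ha (Word.rightModule β deg hj)).ceDiff η = 0)
    (h2 : pullForms (scaleTwo k A N) η = (2 : k) • η) (h1 : η 1 = 0)
    (hJ : ∀ u, J < u.len → contr η (β u) = 0) :
    ∃ ζ ∈ (a.semidirect ha (Word.rightModule β deg hj)).cochains (p - 1) q,
      (a.semidirect ha (Word.rightModule β deg hj)).ceDiff ζ = η := by
  induction J generalizing η with
  | zero =>
    refine ⟨0, zero_mem _, ?_⟩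
    rw [map_zero, eq_zero_of_contr_eq_zero ha _ hη h2 (β.ext fun u => hJ u (Nat.succ_pos _))]
  | succ J ih =>
    have hβ : ∀ u, β u ∈ (Word.rightModule β deg hj).gr (u.degree deg) := Word.basis_mem β deg
    have hu : ∀ u : Word ι, ∃ φ : A →ₗ[k] k, ∃ ζ ∈ a.cochains
        (p - 1 + (u.degree deg).1 - 1) (q + (u.degree deg).2),
        linearForm φ ∈ a.cochains (p + (u.degree deg).1 - 1) (q + (u.degree deg).2) ∧
        (∀ x y, φ (a.lie x y) = 0) ∧ (u.len ≠ J + 1 → φ = 0 ∧ ζ = 0) ∧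
        (u.len = J + 1 → contr η (β u) = linearForm φ + a.ceDiff ζ) := by
      intro u
      by_cases hlen : u.len = J + 1
      · have hlt := Word.len_le_degree hdeg u
        have hmem := contr_mem_cochains ha _ hη (hβ u)
        obtain ⟨φ, ζ, h3, h4, h5, h6⟩ := ha.exists_linear_add_exact
          (hex (q + (u.degree deg).2) (by omega)) hmem
          (a.forms_ext fun m x => by
            have h7 := ev_contr_ceDiff ha _ hη (hβ u) x
            rw [hd, shuf_congr (Ψ := fun _ _ _ _ => 0), shuf_zero, smul_zero, zero_add] at h7
            · have h8 := congrArg (fun c => paritySign (parity (u.degree deg) + 1) • c) h7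
              beta_reduce at h8
              rw [smul_smul, paritySign_mul_self, one_smul] at h8
              exact h8.symm.trans (smul_zero _)
            · intro S
              rw [map_linearFamily_eq_zero hj hJ hlen.ge]
              rfl)
          (by
            ext x
            rw [contr_apply, h1]
            rfl)
        refine ⟨φ, ζ, ?_, h4, h5, fun h => absurd hlen h, fun _ => h6⟩
        convert h3 using 2
        ring
      · refine ⟨0, 0, zero_mem _, ?_, fun _ _ => rfl, fun _ => ⟨rfl, rfl⟩, fun h => absurd h hlen⟩
        rw [linearForm_zero]
        exact zero_mem _
    choose φ ζ hζ hφ hφl hne hlen using hu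
    -- The signs are chosen so that both terms of `ev_contr_ceDiff` come out positive: d(Z u)
    -- contributes dζ_u, and the action of A on u contributes φ_u through the constants on the words
    -- uv.
    let Z : N →ₗ[k] Forms k A := β.constr k fun u =>
      paritySign (parity (u.degree deg) + 1) • ζ u + tailTerm deg e φ u
    have hZβ : ∀ u, Z (β u) =
      paritySign (parity (u.degree deg) + 1) • ζ u + tailTerm deg e φ u := fun u =>
      β.constr_basis k _ u
    have hZm : ∀ i, ∀ n ∈ (Word.rightModule β deg hj).gr i,
        Z n ∈ a.cochains (p - 1 + i.1 - 1) (q + i.2) := by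
      intro i n hn
      have h3 : Word.gr β deg i ≤ (a.cochains (p - 1 + i.1 - 1) (q + i.2)).comap Z := by
        refine Submodule.span_le.2 ?_
        rintro _ ⟨u, rfl, rfl⟩
        have := add_mem (zsmul_mem (hζ u) (paritySign (parity (u.degree deg) + 1)))
          (tailTerm_mem he hφ u)
        exact Submodule.mem_comap.2 ((hZβ u).symm ▸ this)
      exact h3 hn
    have hE := ext_mem_cochains ha _ hZm
    have hZJ : ∀ u : Word ι, J + 1 + 1 < u.len → Z (β u) = 0 := fun u hu => by
      rw [hZβ, (hne u (by omega)).2, smul_zero, zero_add]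
      exact tailTerm_eq_zero (fun u hu => (hne u hu).1) (by omega)
    -- Agreement on all words of length greater than J is required. Length J + 1 is the cancellation
    -- described above; on longer words both sides vanish, since constants are closed and the action
    -- leads to words longer than J + 2.
    have hdE : ∀ u : Word ι, J < u.len → contr ((a.semidirect ha (Word.rightModule β deg hj)).ceDiff
        (ext ha (Word.rightModule β deg hj) Z)) (β u) = contr η (β u) := by
      intro u hu
      have hmem := contr_mem_cochains ha _ (ceDiff_mem_cochains _ hE) (hβ u)
      rw [sub_add_cancel] at hmem
      refine cochains_ext hpos hmem (contr_mem_cochains ha _ hη (hβ u)) fun m x hx => ?_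
      have hlt := Word.len_le_degree hdeg u
      rw [ev_contr_ceDiff ha _ hE (hβ u), contr_ext, hZβ, map_add, map_zsmul, ceDiff_tailTerm,
        add_zero]
      by_cases hlu : u.len = J + 1
      · have hZu : ∀ t, Z (β (t, u.1 :: u.2)) =
            constForm k A ((paritySign (parity (u.degree deg)) • φ u) (e t)) := fun t => by
          have h3 : Word.len (t, u.1 :: u.2) ≠ J + 1 := by
            have : Word.len (t, u.1 :: u.2) = u.len + 1 := rfl
            omega
          rw [hZβ, (hne _ h3).2, smul_zero, zero_add]
          rfl
        rw [shuf_congr (Ψ := fun p q y z => a.ev (constForm k A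
          ((paritySign (parity (u.degree deg)) • linearFamily (φ u) p (a.vals y)))) q z),
          shuf_of_right, hlen u hlu]
        · change paritySign (parity (u.degree deg)) • (paritySign (parity (u.degree deg)) •
            linearFamily (φ u) m (a.vals x)) + paritySign (parity (u.degree deg) + 1) •
            (paritySign (parity (u.degree deg) + 1) • a.ev (a.ceDiff (ζ u)) m x) =
            linearFamily (φ u) m (a.vals x) + a.ev (a.ceDiff (ζ u)) m x
          rw [smul_smul, smul_smul, paritySign_mul_self, paritySign_mul_self, one_smul, one_smul]
        · intro p q y z hq
          simp only [ev]
          rw [constForm_of_ne _ hq]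
          rfl
        · intro S
          have key : ∀ p (y : Fin p → a.Letter), (∀ t, (y t).1.2 < w) →
              Z (linearFamily ((Word.rightModule β deg hj).ρ.flip (β u)) p (a.vals y)) =
              constForm k A (paritySign (parity (u.degree deg)) •
                linearFamily (φ u) p (a.vals y)) := by
            intro p y hy
            by_cases hp : p = 1
            · subst hp
              refine map_mulMap_eq_constForm hpos hG hj hje (fun x y => ?_) hZu
                (fun u' hu' => hZJ u' (by omega)) (hy 0) (y 0).2.2
              rw [LinearMap.smul_apply, hφl, smul_zero]
            · rw [linearFamily_of_ne _ hp, linearFamily_of_ne _ hp, _root_.zero_apply,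
                _root_.zero_apply, map_zero, smul_zero, constForm_zero]
          rw [key _ _ fun t => ?_]
          have := (hx (S.orderEmbOfFin rfl t)).2
          simp only [pick]
          omega
      · rw [(hne u hlu).2, map_zero, hJ u (by omega), shuf_congr (Ψ := fun _ _ _ _ => 0), shuf_zero]
        · rw [smul_zero, zero_add]
          change paritySign (parity (u.degree deg) + 1) •
            (paritySign (parity (u.degree deg) + 1) • (0 : k)) = 0
          rw [smul_zero, smul_zero]
        · intro S
          rw [map_linearFamily_eq_zero hj hZJ (by omega)]
          rfl
    -- The corrected form is still closed, linear in N and without arity one part, and it sees only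
    -- words of length at most J.
    obtain ⟨ξ, hξ, hξd⟩ := ih (η := η - (a.semidirect ha (Word.rightModule β deg hj)).ceDiff
        (ext ha (Word.rightModule β deg hj) Z))
      (sub_mem hη (by simpa using ceDiff_mem_cochains _ hE))
      (by rw [map_sub, hd, ceDiff_ceDiff _ hE, sub_zero])
      (by
        rw [map_sub, h2, ← (isStrictHom_scaleTwo ha _).ceDiff_pullForms, pullForms_scaleTwo_ext,
          map_smul, smul_sub])
      (by
        change η 1 - _ = 0
        rw [h1, (semidirect_isStrictLie ha _).ceDiff_eq_zero (ext_zero_arity ha _ Z), sub_zero])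
      (fun u hu => by
        have : contr (η - (a.semidirect ha (Word.rightModule β deg hj)).ceDiff
          (ext ha (Word.rightModule β deg hj) Z)) (β u) = contr η (β u) - contr
          ((a.semidirect ha (Word.rightModule β deg hj)).ceDiff
          (ext ha (Word.rightModule β deg hj) Z)) (β u) := rfl
        rw [this, hdE u hu, sub_self])
    exact ⟨ξ + ext ha _ Z, add_mem hξ hE, by rw [map_add, hξd, sub_add_cancel]⟩

end Descent

end LInftyAlg

namespace LInftyAlg

/-! ### The homotopy for free Lie algebras -/

section Insertion

variable {k : Type u} [Field k] {A : Type v} [AddCommGroup A] [Module k A]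

/-- The insertion of an element as the first argument of a family of forms. -/
noncomputable def insertFirst (ω : Forms k A) : A →ₗ[k] Forms k A where
  toFun x := fun q => (ω (q + 1)).curryLeft x
  map_add' x y := funext fun q => map_add (ω (q + 1)).curryLeft x y
  map_smul' c x := funext fun q => map_smul (ω (q + 1)).curryLeft c x

theorem ev_insertFirst (a : LInftyAlg k A) (ω : Forms k A) (u : a.Letter) {n : ℕ}
    (z : Fin n → a.Letter) :
    a.ev (insertFirst ω u.2) n z = a.ev ω (n + 1) (Fin.cons u z) := by
  simp only [ev, vals_cons]
  rfl

theorem insertFirst_mem (a : LInftyAlg k A) {ω : Forms k A} {p q : ℤ} (h : ω ∈ a.cochains p q)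
    {i : ℤ × ℤ} {x : A} (hx : x ∈ a.gr i) :
    insertFirst ω x ∈ a.cochains (p + i.1 - 1) (q + i.2) := by
  rw [mem_cochains_iff] at h ⊢
  refine ⟨fun m z σ => ?_, fun m z hz => ?_⟩
  · refine (a.ev_insertFirst ω ⟨i, x, hx⟩ _).trans ?_
    rw [show a.ev (insertFirst ω x) m z = _ from a.ev_insertFirst ω ⟨i, x, hx⟩ z]
    exact h.1.cons ⟨i, x, hx⟩ m z σ
  · refine (a.ev_insertFirst ω ⟨i, x, hx⟩ _).trans (h.2 _ _ fun h2 => hz ?_)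
    rw [sdeg_cons] at h2
    have h3 : a.sdeg z = (-p, -q) - (i + (-1, 0)) := by rw [← h2]; simp
    rw [h3]
    ext
    · simp; ring
    · simp; ring

/-- Cartan's formula for the first argument of a differential. -/
theorem ev_ceDiff_cons (a : LInftyAlg k A) {ω : Forms k A} (h : SymmFam a.lpar (a.ev ω))
    (u : a.Letter) {n : ℕ} (x : Fin n → a.Letter) :
    a.ev (a.ceDiff ω) (n + 1) (Fin.cons u x) =
      shuf a.lpar (fun p q y z => a.ev ω (q + 1) (Fin.cons (a.mL (p + 1) (Fin.cons u y)) z)) x +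
      paritySign (a.lpar u) • a.ev (a.ceDiff (insertFirst ω u.2)) n x := by
  rw [ev_ceDiff, dFam_cons a.lpar_mL h, ev_ceDiff]
  congr 3
  exact funext fun n => funext fun z => (a.ev_insertFirst ω u z).symm

end Insertion

section Words

variable {k : Type u} [Field k] [CharZero k] {A N : Type v} [AddCommGroup A] [Module k A]
  [AddCommGroup N] [Module k N] {ι : Type*} {β : Module.Basis (Word ι) k N} {deg : ι → ℤ × ℤ}
  {a : LInftyAlg k A} {e : ι → A} (ha : a.IsStrictLie) (hpos : a.IsPositive)
  (hdeg : ∀ t, 0 < (deg t).2) {w : ℤ} (he : ∀ t, e t ∈ a.gr (deg t))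
  (hG : ∀ i : ℤ × ℤ, i.2 < w → a.gr i ≤ Submodule.span k (e '' {t | deg t = i}) ⊔ a.decAt i)
  {j : A →ₗ[k] N} (hj : a.IsStrictHom (Word.lieAlg β deg) j) (hje : ∀ t, j (e t) = β (t, []))

omit [CharZero k] in
theorem ext_arity_one (M : a.RightModule N) {Z : N →ₗ[k] Forms k A} (hZ : ∀ n, Z n 0 = 0) :
    ext ha M Z 1 = 0 := by
  refine (a.semidirect ha M).multilinear_ext fun z => ?_
  refine (ev_ext ha M Z z).trans ((shuf_congr fun S => ?_).trans (shuf_zero z))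
  unfold extTerm
  split_ifs with hS
  · have hc := card_add_card_compl S
    rw [Fintype.card_fin] at hc
    have h : ∀ q (z : Fin q → A) n, q = 0 → Z n q z = 0 := by
      rintro q z n rfl
      rw [hZ]
      rfl
    exact h _ _ _ (by omega)
  · rfl

include hpos hdeg he hG hje in
-- The form is η(n, x, …) = ω(b(n), x, …) with b the iterated bracket. As b is a module map,
-- contracting dη with a word u agrees with inserting b(u) as first argument of dω = 0, by Cartan's
-- formula. The letters entering have degree below w since u already takes up positive internal
-- degree.
theorem ceDiff_ext_insertFirst {p q : ℤ} (hq : -q ≤ w) {ω : Forms k A} (hω : ω ∈ a.cochains p q)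
    (hd : a.ceDiff ω = 0)
    (hη : ext ha (Word.rightModule β deg hj) (insertFirst ω ∘ₗ a.wordBrMap β e) ∈
      (a.semidirect ha (Word.rightModule β deg hj)).cochains p q) :
    (a.semidirect ha (Word.rightModule β deg hj)).ceDiff
      (ext ha (Word.rightModule β deg hj) (insertFirst ω ∘ₗ a.wordBrMap β e)) = 0 := by
  have hdη := ceDiff_mem_cochains _ hη
  refine eq_zero_of_contr_eq_zero ha _ hdη ?_ (β.ext fun u => ?_)
  · rw [← (isStrictHom_scaleTwo ha _).ceDiff_pullForms, pullForms_scaleTwo_ext, map_smul]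
  have hu : β u ∈ (Word.rightModule β deg hj).gr (u.degree deg) := Word.basis_mem β deg u
  refine cochains_ext hpos (contr_mem_cochains ha _ hdη hu) (zero_mem _) fun m x hx => ?_
  rw [ev_contr_ceDiff ha _ hη hu, contr_ext]
  let X : a.Letter := ⟨u.degree deg, a.wordBrMap β e (β u), wordBrMap_mem β he hu⟩
  have h1 := a.ev_ceDiff_cons (a.mem_cochains_iff.1 hω).1 X x
  rw [hd] at h1
  refine Eq.trans ?_ (h1.symm.trans rfl)
  congr 1
  refine Eq.trans (map_shuf (DistribSMul.toAddMonoidHom k (paritySign (parity (u.degree deg)))) _ x)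
    (shuf_congr fun S => ?_)
  have hlt := Word.len_le_degree hdeg u
  have key : ∀ p q (y : Fin p → a.Letter) (z : Fin q → a.Letter), (∀ t, (y t).1.2 < w) →
      paritySign (parity (u.degree deg)) • a.ev (insertFirst ω (a.wordBrMap β e
        (linearFamily ((Word.rightModule β deg hj).ρ.flip (β u)) p (a.vals y)))) q z =
      a.ev ω (q + 1) (Fin.cons (a.mL (p + 1) (Fin.cons X y)) z) := by
    intro p q y z hy
    by_cases hp : p = 1
    · subst hp
      have h2 : ((a.mL (1 + 1) (Fin.cons X y)).2 : A) =
          paritySign (parity (u.degree deg)) • a.lie (a.wordBrMap β e (β u)) (y 0).2 := by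
        change a.shiftBr 2 _ = _
        rw [shiftBr_two]
        exact a.slie_eq X.2.2 _
      have h3 : a.wordBrMap β e
        (linearFamily ((Word.rightModule β deg hj).ρ.flip (β u)) 1 (a.vals y)) =
          a.lie (a.wordBrMap β e (β u)) (y 0).2 :=
        wordBrMap_mulMap ha hpos hG hj hje (hy 0) (y 0).2.2 (β u)
      rw [h3, ← ev_insertFirst, h2, map_zsmul]
      rfl
    · rw [linearFamily_of_ne _ hp, _root_.zero_apply, map_zero, map_zero]
      refine (smul_zero _).trans (Eq.symm ((a.ev_cons_eq_zero (B := k) ω ?_ _)))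
      change a.shiftBr (p + 1) _ = 0
      rw [a.shiftBr_eq_zero (ha _ (by omega))]
      rfl
  refine key _ _ _ _ fun t => ?_
  have h2 := (hx (S.orderEmbOfFin rfl t)).2
  have : 0 < u.len := Nat.succ_pos _
  simp only [pick]
  omega

include hpos hdeg he hG hje in
-- The form η built from ω by the iterated bracket has a primitive ζ on A ⋉ N. Pulling back along F
-- = (id, D) gives F^*η = wω, so w⁻¹F^*ζ is a primitive of ω.
theorem isExactAt_of_words {F : A →ₗ[k] A × N}
    (hF : a.IsStrictHom (a.semidirect ha (Word.rightModule β deg hj)) F)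
    (hFe : ∀ t, F (e t) = (e t, ((deg t).2 : k) • β (t, []))) (hw : 0 < w)
    (hex : ∀ q', -q' < w → a.IsExactAt q') : a.IsExactAt (-w) := by
  intro p ω hω hd h0 h1
  have hη := ext_mem_cochains ha (Word.rightModule β deg hj) (p := p) (q := -w)
    (Z := insertFirst ω ∘ₗ a.wordBrMap β e)
    fun i n hn => a.insertFirst_mem hω (wordBrMap_mem β he hn)
  have hη1 := ext_arity_one ha (Word.rightModule β deg hj)
    (Z := insertFirst ω ∘ₗ a.wordBrMap β e) fun n => by
      ext x
      change ω 1 _ = 0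
      rw [h1]
      rfl
  have hηd := ceDiff_ext_insertFirst ha hpos hdeg he hG hj hje (neg_neg w).le hω hd hη
  -- The descent may start at length w: a longer word has internal degree above w and would leave a
  -- negative total for the remaining letters.
  obtain ⟨ζ, hζ, hζd⟩ := exists_primitive_of_contr ha hpos hdeg hG hj hje he (neg_neg w).le hex w.toNat
    hη hηd (pullForms_scaleTwo_ext ha _ _) hη1 fun u hu => by
      have hu' := Word.basis_mem β deg u
      have hlt := Word.len_le_degree hdeg u
      refine cochains_ext_of_sdeg hpos (contr_mem_cochains ha _ hη hu') (zero_mem _)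
        fun m x hx hs => ?_
      have h2 := congrArg Prod.snd hs
      rw [sdeg_snd] at h2
      have h3 := sum_nonneg fun t (_ : t ∈ univ) => (hx t).le
      rw [h2] at h3
      simp only at h3
      omega
  have hpull : pullForms F (ext ha (Word.rightModule β deg hj)
      (insertFirst ω ∘ₗ a.wordBrMap β e)) = (w : k) • ω := by
    refine cochains_ext_of_sdeg hpos (pullForms_mem_cochains hF.1 hη) (Submodule.smul_mem _ _ hω)
      fun n z hz hs => ?_
    replace hs : ∑ t, (z t).1.2 = w := by
      have := congrArg Prod.snd hs
      rwa [sdeg_snd, neg_neg] at this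
    -- From arity two on, positivity makes every letter of a sequence of total w smaller than w, so
    -- the formulas for F apply. Arity one would involve degree w itself, but there both forms
    -- vanish.
    obtain rfl | rfl | hn : n = 0 ∨ n = 1 ∨ 2 ≤ n := by omega
    · simp at hs
      omega
    · change ext _ _ _ 1 _ = (w : k) • ω 1 _
      rw [hη1, h1]
      exact (smul_zero _).symm
    have hlt : ∀ t, (z t).1.2 < w := by
      intro t
      rw [← hs]
      obtain ⟨s, hs⟩ : ∃ s : Fin n, s ≠ t := by
        have : Nontrivial (Fin n) := Fin.nontrivial_iff_two_le.2 hn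
        exact exists_ne t
      exact single_lt_sum hs (mem_univ t) (mem_univ s) (hz s) fun i _ _ => (hz i).le
    have hsec := fun t => wordBrMap_section ha hpos hG hj hje hF hFe (hlt t) (z t).2.2
    let y : Fin n → (a.semidirect ha (Word.rightModule β deg hj)).Letter :=
      fun t => ⟨(z t).1, F (z t).2, hF.1 _ _ (z t).2.2⟩
    refine (ev_ext ha _ _ y).trans ?_
    have h2 := shuf_euler (fun u : a.Letter => (u.1.2 : k)) (a.mem_cochains_iff.1 hω).1 z
    rw [← Int.cast_sum, hs] at h2
    refine Eq.trans ?_ h2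
    refine sum_congr rfl fun S _ => congrArg (fun v : k =>
      koszulSign (splitLabel S) (fun j => a.lpar (z j)) • v) ?_
    unfold extTerm
    split_ifs with h
    · change insertFirst ω (a.wordBrMap β e (F (pick S z ⟨0, _⟩).2).2) #Sᶜ
        (fun j => (F (pick Sᶜ z j).2).1) = _
      have h3 : (fun j => (F (pick Sᶜ z j).2).1) = a.vals (pick Sᶜ z) :=
        funext fun j => (hsec _).1
      rw [h3, show a.wordBrMap β e (F (pick S z ⟨0, _⟩).2).2 = _ from (hsec _).2, map_smul]
      refine Eq.trans ?_ (dif_pos h).symm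
      exact congrArg (fun v : k => (((pick S z ⟨0, by omega⟩).1.2 : ℤ) : k) • v)
        (a.ev_insertFirst ω (pick S z ⟨0, by omega⟩) (pick Sᶜ z))
    · beta_reduce
      rw [dif_neg h]
  refine ⟨(w : k)⁻¹ • pullForms F ζ, Submodule.smul_mem _ _ (pullForms_mem_cochains hF.1 hζ), ?_⟩
  rw [map_smul, hF.ceDiff_pullForms, hζd, hpull, smul_smul, inv_mul_cancel₀, one_smul]
  exact_mod_cast hw.ne'

end Words

end LInftyAlg

namespace LInftyAlg

/-! ### Exactness of free Lie algebras -/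

section Free

variable {k : Type u} [Field k] {A : Type v} [AddCommGroup A] [Module k A]

/-- Degree-preserving linear maps from `V` to strict Lie algebras extend to homomorphisms. -/
def HasLieExtension (a : LInftyAlg k A) (V : ℤ × ℤ → Submodule k A) : Prop :=
  ∀ (B : Type v) [AddCommGroup B] [Module k B] (b : LInftyAlg k B), b.IsStrictLie →
    ∀ φ : (i : ℤ × ℤ) → V i →ₗ[k] B, (∀ i y, φ i y ∈ b.gr i) →
      ∃ F : A →ₗ[k] B, a.IsStrictHom b F ∧ ∀ i (y : V i), F y = φ i y

theorem isExactAt_of_nonneg {a : LInftyAlg k A} (hpos : a.IsPositive) {q : ℤ} (hq : 0 ≤ q) :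
    a.IsExactAt q := by
  intro p ω hω _ h0 _
  refine ⟨0, zero_mem _, ?_⟩
  rw [map_zero]
  refine cochains_ext hpos (zero_mem _) hω fun n z hz => ?_
  obtain rfl | hn := Nat.eq_zero_or_pos n
  · exact (congrArg (fun f => f (a.vals z)) h0).symm
  · have := hz ⟨0, hn⟩
    omega

theorem isExactAt_of_subsingleton [Subsingleton A] (a : LInftyAlg k A) (q : ℤ) :
    a.IsExactAt q := by
  intro p ω _ _ h0 _
  refine ⟨0, zero_mem _, ?_⟩
  rw [map_zero]
  refine funext fun n => ?_
  obtain rfl | hn := Nat.eq_zero_or_pos n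
  · exact h0.symm
  · refine MultilinearMap.ext fun x => ?_
    exact ((ω n).map_coord_zero ⟨0, hn⟩ (Subsingleton.elim _ _)).symm

/-- A type of bases indexed by any type in the universe of a nontrivial vector space. -/
theorem exists_basis_of_nontrivial (k : Type u) [Field k] (A : Type v) [AddCommGroup A]
    [Module k A] [Nontrivial A] (ι : Type v) :
    ∃ (N : Type v) (_ : AddCommGroup N) (_ : Module k N), Nonempty (Module.Basis ι k N) := by
  obtain ⟨x, hx⟩ := exists_ne (0 : A)
  -- The universal property concerns targets in the universe of A, so the free associative algebra
  -- has to be realized there. A line in A shows that k has a copy in that universe.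
  have : Small.{v} k := small_of_injective (f := fun c : k => c • x) (smul_left_injective k hx)
  exact ⟨ι →₀ Shrink.{v} k, inferInstance, inferInstance,
    ⟨.ofRepr (Finsupp.mapRange.linearEquiv (Shrink.linearEquiv k k))⟩⟩

/-- The extension property is used twice: for j into the free associative algebra, and for F into
the semidirect product. Generation is assumed only below w, which gives exactness up to weight w
inclusive. -/
theorem isExactAt_of_free [CharZero k] {a : LInftyAlg k A} (ha : a.IsStrictLie) (hpos : a.IsPositive)
    {V : ℤ × ℤ → Submodule k A} (hV : ∀ i, V i ≤ a.gr i) (hE : a.HasLieExtension V) {w : ℤ}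
    (hG : ∀ i : ℤ × ℤ, i.2 < w → a.gr i ≤ V i ⊔ a.decAt i) {q : ℤ} (hq : -q ≤ w) :
    a.IsExactAt q := by
  obtain hA | hA := subsingleton_or_nontrivial A
  · exact a.isExactAt_of_subsingleton q
  let ι := Σ i, Module.Basis.ofVectorSpaceIndex k (V i)
  let e' (i) := Module.Basis.ofVectorSpace k (V i)
  let e : ι → A := fun t => e' t.1 t.2
  let deg : ι → ℤ × ℤ := Sigma.fst
  have he : ∀ t, e t ∈ a.gr (deg t) := fun t => hV _ (e' t.1 t.2).2
  have hdeg : ∀ t, 0 < (deg t).2 := by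
    intro t
    by_contra h
    have h1 := he t
    rw [hpos _ (not_lt.1 h), Submodule.mem_bot] at h1
    exact (e' t.1).ne_zero t.2 (Subtype.ext h1)
  have hspan : ∀ i, V i ≤ Submodule.span k (e '' {t | deg t = i}) := by
    intro i x hx
    have h1 : (⟨x, hx⟩ : V i) ∈ Submodule.span k (Set.range (e' i)) := by
      rw [(e' i).span_eq]
      trivial
    have h2 := Submodule.mem_map_of_mem (f := (V i).subtype) h1
    rw [Submodule.map_span] at h2
    refine Submodule.span_mono ?_ h2
    rintro _ ⟨_, ⟨t, rfl⟩, rfl⟩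
    exact ⟨⟨i, t⟩, rfl, rfl⟩
  obtain ⟨N, _, _, ⟨β⟩⟩ := exists_basis_of_nontrivial k A (Word ι)
  obtain ⟨j, hj, hjV⟩ := hE N (Word.lieAlg β deg) (Word.lieAlg_isStrictLie β deg)
    (fun i => (e' i).constr k fun t => β (⟨i, t⟩, [])) fun i y => by
      have : ⊤ ≤ (Word.gr β deg i).comap ((e' i).constr k fun t => β (⟨i, t⟩, [])) := by
        rw [← (e' i).span_eq, Submodule.span_le]
        rintro _ ⟨t, rfl⟩
        have h1 := Word.basis_mem β deg (⟨i, t⟩, [])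
        have h2 : Word.degree deg ((⟨i, t⟩, []) : Word ι) = i := add_zero i
        rw [h2] at h1
        simpa only [SetLike.mem_coe, Submodule.mem_comap, Module.Basis.constr_basis] using h1
      exact this (Submodule.mem_top (x := y))
  have hje : ∀ t, j (e t) = β (t, []) := by
    rintro ⟨i, t⟩
    rw [hjV i (e' i t), Module.Basis.constr_basis]
  obtain ⟨F, hF, hFV⟩ := hE (A × N) (a.semidirect ha (Word.rightModule β deg hj))
    (semidirect_isStrictLie ha _)
    (fun i => (V i).subtype.prod ((i.2 : k) • (j ∘ₗ (V i).subtype)))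
    fun i y => ⟨hV i y.2, Submodule.smul_mem _ _ (hj.1 i y (hV i y.2))⟩
  have hFe : ∀ t, F (e t) = (e t, ((deg t).2 : k) • β (t, [])) := by
    intro t
    rw [← hje t]
    exact hFV t.1 (e' t.1 t.2)
  -- Exactness with coefficients at one weight requires exactness at all smaller weights, hence the
  -- induction on -q.
  have main : ∀ (n : ℕ) (q : ℤ), -q ≤ n → -q ≤ w → a.IsExactAt q := by
    intro n
    induction n with
    | zero => exact fun q hq _ => isExactAt_of_nonneg hpos (by simp at hq; exact hq)
    | succ n ih =>
      intro q hq hqw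
      obtain hq | hq := hq.lt_or_eq
      · exact ih q (by push_cast at hq; omega) hqw
      have := isExactAt_of_words ha hpos hdeg (w := -q) he
        (fun i hi => (hG i (by omega)).trans (sup_le_sup_right (hspan i) _)) hj hje hF hFe
        (by rw [hq]; positivity) fun q' hq' => ih q' (by push_cast at hq; omega) (by omega)
      rwa [neg_neg] at this
  exact main (-q).toNat q (Int.self_le_toNat _) hq

end Free

end LInftyAlg

namespace LInftyAlg

/-! ### Arity components: from the binary bracket to all brackets -/

section Part

variable {k : Type u} [Field k] {A : Type v} [AddCommGroup A] [Module k A]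

/-- The component of arity `n`. -/
def part (n : ℕ) (ω : Forms k A) : Forms k A := fun m => if m = n then ω m else 0

@[simp] theorem part_self (n : ℕ) (ω : Forms k A) : part n ω n = ω n := if_pos rfl

theorem part_of_ne {m n : ℕ} (h : m ≠ n) (ω : Forms k A) : part n ω m = 0 := if_neg h

theorem part_mem_arityPart (n : ℕ) (ω : Forms k A) : part n ω ∈ arityPart k A n :=
  fun _ h => part_of_ne h ω

theorem part_of_mem {n : ℕ} {ω : Forms k A} (h : ω ∈ arityPart k A n) : part n ω = ω :=
  funext fun m => by
    by_cases hm : m = n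
    · rw [hm, part_self]
    · rw [part_of_ne hm, h m hm]

theorem part_mem_cochains (a : LInftyAlg k A) {p q : ℤ} {ω : Forms k A} (h : ω ∈ a.cochains p q)
    (n : ℕ) : part n ω ∈ a.cochains p q := by
  intro m d x hx
  by_cases hm : m = n
  · subst hm
    rw [part_self]
    exact h m d x hx
  · rw [part_of_ne hm]
    simp

theorem ceDiff_congr (a b : LInftyAlg k A) (hab : b.gr = a.gr) {ω ω' : Forms k A} {n : ℕ}
    (h : ∀ S : Finset (Fin n), ω (#Sᶜ + 1) = ω' (#Sᶜ + 1) ∧ a.shiftBr #S = b.shiftBr #S ∨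
      (a.shiftBr #S = 0 ∨ ω (#Sᶜ + 1) = 0) ∧ (b.shiftBr #S = 0 ∨ ω' (#Sᶜ + 1) = 0)) :
    a.ceDiff ω n = b.ceDiff ω' n := by
  refine multilinear_ext_of_homogeneous a.isInternal fun d x hx => ?_
  rw [a.ceDiff_apply ω n d x hx, b.ceDiff_apply ω' n d x (by rwa [hab])]
  refine sum_congr rfl fun S _ => congrArg _ ?_
  have key : ∀ (c : LInftyAlg k A) (θ : Forms k A), c.shiftBr #S = 0 ∨ θ (#Sᶜ + 1) = 0 →
      θ (#Sᶜ + 1) (Fin.cons (c.shiftBr #S (pick S x)) (pick Sᶜ x)) = 0 := by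
    rintro c θ (h | h)
    · exact (θ (#Sᶜ + 1)).map_coord_zero 0 (by rw [h]; rfl)
    · rw [h]
      rfl
  obtain ⟨h1, h2⟩ | ⟨h1, h2⟩ := h S
  · rw [h1, h2]
  · rw [key a ω h1, key b ω' h2]

theorem shiftBr_zero (a : LInftyAlg k A) : a.shiftBr 0 = 0 := a.shiftBr_eq_zero a.br_zero

theorem IsMinimal.shiftBr_of_le_one {a : LInftyAlg k A} (ha : a.IsMinimal) {n : ℕ} (hn : n ≤ 1) :
    a.shiftBr n = 0 := by
  obtain rfl | rfl : n = 0 ∨ n = 1 := by omega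
  · exact a.shiftBr_zero
  · exact a.shiftBr_eq_zero ha

theorem IsMinimal.ceDiff_eq_zero {a : LInftyAlg k A} (ha : a.IsMinimal) {ω : Forms k A} {m : ℕ}
    (h : ∀ j, 1 ≤ j → j < m → ω j = 0) : a.ceDiff ω m = 0 := by
  refine (a.ceDiff_congr a rfl (ω' := 0) fun S => Or.inr ?_).trans (by rw [map_zero]; rfl)
  refine ⟨?_, Or.inr rfl⟩
  have hc := card_add_card_compl S
  rw [Fintype.card_fin] at hc
  by_cases hS : #S ≤ 1
  · exact Or.inl (ha.shiftBr_of_le_one hS)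
  · exact Or.inr (h _ (by omega) (by omega))

theorem IsMinimal.ceDiff_part_zero {a : LInftyAlg k A} (ha : a.IsMinimal) (ω : Forms k A) :
    a.ceDiff (part 0 ω) = 0 :=
  funext fun _ => ha.ceDiff_eq_zero fun _ hj _ => part_of_ne (by omega) ω

theorem quad_shiftBr_two (a : LInftyAlg k A) (ha : a.IsMinimal) :
    (a.quad ha).shiftBr 2 = a.shiftBr 2 :=
  multilinear_ext_of_homogeneous a.isInternal fun d x hx => by
    rw [a.shiftBr_apply 2 d x hx, (a.quad ha).shiftBr_apply 2 d x hx]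
    rfl

/-- The differential of the leading component is given by the binary bracket. -/
theorem IsMinimal.ceDiff_leading {a : LInftyAlg k A} (ha : a.IsMinimal) {ω : Forms k A} {n : ℕ}
    (h : ∀ j, 1 ≤ j → j < n → ω j = 0) :
    a.ceDiff ω (n + 1) = (a.quad ha).ceDiff (part n ω) (n + 1) := by
  refine a.ceDiff_congr (a.quad ha) rfl fun S => ?_
  have hc := card_add_card_compl S
  rw [Fintype.card_fin] at hc
  by_cases hS : #S = 2
  · refine Or.inl ⟨?_, by rw [hS, quad_shiftBr_two]⟩
    rw [show #Sᶜ + 1 = n by omega, part_self]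
  · refine Or.inr ⟨?_, Or.inl ((a.quad ha).shiftBr_eq_zero (quad_isStrictLie a ha _ hS))⟩
    by_cases hS' : #S ≤ 1
    · exact Or.inl (ha.shiftBr_of_le_one hS')
    · exact Or.inr (h _ (by omega) (by omega))

/-- Letters have internal degree at least 1, so a cochain of internal degree q has no components of
arity above -q. The arity filtration is therefore finite. -/
theorem IsPositive.eq_zero_of_lt {a : LInftyAlg k A} (ha : a.IsPositive) {p q : ℤ} {ω : Forms k A}
    (h : ω ∈ a.cochains p q) {n : ℕ} (hn : ∀ j < n, ω j = 0) (hq : -q < n) : ω = 0 := by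
  refine cochains_ext_of_sdeg ha h (zero_mem _) fun m z hz hs => ?_
  replace hs := congrArg Prod.snd hs
  rw [sdeg_snd] at hs
  have h1 : ∑ _t : Fin m, (1 : ℤ) ≤ ∑ t, (z t).1.2 := sum_le_sum fun t _ => hz t
  rw [hs] at h1
  simp at h1
  exact congrArg (fun f => f (a.vals z)) (hn m (by omega))

/-- Exactness passes from the binary bracket to the whole algebra, arity by arity. -/
theorem exists_primitive_of_quad [CharZero k] {a : LInftyAlg k A} (hmin : a.IsMinimal)
    (hpos : a.IsPositive) {q : ℤ} (hex : (a.quad hmin).IsExactAt q) {n : ℕ} (hn : 2 ≤ n) {p : ℤ}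
    {ω : Forms k A} (hω : ω ∈ a.cochains p q) (hd : a.ceDiff ω = 0) (h : ∀ j < n, ω j = 0) :
    ∃ η ∈ a.cochains (p - 1) q, a.ceDiff η = ω ∧ ∀ j < n - 1, η j = 0 := by
  -- Here m bounds the number of arities left to correct. Each step removes the component of arity n
  -- by the arity n - 1 part of a primitive for the binary bracket, and only creates components of
  -- higher arity.
  obtain ⟨m, hm⟩ : ∃ m : ℕ, -q < n + m := ⟨(-q).toNat + 1, by omega⟩
  induction m generalizing n ω with
  | zero =>
    exact ⟨0, zero_mem _, by rw [map_zero, hpos.eq_zero_of_lt hω h (by simpa using hm)],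
      fun _ _ => rfl⟩
  | succ m ih =>
    have h1 : (a.quad hmin).ceDiff (part n ω) = 0 := funext fun l => by
      obtain rfl | hl := eq_or_ne l (n + 1)
      · rw [← hmin.ceDiff_leading fun j _ hj => h j hj, hd]
      · cases l with
        | zero => exact ceDiff_arity_zero _ _
        | succ l => exact (quad_isStrictLie a hmin).ceDiff_eq_zero (part_of_ne (by omega) ω)
    obtain ⟨η, hη, hηd⟩ := hex p (part n ω) (part_mem_cochains _ hω n) h1
      (part_of_ne (by omega) ω) (part_of_ne (by omega) ω)
    have hη' : part (n - 1) η ∈ a.cochains (p - 1) q := part_mem_cochains _ hη _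
    have h2 : ∀ j < n, a.ceDiff (part (n - 1) η) j = 0 := fun j hj =>
      hmin.ceDiff_eq_zero fun i _ hi => part_of_ne (by omega) η
    have h3 : a.ceDiff (part (n - 1) η) n = ω n := by
      have h4 := hmin.ceDiff_leading (ω := part (n - 1) η) (n := n - 1)
        fun j _ hj => part_of_ne (by omega) η
      rw [part_of_mem (part_mem_arityPart _ _), (quad_isStrictLie a hmin).ceDiff_congr
        (part_self (n - 1) η), hηd, show n - 1 + 1 = n by omega, part_self] at h4
      exact h4
    obtain ⟨ξ, hξ, hξd, hξ0⟩ := ih (n := n + 1) (by omega)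
      (sub_mem hω (by simpa using a.ceDiff_mem_cochains hη'))
      (by rw [map_sub, hd, ceDiff_ceDiff a hη', sub_zero])
      (fun j hj => by
        change ω j - a.ceDiff (part (n - 1) η) j = 0
        obtain rfl | hj := eq_or_ne j n
        · rw [h3, sub_self]
        · rw [h j (by omega), h2 j (by omega), sub_zero])
      (by push_cast at hm ⊢; omega)
    refine ⟨ξ + part (n - 1) η, add_mem hξ hη', by rw [map_add, hξd, sub_add_cancel],
      fun j hj => ?_⟩
    change ξ j + part (n - 1) η j = 0
    rw [hξ0 j (by omega), part_of_ne (by omega), add_zero]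

end Part

section Linear

variable {k : Type u} [Field k] {A : Type v} [AddCommGroup A] [Module k A]

theorem mem_arityCohomology_iff (a : LInftyAlg k A) {m : ℕ} {p q : ℤ} {x : a.Cohomology p q} :
    x ∈ a.arityCohomology m p q ↔ ∃ c : a.cocycles p q, (c : Forms k A) ∈ arityPart k A m ∧
      Submodule.Quotient.mk c = x := by
  simp [arityCohomology]

theorem cohomology_mk_eq_iff (a : LInftyAlg k A) {p q : ℤ} {c c' : a.cocycles p q} :
    (Submodule.Quotient.mk c : a.Cohomology p q) = Submodule.Quotient.mk c' ↔
      ∃ η ∈ a.cochains (p - 1) q, (c : Forms k A) = c' + a.ceDiff η := by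
  rw [Submodule.Quotient.eq, Submodule.mem_comap, coboundaries, Submodule.mem_map]
  refine exists_congr fun η => and_congr_right fun _ => ?_
  rw [map_sub, Submodule.subtype_apply, Submodule.subtype_apply, eq_sub_iff_add_eq, add_comm,
    eq_comm]

/-- `H^•(a) = k ⊕ H^{(1)}(a)` means that the linear component of every cocycle is closed, and that
the components of higher arity form a coboundary. -/
theorem IsMinimal.cohomologyIsLinear_iff {a : LInftyAlg k A} (ha : a.IsMinimal) :
    a.CohomologyIsLinear ↔ ∀ p q, ∀ ω ∈ a.cochains p q, a.ceDiff ω = 0 →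
      a.ceDiff (part 1 ω) = 0 ∧
        ∃ η ∈ a.cochains (p - 1) q, ω = part 0 ω + part 1 ω + a.ceDiff η := by
  -- For a minimal algebra coboundaries have no components in arities 0 and 1, so these components
  -- of a cocycle depend only on its class.
  have low : ∀ (η : Forms k A) (m : ℕ), m ≤ 1 → a.ceDiff η m = 0 :=
    fun η m hm => ha.ceDiff_eq_zero fun j _ _ => by omega
  constructor
  · intro h p q ω hω hd
    have h1 : (Submodule.Quotient.mk ⟨ω, hω, hd⟩ : a.Cohomology p q) ∈
        a.arityCohomology 0 p q ⊔ a.arityCohomology 1 p q := by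
      rw [(h p q).sup_eq_top]
      trivial
    obtain ⟨y, hy, z, hz, hyz⟩ := Submodule.mem_sup.1 h1
    obtain ⟨c, hc, rfl⟩ := a.mem_arityCohomology_iff.1 hy
    obtain ⟨l, hl, rfl⟩ := a.mem_arityCohomology_iff.1 hz
    rw [← Submodule.Quotient.mk_add] at hyz
    obtain ⟨η, hη, hωη⟩ := a.cohomology_mk_eq_iff.1 hyz.symm
    replace hωη : ω = c + l + a.ceDiff η := hωη
    have hval : ∀ m, m ≤ 1 → ω m = (c : Forms k A) m + (l : Forms k A) m := fun m hm => by
      rw [hωη]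
      change (c : Forms k A) m + (l : Forms k A) m + a.ceDiff η m = _
      rw [low η m hm, add_zero]
    have h0 : part 0 ω = c := by
      rw [← part_of_mem hc]
      refine funext fun m => ?_
      by_cases hm : m = 0
      · subst hm
        rw [part_self, part_self, hval 0 (by omega), hl 0 (by omega), add_zero]
      · rw [part_of_ne hm, part_of_ne hm]
    have h1 : part 1 ω = l := by
      rw [← part_of_mem hl]
      refine funext fun m => ?_
      by_cases hm : m = 1
      · subst hm
        rw [part_self, part_self, hval 1 le_rfl, hc 1 (by omega), zero_add]
      · rw [part_of_ne hm, part_of_ne hm]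
    rw [h0, h1]
    exact ⟨l.2.2, η, hη, hωη⟩
  · intro h p q
    refine ⟨Submodule.disjoint_def.2 fun x hx hx' => ?_, codisjoint_iff.2 (eq_top_iff.2 ?_)⟩
    · obtain ⟨c, hc, rfl⟩ := a.mem_arityCohomology_iff.1 hx
      obtain ⟨l, hl, hlc⟩ := a.mem_arityCohomology_iff.1 hx'
      obtain ⟨η, hη, hlη⟩ := a.cohomology_mk_eq_iff.1 hlc
      have h1 : (l : Forms k A) = 0 := by
        rw [← part_of_mem hl]
        refine funext fun m => ?_
        by_cases hm : m = 1
        · subst hm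
          rw [part_self, hlη]
          change (c : Forms k A) 1 + a.ceDiff η 1 = 0
          rw [hc 1 (by omega), low η 1 le_rfl, add_zero]
        · exact part_of_ne hm _
      rw [← hlc, Subtype.ext (a1 := l) (a2 := 0) h1]
      rfl
    · rintro x -
      obtain ⟨⟨ω, hω, hd⟩, rfl⟩ := Submodule.Quotient.mk_surjective _ x
      obtain ⟨h1, η, hη, hωη⟩ := h p q ω hω hd
      let c : a.cocycles p q := ⟨part 0 ω, part_mem_cochains a hω 0, ha.ceDiff_part_zero ω⟩
      let l : a.cocycles p q := ⟨part 1 ω, part_mem_cochains a hω 1, h1⟩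
      rw [show (Submodule.Quotient.mk ⟨ω, hω, hd⟩ : a.Cohomology p q) =
        Submodule.Quotient.mk (c + l) from a.cohomology_mk_eq_iff.2 ⟨η, hη, hωη⟩,
        Submodule.Quotient.mk_add]
      exact Submodule.add_mem_sup
        (a.mem_arityCohomology_iff.2 ⟨c, part_mem_arityPart _ _, rfl⟩)
        (a.mem_arityCohomology_iff.2 ⟨l, part_mem_arityPart _ _, rfl⟩)

end Linear

end LInftyAlg

namespace LInftyAlg

/-! ### Linear cohomology as the forms that kill brackets -/

section LinearCocycles

variable {k : Type u} [Field k] {A : Type v} [AddCommGroup A] [Module k A]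

/-- The span of the brackets of degree `i`. -/
def brAt (a : LInftyAlg k A) (i : ℤ × ℤ) : Submodule k A :=
  Submodule.span k {z | z ∈ a.gr i ∧ ∃ n, ∃ x : Fin n → A, a.br n x = z}

theorem brAt_le (a : LInftyAlg k A) (i : ℤ × ℤ) : a.brAt i ≤ a.gr i :=
  Submodule.span_le.2 fun _ h => h.1

theorem decAt_le (a : LInftyAlg k A) (i : ℤ × ℤ) : a.decAt i ≤ a.gr i := by
  refine Submodule.span_le.2 ?_
  rintro _ ⟨i₁, i₂, rfl, x, hx, y, hy, rfl⟩
  exact a.lie_mem hx hy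

theorem decAt_le_brAt (a : LInftyAlg k A) (i : ℤ × ℤ) : a.decAt i ≤ a.brAt i := by
  refine Submodule.span_mono ?_
  rintro _ ⟨i₁, i₂, rfl, x, hx, y, hy, rfl⟩
  exact ⟨a.lie_mem hx hy, 2, _, rfl⟩

/-- The closed linear forms supported in degree `i`. -/
def linearCocycles (a : LInftyAlg k A) (i : ℤ × ℤ) : Submodule k (Module.Dual k A) where
  carrier := {g | (∀ j, j ≠ i → ∀ x ∈ a.gr j, g x = 0) ∧ ∀ n x, g (a.br n x) = 0}
  add_mem' := by
    rintro g g' ⟨h1, h2⟩ ⟨h3, h4⟩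
    exact ⟨fun j hj x hx => by rw [LinearMap.add_apply, h1 j hj x hx, h3 j hj x hx, add_zero],
      fun n x => by rw [LinearMap.add_apply, h2, h4, add_zero]⟩
  zero_mem' := ⟨fun _ _ _ _ => rfl, fun _ _ => rfl⟩
  smul_mem' := by
    rintro c g ⟨h1, h2⟩
    exact ⟨fun j hj x hx => by rw [LinearMap.smul_apply, h1 j hj x hx, smul_zero],
      fun n x => by rw [LinearMap.smul_apply, h2, smul_zero]⟩

theorem map_brAt {a : LInftyAlg k A} {i : ℤ × ℤ} {g : Module.Dual k A}
    (hg : g ∈ a.linearCocycles i) {j : ℤ × ℤ} {x : A} (hx : x ∈ a.brAt j) : g x = 0 := by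
  have : a.brAt j ≤ LinearMap.ker g := by
    refine Submodule.span_le.2 ?_
    rintro _ ⟨_, n, x, rfl⟩
    exact hg.2 n x
  exact this hx

theorem linearForm_mem_arityPart (g : A →ₗ[k] k) : linearForm g ∈ arityPart k A 1 :=
  fun _ hn => linearFamily_of_ne _ hn

theorem part_one_eq_linearForm (ω : Forms k A) :
    part 1 ω = linearForm ((MultilinearMap.ofSubsingleton k A k (0 : Fin 1)).symm (ω 1)) := by
  refine funext fun n => ?_
  by_cases hn : n = 1
  · subst hn
    rw [part_self]
    refine MultilinearMap.ext fun x => ?_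
    exact congrArg (ω 1) (funext fun j => by rw [Subsingleton.elim j 0])
  · rw [part_of_ne hn]
    exact (linearFamily_of_ne _ hn).symm

theorem linearForm_mem_cochains_iff (a : LInftyAlg k A) {p q : ℤ} {g : A →ₗ[k] k} :
    linearForm g ∈ a.cochains p q ↔ ∀ j, j ≠ (1 - p, -q) → ∀ x ∈ a.gr j, g x = 0 := by
  rw [mem_cochains_iff]
  refine ⟨fun h j hj x hx => h.2 1 (fun _ => ⟨j, x, hx⟩) fun hs => hj ?_,
    fun h => ⟨a.symmFam_linearFamily _, fun n z hz => ?_⟩⟩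
  · simp only [sdeg, Finset.univ_unique, sum_singleton] at hs
    rw [eq_sub_of_add_eq hs]
    ext <;> simp
    ring
  · by_cases hn : n = 1
    · subst hn
      refine h (z 0).1 (fun h' => hz ?_) _ (z 0).2.2
      simp only [sdeg, Finset.univ_unique, sum_singleton]
      rw [show (default : Fin 1) = 0 from rfl, h']
      ext <;> simp
      ring
    · exact congrArg (fun f => f (a.vals z)) (linearForm_mem_arityPart g n hn)

theorem ceDiff_linearForm_iff (a : LInftyAlg k A) {g : A →ₗ[k] k} :
    a.ceDiff (linearForm g) = 0 ↔ ∀ n x, g (a.br n x) = 0 :=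
  ⟨fun h n x => a.map_br_eq_zero_of_ceDiff (n := n) (by rw [h]; rfl) x, a.ceDiff_linearForm⟩

/-- The cocycle given by a closed linear form. -/
noncomputable def linearCocycle (a : LInftyAlg k A) (p q : ℤ) :
    a.linearCocycles (1 - p, -q) →ₗ[k] a.cocycles p q where
  toFun g := ⟨linearForm g.1, a.linearForm_mem_cochains_iff.2 g.2.1, a.ceDiff_linearForm g.2.2⟩
  map_add' g g' := Subtype.ext (funext fun n => by
    by_cases hn : n = 1
    · subst hn
      rfl
    · change linearForm _ n = linearForm _ n + linearForm _ n
      simp only [linearForm_mem_arityPart _ n hn, add_zero])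
  map_smul' c g := Subtype.ext (funext fun n => by
    by_cases hn : n = 1
    · subst hn
      rfl
    · change linearForm (c • g).1 n = c • linearForm g.1 n
      simp only [linearForm_mem_arityPart _ n hn, smul_zero])

/-- The linear cohomology of a minimal algebra consists of the closed linear forms. -/
theorem IsMinimal.nonempty_linearCocycles_equiv {a : LInftyAlg k A} (ha : a.IsMinimal) (p q : ℤ) :
    Nonempty (a.linearCocycles (1 - p, -q) ≃ₗ[k] a.arityCohomology 1 p q) := by
  let Φ : a.linearCocycles (1 - p, -q) →ₗ[k] a.arityCohomology 1 p q :=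
    LinearMap.codRestrict _ (Submodule.mkQ _ ∘ₗ a.linearCocycle p q) fun g =>
      a.mem_arityCohomology_iff.2 ⟨a.linearCocycle p q g, linearForm_mem_arityPart g.1, rfl⟩
  refine ⟨LinearEquiv.ofBijective Φ ⟨?_, ?_⟩⟩
  · intro g g' hg
    have h1 : (Submodule.Quotient.mk (a.linearCocycle p q g) : a.Cohomology p q) =
      Submodule.Quotient.mk (a.linearCocycle p q g') := congrArg Subtype.val hg
    obtain ⟨η, _, hη⟩ := a.cohomology_mk_eq_iff.1 h1
    refine Subtype.ext (LinearMap.ext fun x => ?_)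
    have h2 := congrArg (fun f : Forms k A => f 1 fun _ => x) hη
    have h3 : a.ceDiff η 1 = 0 := ha.ceDiff_eq_zero fun j _ _ => by omega
    refine h2.trans ?_
    change g'.1 x + a.ceDiff η 1 _ = _
    rw [h3]
    exact add_zero _
  · rintro ⟨x, hx⟩
    obtain ⟨⟨c, hc, hd⟩, hc1, rfl⟩ := a.mem_arityCohomology_iff.1 hx
    replace hc1 : c ∈ arityPart k A 1 := hc1
    have h1 := part_one_eq_linearForm c
    rw [part_of_mem hc1] at h1
    refine ⟨⟨(MultilinearMap.ofSubsingleton k A k (0 : Fin 1)).symm (c 1), ?_, ?_⟩, ?_⟩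
    · rw [h1] at hc
      exact a.linearForm_mem_cochains_iff.1 hc
    · rw [h1] at hd
      exact a.ceDiff_linearForm_iff.1 hd
    · exact Subtype.ext (congrArg Submodule.Quotient.mk (Subtype.ext h1.symm))

/-- The restriction of closed linear forms to a subspace. -/
def restrictCocycles (a : LInftyAlg k A) (i : ℤ × ℤ) (V : Submodule k A) :
    a.linearCocycles i →ₗ[k] Module.Dual k V :=
  V.subtype.dualMap ∘ₗ (a.linearCocycles i).subtype

theorem restrictCocycles_injective (a : LInftyAlg k A) {i : ℤ × ℤ} {V : Submodule k A}
    (h : a.gr i ≤ V ⊔ a.brAt i) : Function.Injective (a.restrictCocycles i V) := by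
  refine (injective_iff_map_eq_zero _).2 fun g hg => Subtype.ext (a.linearMap_ext fun j x hx => ?_)
  change g.1 x = 0
  by_cases hj : j = i
  · subst hj
    obtain ⟨y, hy, z, hz, rfl⟩ := Submodule.mem_sup.1 (h hx)
    rw [map_add, map_brAt g.2 hz, add_zero]
    exact congrArg (fun f : Module.Dual k V => f ⟨y, hy⟩) hg
  · exact g.2.1 j hj x hx

end LinearCocycles

/-! ### Free Lie algebras are generated; linearity from freeness -/

section Generation

variable {k : Type u} [Field k] {A : Type v} [AddCommGroup A] [Module k A]

/-- The algebra with the same grading and zero brackets. -/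
def abelian (a : LInftyAlg k A) : LInftyAlg k A where
  gr := a.gr
  isInternal := a.isInternal
  br _ := 0
  br_zero := rfl
  br_mem _ _ _ _ := zero_mem _
  br_antisymm _ _ _ _ _ := by simp
  jacobi _ _ _ _ := by simp

theorem abelian_isStrictLie (a : LInftyAlg k A) : a.abelian.IsStrictLie := fun _ _ => rfl

theorem exists_projection_along (W : Submodule k A) :
    ∃ f : A →ₗ[k] A, (∀ x ∈ W, f x = 0) ∧ ∀ x, x - f x ∈ W := by
  obtain ⟨g, hg⟩ := W.subtype.exists_leftInverse_of_injective W.ker_subtype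
  refine ⟨LinearMap.id - W.subtype ∘ₗ g, fun x hx => ?_, fun x => ?_⟩
  · have := congrArg (fun f => ((f ⟨x, hx⟩ : W) : A)) hg
    simpa [sub_eq_zero] using this.symm
  · simp

/-- Uniqueness in the universal property is tested on the abelian algebra with the same grading: in
degree i, a projection along V + [A, A] kills generators and brackets, so it extends the zero map on
V and must be zero. -/
theorem IsFreeLieOn.gr_le {a : LInftyAlg k A} {V : ℤ × ℤ → Submodule k A} (h : a.IsFreeLieOn V)
    (i : ℤ × ℤ) : a.gr i ≤ V i ⊔ a.decAt i := by
  obtain ⟨f, hf, hf'⟩ := exists_projection_along (V i ⊔ a.decAt i)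
  have hW : V i ⊔ a.decAt i ≤ a.gr i := sup_le (h.2.1 i) (a.decAt_le i)
  obtain ⟨_, _, huniq⟩ := h.2.2 A a.abelian a.abelian_isStrictLie (fun i => 0)
    fun i y => zero_mem _
  have h0 := huniq 0 ⟨fun i x _ => zero_mem _, fun x y => rfl, fun i y => rfl⟩
  have h1 := huniq (f ∘ₗ a.gproj i) ⟨fun j x hx => ?_, fun x y => ?_, fun j y => ?_⟩
  · intro x hx
    have h2 := congrArg (fun g => g x) (h1.trans h0.symm)
    simp only [LinearMap.comp_apply, a.gproj_of_mem hx] at h2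
    have h3 := hf' x
    rw [h2] at h3
    simpa using h3
  · change f (a.gproj i x) ∈ a.gr j
    by_cases hj : j = i
    · subst hj
      rw [a.gproj_of_mem hx, ← sub_sub_cancel x (f x)]
      exact sub_mem hx (hW (hf' x))
    · rw [a.gproj_of_ne hj hx, map_zero]
      exact zero_mem _
  · change f (a.gproj i (a.lie x y)) = 0
    refine a.homogeneous_induction (P := fun x => f (a.gproj i (a.lie x y)) = 0) (fun i₁ x hx => ?_)
      (fun x x' h h' => by simp [h, h']) x
    refine a.homogeneous_induction (P := fun y => f (a.gproj i (a.lie x y)) = 0) (fun i₂ y hy => ?_)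
      (fun x x' h h' => by simp [h, h']) y
    by_cases hi : i₁ + i₂ = i
    · rw [a.gproj_of_mem (hi ▸ a.lie_mem hx hy)]
      exact hf _ (Submodule.mem_sup_right (Submodule.subset_span ⟨i₁, i₂, hi, x, hx, y, hy, rfl⟩))
    · rw [a.gproj_of_ne hi (a.lie_mem hx hy), map_zero]
  · change f (a.gproj i y) = 0
    by_cases hj : j = i
    · subst hj
      rw [a.gproj_of_mem (h.2.1 j y.2)]
      exact hf _ (Submodule.mem_sup_left y.2)
    · rw [a.gproj_of_ne hj (h.2.1 j y.2), map_zero]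

theorem IsFreeLieOn.hasLieExtension {a : LInftyAlg k A} {V : ℤ × ℤ → Submodule k A}
    (h : a.IsFreeLieOn V) : a.HasLieExtension V := by
  intro B _ _ b hb φ hφ
  obtain ⟨F, ⟨h1, h2, h3⟩, _⟩ := h.2.2 B b hb φ hφ
  exact ⟨F, isStrictHom_of_lie h.1 hb h1 h2, h3⟩

/-- Homomorphisms that agree on generators are equal. -/
theorem IsPositive.hom_ext {a : LInftyAlg k A} (ha : a.IsPositive) {V : ℤ × ℤ → Submodule k A}
    (hG : ∀ i, a.gr i ≤ V i ⊔ a.decAt i) {B : Type*} [AddCommGroup B] [Module k B]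
    {b : LInftyAlg k B} {F F' : A →ₗ[k] B} (hF : ∀ x y, F (a.lie x y) = b.lie (F x) (F y))
    (hF' : ∀ x y, F' (a.lie x y) = b.lie (F' x) (F' y)) (hV : ∀ i, ∀ x ∈ V i, F x = F' x) :
    F = F' := by
  refine a.linearMap_ext fun i x hx => ?_
  exact ha.gen_induction (w := i.2 + 1) (fun i _ => hG i) (P := fun _ x => F x = F' x) (by simp)
    (fun _ x y h h' => by rw [map_add, map_add, h, h'])
    (fun _ c x h => by rw [map_smul, map_smul, h]) hV
    (fun i j _ _ x _ y _ h h' => by rw [hF, hF', h, h']) (by omega) hx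

theorem isFreeLieOn_of_hasLieExtension {a : LInftyAlg k A} (ha : a.IsStrictLie)
    (hpos : a.IsPositive) {V : ℤ × ℤ → Submodule k A} (hV : ∀ i, V i ≤ a.gr i)
    (hE : a.HasLieExtension V) (hG : ∀ i, a.gr i ≤ V i ⊔ a.decAt i) : a.IsFreeLieOn V := by
  refine ⟨ha, hV, fun B _ _ b hb φ hφ => ?_⟩
  obtain ⟨F, hF, hFφ⟩ := hE B b hb φ hφ
  have hF2 : ∀ x y, F (a.lie x y) = b.lie (F x) (F y) := fun x y => by
    rw [lie_apply, hF.2, br_two]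
    rfl
  refine ⟨F, ⟨hF.1, hF2, hFφ⟩, ?_⟩
  rintro F' ⟨_, h2, h3⟩
  exact hpos.hom_ext hG h2 hF2 fun i x hx => (h3 i ⟨x, hx⟩).trans (hFφ i ⟨x, hx⟩).symm

/-- If the binary bracket is that of a free Lie algebra and every closed linear form for the binary
bracket is closed, then the cohomology is linear. -/
theorem cohomologyIsLinear_of_quad_isFreeLieOn [CharZero k] {a : LInftyAlg k A}
    (hmin : a.IsMinimal) (hpos : a.IsPositive) {V : ℤ × ℤ → Submodule k A}
    (hV : (a.quad hmin).IsFreeLieOn V)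
    (hlin : ∀ i, (a.quad hmin).linearCocycles i ≤ a.linearCocycles i) : a.CohomologyIsLinear := by
  refine hmin.cohomologyIsLinear_iff.2 fun p q ω hω hd => ?_
  -- In arity two, dω = 0 only says that the linear component is closed for the binary bracket;
  -- `hlin` supplies closedness for all the brackets.
  have h1 : a.ceDiff (part 1 ω) = 0 := by
    have h2 := hmin.ceDiff_leading (ω := ω) (n := 1) fun j _ _ => by omega
    have h3 := part_mem_cochains a hω 1
    rw [part_one_eq_linearForm] at h2 h3 ⊢
    rw [hd] at h2
    refine a.ceDiff_linearForm (hlin (1 - p, -q) ⟨a.linearForm_mem_cochains_iff.1 h3,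
      fun n x => ?_⟩).2
    by_cases hn : n = 2
    · subst hn
      exact (a.quad hmin).map_br_eq_zero_of_ceDiff h2.symm x
    · rw [quad_isStrictLie a hmin n hn, _root_.zero_apply, map_zero]
  obtain ⟨η, hη, hηd, _⟩ := exists_primitive_of_quad hmin hpos
    (isExactAt_of_free (quad_isStrictLie a hmin) hpos hV.2.1 hV.hasLieExtension
      (fun i _ => hV.gr_le i) le_rfl) le_rfl
    (sub_mem hω (add_mem (part_mem_cochains a hω 0) (part_mem_cochains a hω 1)))
    (by rw [map_sub, map_add, hd, hmin.ceDiff_part_zero, h1, add_zero, sub_zero]) fun j hj => by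
      change ω j - (part 0 ω j + part 1 ω j) = 0
      obtain rfl | rfl : j = 0 ∨ j = 1 := by omega
      · rw [part_self, part_of_ne (by omega), add_zero, sub_self]
      · rw [part_self, part_of_ne (by omega), zero_add, sub_self]
  exact ⟨h1, η, hη, by rw [hηd, add_sub_cancel]⟩

end Generation

end LInftyAlg

namespace LInftyAlg

/-! ### From linear cohomology to freeness of the binary bracket -/

section Forward

variable {k : Type u} [Field k] {A : Type v} [AddCommGroup A] [Module k A]

/-- The linear map with the given restrictions to the homogeneous parts. -/
noncomputable def ofGraded {B : Type*} [AddCommGroup B] [Module k B] (a : LInftyAlg k A)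
    (f : ℤ × ℤ → A →ₗ[k] B) : A →ₗ[k] B :=
  DirectSum.toModule k (ℤ × ℤ) B (fun i => f i ∘ₗ (a.gr i).subtype) ∘ₗ
    (LinearEquiv.ofBijective (DirectSum.coeLinearMap a.gr) a.bijective_coe).symm.toLinearMap

theorem ofGraded_apply {B : Type*} [AddCommGroup B] [Module k B] (a : LInftyAlg k A)
    (f : ℤ × ℤ → A →ₗ[k] B) {i : ℤ × ℤ} {x : A} (hx : x ∈ a.gr i) : a.ofGraded f x = f i x := by
  have h : (LinearEquiv.ofBijective (DirectSum.coeLinearMap a.gr) a.bijective_coe).symm x =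
      DirectSum.lof k (ℤ × ℤ) (fun i => a.gr i) i ⟨x, hx⟩ := by
    rw [LinearEquiv.symm_apply_eq]
    exact (DirectSum.coeLinearMap_lof a.gr i ⟨x, hx⟩).symm
  simp only [ofGraded, LinearMap.comp_apply, LinearEquiv.coe_coe, h, DirectSum.toModule_lof]
  rfl

/-- A degree-preserving projection along the brackets. -/
theorem exists_projection_along_brAt (a : LInftyAlg k A) : ∃ π : A →ₗ[k] A,
    (∀ i, ∀ x ∈ a.gr i, π x ∈ a.gr i) ∧ (∀ i, ∀ x ∈ a.gr i, x - π x ∈ a.brAt i) ∧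
      ∀ n x, π (a.br n x) = 0 := by
  choose f hf hf' using fun i => exists_projection_along (a.brAt i)
  refine ⟨a.ofGraded f, fun i x hx => ?_, fun i x hx => ?_, fun n => ?_⟩
  · rw [a.ofGraded_apply f hx, ← sub_sub_cancel x (f i x)]
    exact sub_mem hx (a.brAt_le i (hf' i x))
  · rw [a.ofGraded_apply f hx]
    exact hf' i x
  · have : (a.ofGraded f).compMultilinearMap (a.br n) = 0 := a.multilinear_ext fun z => by
      have h := a.br_mem n (fun j => (z j).1) (a.vals z) fun j => (z j).2.2
      refine (a.ofGraded_apply f h).trans (hf _ _ (Submodule.subset_span ⟨h, n, _, rfl⟩))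
    exact fun x => congrArg (fun g => g x) this

theorem IsMinimal.isExactAt {a : LInftyAlg k A} (ha : a.IsMinimal) (h : a.CohomologyIsLinear)
    (q : ℤ) : a.IsExactAt q := by
  intro p ω hω hd h0 h1
  obtain ⟨_, η, hη, hωη⟩ := ha.cohomologyIsLinear_iff.1 h p q ω hω hd
  refine ⟨η, hη, ?_⟩
  have hz : ∀ m, ω m = 0 → part m ω = 0 := fun m hm => funext fun n => by
    by_cases hn : n = m
    · rw [hn, part_self, hm]
      rfl
    · exact part_of_ne hn ω
  rwa [hz 0 h0, hz 1 h1, add_zero, zero_add, eq_comm] at hωη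

variable [CharZero k] {a : LInftyAlg k A} (hmin : a.IsMinimal) (hpos : a.IsPositive)
  (hlin : a.CohomologyIsLinear) {π : A →ₗ[k] A} (h1 : ∀ i, ∀ x ∈ a.gr i, π x ∈ a.gr i)
  (h2 : ∀ i, ∀ x ∈ a.gr i, x - π x ∈ a.brAt i) (h3 : ∀ n x, π (a.br n x) = 0)

omit [CharZero k] in
include h3 in
theorem map_brAt_eq_zero {i : ℤ × ℤ} {x : A} (hx : x ∈ a.brAt i) : π x = 0 := by
  have : a.brAt i ≤ LinearMap.ker π := by
    refine Submodule.span_le.2 ?_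
    rintro _ ⟨_, n, x, rfl⟩
    exact h3 n x
  exact this hx

omit [CharZero k] in
include h2 h3 in
theorem projection_idem (x : A) : π (π x) = π x := by
  refine a.homogeneous_induction (P := fun x => π (π x) = π x) (fun i x hx => ?_)
    (fun x y h h' => by rw [map_add, map_add, h, h']) x
  have := map_brAt_eq_zero h3 (h2 i x hx)
  rw [map_sub, sub_eq_zero] at this
  exact this.symm

include hpos hlin h1 h2 h3 in
-- A map on V is extended to an L∞ morphism from `a`, and the linear part of the morphism is the
-- required homomorphism on `quad`.
theorem quad_hasLieExtension :
    (a.quad hmin).HasLieExtension fun i => (a.gr i).map π := by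
  intro B _ _ b hb φ hφ
  have hmem : ∀ i x, (π ∘ₗ a.gproj i) x ∈ (a.gr i).map π :=
    fun i x => Submodule.mem_map_of_mem (a.gproj_mem i x)
  let φ' : A →ₗ[k] B := a.ofGraded fun i => φ i ∘ₗ (π ∘ₗ a.gproj i).codRestrict _ (hmem i)
  have hφ' : ∀ i, ∀ x (hx : x ∈ a.gr i), φ' x = φ i ⟨π x, Submodule.mem_map_of_mem hx⟩ := by
    intro i x hx
    refine (a.ofGraded_apply _ hx).trans (congrArg (φ i) (Subtype.ext ?_))
    exact congrArg π (a.gproj_of_mem hx)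
  obtain ⟨f, hf⟩ := exists_lInftyHom hpos hb (φ := φ')
    (fun i x hx => by rw [hφ' i x hx]; exact hφ i _) h1 (projection_idem h2 h3) h3
    (hmin.isExactAt hlin)
  refine ⟨f.linear, isStrictHom_of_lie (quad_isStrictLie a hmin) hb (fun i x hx => f.linear_mem hx)
    (f.linear_lie hmin hb), ?_⟩
  rintro i ⟨_, x, hx, rfl⟩
  refine (hf x).trans ((hφ' i _ (h1 i x hx)).trans (congrArg (φ i) (Subtype.ext ?_)))
  exact projection_idem h2 h3 x

include hpos hlin h1 h2 h3 in
-- Induction on the internal degree. If x were not generated, some linear form g would kill V and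
-- the binary brackets but not x. Then dg starts in arity 3, and exactness of `quad` at this weight,
-- which needs generation in smaller degrees only, gives η starting in arity 2 with dη = dg. So g -
-- η is a cocycle; linearity of the cohomology makes its linear component g closed, g kills all
-- brackets, and g(x) = g(πx) = 0.
theorem quad_generated (i : ℤ × ℤ) : a.gr i ≤ (a.gr i).map π ⊔ (a.quad hmin).decAt i := by
  obtain ⟨m, hm⟩ : ∃ m : ℕ, i.2 < m := ⟨i.2.toNat + 1, by push_cast; omega⟩
  induction m generalizing i with
  | zero =>
    rw [hpos i (by push_cast at hm; omega)]
    exact bot_le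
  | succ m ih =>
    intro x hx
    by_contra hxW
    obtain ⟨ψ, hψx, hψ⟩ := Submodule.exists_le_ker_of_notMem hxW
    let g : A →ₗ[k] k := ψ ∘ₗ a.gproj i
    have hg : ∀ j, j ≠ i → ∀ x ∈ a.gr j, g x = 0 := fun j hj x hx => by
      change ψ (a.gproj i x) = 0
      rw [a.gproj_of_ne hj hx, map_zero]
    have hglie : ∀ x y, g (a.lie x y) = 0 := by
      intro x y
      refine a.homogeneous_induction (P := fun x => g (a.lie x y) = 0) (fun i₁ x hx => ?_)
        (fun x x' h h' => by simp [h, h']) x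
      refine a.homogeneous_induction (P := fun y => g (a.lie x y) = 0) (fun i₂ y hy => ?_)
        (fun x x' h h' => by simp [h, h']) y
      by_cases hi : i₁ + i₂ = i
      · change ψ (a.gproj i _) = 0
        rw [a.gproj_of_mem (hi ▸ a.lie_mem hx hy)]
        exact hψ (Submodule.mem_sup_right
          (Submodule.subset_span ⟨i₁, i₂, hi, x, hx, y, hy, rfl⟩))
      · exact hg _ hi _ (a.lie_mem hx hy)
    have hgmem : linearForm g ∈ a.cochains (1 - i.1) (-i.2) :=
      a.linearForm_mem_cochains_iff.2 fun j hj => hg j (by simpa using hj)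
    have hd2 : a.ceDiff (linearForm g) 2 = 0 := by
      rw [hmin.ceDiff_leading (n := 1) fun j _ _ => by omega,
        part_of_mem (linearForm_mem_arityPart g), (a.quad hmin).ceDiff_linearForm fun n x => ?_]
      · rfl
      by_cases hn : n = 2
      · subst hn
        rw [br_two]
        exact hglie _ _
      · rw [quad_isStrictLie a hmin n hn, _root_.zero_apply, map_zero]
    -- Taking n = 3 ensures that η vanishes in arity 1, so subtracting it does not alter the linear
    -- component.
    obtain ⟨η, hη, hηd, hη0⟩ := exists_primitive_of_quad hmin hpos (q := -i.2)
      (isExactAt_of_free (quad_isStrictLie a hmin) hpos (w := i.2)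
        (fun i => by rintro _ ⟨x, hx, rfl⟩; exact h1 i x hx)
        (quad_hasLieExtension hmin hpos hlin h1 h2 h3)
        (fun j hj => ih j (by push_cast at hm; omega)) (neg_neg i.2).le)
      (n := 3) (by omega) (a.ceDiff_mem_cochains hgmem) (a.ceDiff_ceDiff hgmem) fun j hj => by
        obtain hj | rfl : j ≤ 1 ∨ j = 2 := by omega
        · exact hmin.ceDiff_eq_zero fun _ _ _ => by omega
        · exact hd2
    rw [add_sub_cancel_right] at hη
    have hcl := (hmin.cohomologyIsLinear_iff.1 hlin _ _ _ (sub_mem hgmem hη)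
      (by rw [map_sub, hηd, sub_self])).1
    have hpart : part 1 (linearForm g - η) = linearForm g := by
      rw [← part_of_mem (linearForm_mem_arityPart g)]
      refine funext fun n => ?_
      by_cases hn : n = 1
      · subst hn
        rw [part_self, part_self, part_of_mem (linearForm_mem_arityPart g)]
        change linearForm g 1 - η 1 = _
        rw [hη0 1 (by omega), sub_zero]
      · rw [part_of_ne hn, part_of_ne hn]
    rw [hpart, ceDiff_linearForm_iff] at hcl
    have h4 := map_brAt (g := g) (i := i) ⟨hg, hcl⟩ (h2 i x hx)
    have h5 : g (π x) = 0 := by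
      change ψ (a.gproj i _) = 0
      rw [a.gproj_of_mem (h1 i x hx)]
      exact hψ (Submodule.mem_sup_left (Submodule.mem_map_of_mem hx))
    rw [map_sub, h5, sub_zero] at h4
    refine hψx ?_
    have h6 : ψ (a.gproj i x) = 0 := h4
    rwa [a.gproj_of_mem hx] at h6

include h1 h2 h3 in
omit [CharZero k] in
-- The range of `π` is a complement of the brackets, so a closed linear form in degree i is an
-- arbitrary form on that complement, extended by zero on the brackets.
theorem restrictCocycles_bijective (i : ℤ × ℤ) :
    Function.Bijective (a.restrictCocycles i ((a.gr i).map π)) := by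
  have hmem : ∀ x, (π ∘ₗ a.gproj i) x ∈ (a.gr i).map π :=
    fun x => Submodule.mem_map_of_mem (a.gproj_mem i x)
  refine ⟨a.restrictCocycles_injective fun x hx => ?_, fun g => ?_⟩
  · rw [← add_sub_cancel (π x) x]
    exact Submodule.add_mem_sup (Submodule.mem_map_of_mem hx) (h2 i x hx)
  · refine ⟨⟨g ∘ₗ (π ∘ₗ a.gproj i).codRestrict _ hmem, fun j hj x hx => ?_, fun n => ?_⟩, ?_⟩
    · refine (congrArg g (Subtype.ext ?_)).trans (map_zero g)
      change π (a.gproj i x) = 0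
      rw [a.gproj_of_ne hj hx, map_zero]
    · have : (π ∘ₗ a.gproj i).compMultilinearMap (a.br n) = 0 := a.multilinear_ext fun z => by
        have h := a.br_mem n (fun j => (z j).1) (a.vals z) fun j => (z j).2.2
        change π (a.gproj i _) = 0
        rw [a.gproj_of_mem' i h]
        split_ifs
        · exact h3 _ _
        · exact map_zero π
      exact fun x => (congrArg g (Subtype.ext (congrArg (fun f => f x) this))).trans (map_zero g)
    · refine LinearMap.ext ?_
      rintro ⟨_, x, hx, rfl⟩
      refine congrArg g (Subtype.ext ?_)
      change π (a.gproj i (π x)) = π x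
      rw [a.gproj_of_mem (h1 i x hx), projection_idem h2 h3]

end Forward

/-! ### The isomorphism with the free Lie algebra -/

section Main

variable {k : Type u} [Field k] [CharZero k] {A : Type v} [AddCommGroup A] [Module k A]
  {a : LInftyAlg k A} (hmin : a.IsMinimal) (hpos : a.IsPositive)

include hpos in
/-- An algebra with linear cohomology is isomorphic to the Lie algebra given by its binary bracket,
which is free on a complement of the brackets. -/
theorem exists_isFreeLieOn_of_cohomologyIsLinear (hlin : a.CohomologyIsLinear) :
    ∃ V : ℤ × ℤ → Submodule k A, (a.quad hmin).IsFreeLieOn V ∧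
      (∀ i, Function.Bijective (a.restrictCocycles i (V i))) ∧
      ∃ f : LInftyHom a (a.quad hmin), f.IsIso := by
  obtain ⟨π, h1, h2, h3⟩ := a.exists_projection_along_brAt
  have hG := quad_generated hmin hpos hlin h1 h2 h3
  refine ⟨fun i => (a.gr i).map π, isFreeLieOn_of_hasLieExtension (quad_isStrictLie a hmin) hpos
    (fun i => by rintro _ ⟨x, hx, rfl⟩; exact h1 i x hx)
    (quad_hasLieExtension hmin hpos hlin h1 h2 h3) hG,
    restrictCocycles_bijective h1 h2 h3, ?_⟩
  obtain ⟨f, hf⟩ := exists_lInftyHom (b := a.quad hmin) hpos (quad_isStrictLie a hmin)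
    (φ := LinearMap.id) (fun _ _ hx => hx) h1 (projection_idem h2 h3) h3 (hmin.isExactAt hlin)
  -- Both are Lie homomorphisms of `quad` that agree on the generators.
  have hid : f.linear = LinearMap.id := by
    refine IsPositive.hom_ext (a := a.quad hmin) (b := a.quad hmin) hpos hG
      (f.linear_lie hmin (quad_isStrictLie a hmin)) (fun _ _ => rfl) ?_
    rintro i _ ⟨x, -, rfl⟩
    exact hf x
  refine ⟨f, ?_⟩
  change Function.Bijective f.linear
  rw [hid]
  exact Function.bijective_id

end Main

end LInftyAlg

namespace LInftyAlg

/-! ### Transport of freeness along isomorphisms -/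

section Transport

variable {k : Type u} [Field k] {A L : Type v} [AddCommGroup A] [Module k A] [AddCommGroup L]
  [Module k L] {a : LInftyAlg k A} {l : LInftyAlg k L} {F : A →ₗ[k] L}

/-- An injective degree-preserving linear map reflects degrees. -/
theorem mem_gr_of_map_mem (hF : ∀ i, ∀ x ∈ a.gr i, F x ∈ l.gr i) (hinj : Function.Injective F)
    {i : ℤ × ℤ} {x : A} (hx : F x ∈ l.gr i) : x ∈ a.gr i := by
  have h : F (a.gproj i x) = l.gproj i (F x) := by
    refine a.homogeneous_induction (P := fun x => F (a.gproj i x) = l.gproj i (F x))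
      (fun j x hx => ?_) (fun x y h h' => by simp only [map_add, h, h']) x
    rw [a.gproj_of_mem' i hx, l.gproj_of_mem' i (hF j x hx)]
    split_ifs
    · rfl
    · exact map_zero F
  rw [l.gproj_of_mem hx] at h
  rw [← hinj h]
  exact a.gproj_mem i x

/-- Freeness is transported along isomorphisms of Lie algebras. -/
theorem IsFreeLieOn.comap (ha : a.IsStrictLie) (hpos : a.IsPositive)
    (hF : ∀ i, ∀ x ∈ a.gr i, F x ∈ l.gr i) (hlie : ∀ x y, F (a.lie x y) = l.lie (F x) (F y))
    (hbij : Function.Bijective F) {U : ℤ × ℤ → Submodule k L} (hU : l.IsFreeLieOn U) :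
    a.IsFreeLieOn fun i => (U i).comap F := by
  let E := LinearEquiv.ofBijective F hbij
  have hE : ∀ x, F (E.symm x) = x := fun x => E.apply_symm_apply x
  have hmem : ∀ i x, x ∈ l.gr i → E.symm x ∈ a.gr i := fun i x hx =>
    mem_gr_of_map_mem hF hbij.1 (by rwa [hE])
  refine isFreeLieOn_of_hasLieExtension ha hpos
    (fun i x hx => mem_gr_of_map_mem hF hbij.1 (hU.2.1 i hx)) (fun B _ _ b hb φ hφ => ?_)
    fun i x hx => ?_
  · obtain ⟨G, hG, hGφ⟩ := hU.hasLieExtension B b hb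
      (fun i => φ i ∘ₗ (E.symm.toLinearMap ∘ₗ (U i).subtype).codRestrict ((U i).comap F)
        fun y => by
          change F (E.symm y) ∈ U i
          rw [hE]
          exact y.2)
      fun i y => hφ i _
    refine ⟨G ∘ₗ F, isStrictHom_of_lie ha hb (fun i x hx => hG.1 i _ (hF i x hx)) fun x y => ?_,
      fun i y => (hGφ i ⟨F y, y.2⟩).trans (congrArg (φ i) (Subtype.ext (E.symm_apply_apply y)))⟩
    rw [LinearMap.comp_apply, hlie, lie_apply, hG.2, br_two]
    rfl
  · obtain ⟨y, hy, z, hz, hyz⟩ := Submodule.mem_sup.1 (hU.gr_le i (hF i x hx))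
    have hx' : x = E.symm y + E.symm z := by
      rw [← map_add, hyz]
      exact (E.symm_apply_apply x).symm
    rw [hx']
    refine Submodule.add_mem_sup (by rwa [Submodule.mem_comap, hE]) ?_
    have : l.decAt i ≤ (a.decAt i).comap E.symm.toLinearMap := by
      refine Submodule.span_le.2 ?_
      rintro _ ⟨i₁, i₂, hi, x, hx, y, hy, rfl⟩
      refine Submodule.subset_span ⟨i₁, i₂, hi, _, hmem _ x hx, _, hmem _ y hy, hbij.1 ?_⟩
      change F (a.lie (E.symm x) (E.symm y)) = F (E.symm (l.lie x y))
      rw [hlie, hE, hE, hE]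
    exact this hz

end Transport

/-! ### Comparison of closed linear forms by dimension -/

section Dimension

variable {k : Type u} [Field k] {A : Type v} [AddCommGroup A] [Module k A]

theorem linearCocycles_le_quad (a : LInftyAlg k A) (hmin : a.IsMinimal) (i : ℤ × ℤ) :
    a.linearCocycles i ≤ (a.quad hmin).linearCocycles i := by
  refine fun g hg => ⟨hg.1, fun n x => ?_⟩
  by_cases hn : n = 2
  · subst hn
    exact hg.2 2 x
  · rw [quad_isStrictLie a hmin n hn, _root_.zero_apply, map_zero]

/-- A linear isomorphism of the linear cohomology with the dual of free generators of the binary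
bracket shows that the closed linear forms are those of the binary bracket. -/
theorem quad_linearCocycles_le {a : LInftyAlg k A} (hmin : a.IsMinimal)
    {V : ℤ × ℤ → Submodule k A} (hV : (a.quad hmin).IsFreeLieOn V) (i : ℤ × ℤ)
    [FiniteDimensional k (V i)]
    (h : Module.finrank k (V i) ≤ Module.finrank k (a.linearCocycles i)) :
    (a.quad hmin).linearCocycles i ≤ a.linearCocycles i := by
  have hinj := (a.quad hmin).restrictCocycles_injective
    ((hV.gr_le i).trans (sup_le_sup_left ((a.quad hmin).decAt_le_brAt i) _))
  have : FiniteDimensional k ((a.quad hmin).linearCocycles i) :=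
    FiniteDimensional.of_injective _ hinj
  refine (Submodule.eq_of_le_of_finrank_le (a.linearCocycles_le_quad hmin i) (le_trans ?_ h)).ge
  exact (LinearMap.finrank_le_finrank_of_injective hinj).trans Subspace.dual_finrank_eq.le

end Dimension

end LInftyAlg

theorem mainTheorem2 {k : Type u} [Field k] [CharZero k] {A : Type v} [AddCommGroup A]
    [Module k A] (a : LInftyAlg k A) (hfin : ∀ i, FiniteDimensional k (a.gr i))
    (hmin : a.IsMinimal) (hpos : a.IsPositive) :
    (a.IsStrictLie → ((∃ V : ℤ × ℤ → Submodule k A, a.IsFreeLieOn V) ↔ a.CohomologyIsLinear)) ∧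
    ((∃ (L : Type v) (_ : AddCommGroup L) (_ : Module k L) (l : LInftyAlg k L)
        (V : ℤ × ℤ → Submodule k L), l.IsFreeLieOn V ∧
        (∀ p q : ℤ, Nonempty
          (a.arityCohomology 1 p q ≃ₗ[k] Module.Dual k (V (1 - p, -q)))) ∧
        ∃ f : LInftyHom a l, f.IsIso) ↔
      a.CohomologyIsLinear) := by
  refine ⟨fun ha => ⟨?_, fun h => ?_⟩, ?_, fun h => ?_⟩
  · rintro ⟨V, hV⟩
    refine LInftyAlg.cohomologyIsLinear_of_quad_isFreeLieOn hmin hpos (V := V) ?_ fun i => ?_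
    · rwa [ha.quad_eq]
    · rw [ha.quad_eq]
  · obtain ⟨V, hV, -⟩ := LInftyAlg.exists_isFreeLieOn_of_cohomologyIsLinear hmin hpos h
    rw [ha.quad_eq] at hV
    exact ⟨V, hV⟩
  -- The cohomology is not transported along f. Its linear part makes `quad` free, and the
  -- isomorphism of H^(1) with the dual of the generators gives the dimension count that closes the
  -- gap between `quad` and `a`.
  · rintro ⟨L, _, _, l, U, hU, hdim, f, hf⟩
    have hbij : Function.Bijective f.linear := hf
    have hV : (a.quad hmin).IsFreeLieOn fun i => (U i).comap f.linear :=
      hU.comap (LInftyAlg.quad_isStrictLie a hmin) hpos (fun i x hx => f.linear_mem hx)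
        (f.linear_lie hmin hU.1) hbij
    refine LInftyAlg.cohomologyIsLinear_of_quad_isFreeLieOn hmin hpos hV fun i => ?_
    have : FiniteDimensional k ((U i).comap f.linear) :=
      Submodule.finiteDimensional_of_le (S₂ := a.gr i) (hV.2.1 i)
    refine LInftyAlg.quad_linearCocycles_le hmin hV i ?_
    have e : (U i).comap f.linear ≃ₗ[k] U i :=
      (LinearEquiv.ofBijective f.linear hbij).submoduleMap _ |>.trans
        (LinearEquiv.ofEq _ _ (Submodule.map_comap_eq_of_surjective hbij.2 _))
    -- A linear form supported on elements of degree i has bidegree (1 - i.1, -i.2) because of the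
    -- shift.
    obtain ⟨e₁⟩ := hmin.nonempty_linearCocycles_equiv (1 - i.1) (-i.2)
    obtain ⟨e₂⟩ := hdim (1 - i.1) (-i.2)
    have hi : ((1 - (1 - i.1), - -i.2) : ℤ × ℤ) = i := by simp
    rw [hi] at e₁ e₂
    rw [(e₁.trans e₂).finrank_eq, e.finrank_eq, Subspace.dual_finrank_eq]
  · obtain ⟨V, hV, hbij, f, hf⟩ := LInftyAlg.exists_isFreeLieOn_of_cohomologyIsLinear hmin hpos h
    refine ⟨A, inferInstance, inferInstance, a.quad hmin, V, hV, fun p q => ?_, f, hf⟩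
    obtain ⟨e⟩ := hmin.nonempty_linearCocycles_equiv p q
    exact ⟨e.symm.trans (LinearEquiv.ofBijective _ (hbij _))⟩
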